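/- Let $\delta\neq 0$ be a real number. For $k,l\in\mathbb N_0$ let $\mathbf{Part}_\delta(k,l)$ be the complex vector space with basis the set $\mathscr P(k,l)$ of all partitions of $k$ upper and $l$ lower points, with the usual operations: tensor product (placing side by side, extended bilinearly), composition $qp$ (putting $q$ below $p$ and multiplying by $\delta$ for every middle block connected to no upper or lower point, extended bilinearly) and involution (horizontal reflection, extended antilinearly). A linear category of partitions is a collection $\mathscr K$ of linear subspaces $\mathscr K(k,l)\subseteq\mathbf{Part}_\delta(k,l)$ that is closed under these operations and contains the identity partition in $\mathscr K(1,1)$ and the pair partition in $\mathscr K(0,2)$; $\langle p_1,\dots,p_n\rangle_\delta$ denotes the smallest one containing $p_1,\dots,p_n$. It is called easy if each $\mathscr K(k,l)$ is the linear span of a set of partitions, and non-easy otherwise. Let $\mathsf{a}=\uparrow\in\mathscr P(0,1)$ be the singleton, let $b_n\in\mathscr P(0,n)$ be the partition of $n$ lower points with a single block, and let $\mathsf{abac}\in\mathscr P(0,4)$ be the partition with blocks $\{1,3\},\{2\},\{4\}$. Put $\pi_{(\delta)}=\mathrm{id}-\frac1\delta d\in\mathbf{Part}_\delta(1,1)$,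 where $\mathrm{id}\in\mathscr P(1,1)$ is the identity partition and $d\in\mathscr P(1,1)$ is the partition with two singleton blocks, and $\mathcal P_{(\delta)}p=\pi_{(\delta)}^{\otimes l}\,p\,\pi_{(\delta)}^{\otimes k}$ for $p\in\mathbf{Part}_\delta(k,l)$. Let $\mathbf{NCPart}_\delta(k,l)$ be the linear span of all non-crossing partitions in $\mathscr P(k,l)$. Then $$\begin{matrix} \langle \mathcal P_{(\delta)}b_3,\uparrow\otimes\uparrow\rangle_\delta&\subsetneq&\langle \mathcal P_{(\delta)}b_3,\mathsf{abac}\rangle_\delta&\subsetneq&\langle \mathcal P_{(\delta)}b_3,\uparrow\rangle_\delta=\mathbf{NCPart}_\delta\\ \cup\!\!\!\!\!{\scriptstyle\neq}&&\cup\!\!\!\!\!{\scriptstyle\neq}&&\cup\!\!\!\!\!{\scriptstyle\neq}\\ \langle \mathcal P_{(\delta)}b_4,\uparrow\otimes\uparrow\rangle_\delta&\subsetneq&\langle \mathcal P_{(\delta)}b_4,\mathsf{abac}\rangle_\delta&\subsetneq&\langle \mathcal P_{(\delta)}b_4,\uparrow\rangle_\delta \end{matrix}$$ where each category in the second row is strictly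 contained in the one above it. The six categories are mutually distinct. The category $\langle \mathcal P_{(\delta)}b_3,\uparrow\rangle_\delta=\mathbf{NCPart}_\delta$ is easy, and the other five are non-easy. -/

import Mathlib

noncomputable section

namespace PartCat

/-- `𝒫(k,l)`: the partitions of the set of `k` upper points and `l` lower points, given by the
equivalence relation "lies in the same block". -/
abbrev Partn (k l : ℕ) : Type := Setoid (Fin k ⊕ Fin l)

/-- Formal complex linear combinations of partitions of `k` upper and `l` lower points. -/
abbrev Part (k l : ℕ) : Type := Partn k l →₀ ℂ

/-- A partition as an element of the vector space it spans. -/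
def toPart {k l : ℕ} (p : Partn k l) : Part k l := Finsupp.single p 1

/-! ### Operations on partitions -/

/-- The block of `p`, resp. of `q`, that contains a given point of the side-by-side picture of
`p` (left) and `q` (right). -/
def tensorBlock {k l k' l' : ℕ} (p : Partn k l) (q : Partn k' l') :
    Fin (k + k') ⊕ Fin (l + l') → Quotient p ⊕ Quotient q :=
  Sum.elim
    (Fin.addCases (fun i => Sum.inl (Quotient.mk p (Sum.inl i)))
      (fun i => Sum.inr (Quotient.mk q (Sum.inl i))))
    (Fin.addCases (fun j => Sum.inl (Quotient.mk p (Sum.inr j)))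
      (fun j => Sum.inr (Quotient.mk q (Sum.inr j))))

/-- Tensor product of two partitions: `p` and `q` side by side. -/
def tensorPartn {k l k' l' : ℕ} (p : Partn k l) (q : Partn k' l') : Partn (k + k') (l + l') :=
  Setoid.ker (tensorBlock p q)

/-- The partition of three rows of points (upper, middle, lower) obtained by drawing `q` below `p`
and identifying the lower row of `p` with the upper row of `q`. -/
def stack {k l m : ℕ} (q : Partn l m) (p : Partn k l) : Setoid (Fin k ⊕ (Fin l ⊕ Fin m)) :=
  Setoid.map p (Sum.map id Sum.inl) ⊔ Setoid.map q Sum.inr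

/-- The inclusion of the upper and the lower row into the three rows. -/
def outer {k l m : ℕ} : Fin k ⊕ Fin m → Fin k ⊕ (Fin l ⊕ Fin m) :=
  Sum.map id Sum.inr

/-- The partition underlying the composition `q p` (`q` below `p`). -/
def compPartn {k l m : ℕ} (q : Partn l m) (p : Partn k l) : Partn k m :=
  Setoid.comap outer (stack q p)

/-- The number of blocks of the stacked picture that contain no upper and no lower point. -/
def loops {k l m : ℕ} (q : Partn l m) (p : Partn k l) : ℕ :=
  Nat.card {c : Quotient (stack q p) // ∀ x : Fin k ⊕ Fin m, c ≠ Quotient.mk (stack q p) (outer x)}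

/-- Reflection of a partition at the horizontal axis. -/
def starPartn {k l : ℕ} (p : Partn k l) : Partn l k :=
  Setoid.comap Sum.swap p

/-- Tensor product, extended bilinearly. -/
def tensor {k l k' l' : ℕ} (x : Part k l) (y : Part k' l') : Part (k + k') (l + l') :=
  x.sum fun p a => y.sum fun q b => Finsupp.single (tensorPartn p q) (a * b)

/-- Composition `y x` (`y` below `x`) with loop parameter `δ`, extended bilinearly. -/
def comp (δ : ℂ) {k l m : ℕ} (y : Part l m) (x : Part k l) : Part k m :=
  y.sum fun q b => x.sum fun p a => Finsupp.single (compPartn q p) (δ ^ loops q p * (b * a))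

/-- Involution, extended antilinearly. -/
def invol {k l : ℕ} (x : Part k l) : Part l k :=
  x.sum fun p a => Finsupp.single (starPartn p) (starRingEnd ℂ a)

/-! ### Particular partitions -/

/-- The partition with `n` lower points (and no upper points) represented by a word of length `n`:
two points lie in the same block if and only if they carry the same letter. -/
def word {n : ℕ} (w : Fin n → ℕ) : Part 0 n :=
  toPart (Setoid.ker (Sum.elim Fin.elim0 w))

/-- The identity partition: one upper point connected with one lower point. -/
def idPart : Part 1 1 := toPart ⊤

/-- One upper and one lower point, not connected. -/
def disconnecter : Part 1 1 := toPart ⊥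

/-- The pair partition `aa`. -/
def pair : Part 0 2 := word ![0, 0]

/-- The singleton `↑`. -/
def singleton : Part 0 1 := word ![0]

/-- The three-block `aaa`. -/
def block3 : Part 0 3 := word ![0, 0, 0]

/-- The four-block `aaaa`. -/
def block4 : Part 0 4 := word ![0, 0, 0, 0]

/-- The partition `abac`. -/
def abac : Part 0 4 := word ![0, 1, 0, 2]

/-! ### Linear categories of partitions -/

/-- Collections of linear subspaces `K(k,l) ⊆ Part_δ(k,l)`, ordered by inclusion. -/
abbrev Family : Type := ∀ k l : ℕ, Submodule ℂ (Part k l)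

/-- `K` is a linear category of partitions with loop parameter `δ`. -/
structure IsLinearCategory (δ : ℂ) (K : Family) : Prop where
  id_mem : idPart ∈ K 1 1
  pair_mem : pair ∈ K 0 2
  tensor_mem : ∀ {k l k' l' : ℕ} {x : Part k l} {y : Part k' l'},
    x ∈ K k l → y ∈ K k' l' → tensor x y ∈ K (k + k') (l + l')
  comp_mem : ∀ {k l m : ℕ} {y : Part l m} {x : Part k l},
    y ∈ K l m → x ∈ K k l → comp δ y x ∈ K k m
  invol_mem : ∀ {k l : ℕ} {x : Part k l}, x ∈ K k l → invol x ∈ K l k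

/-- `⟨x, y⟩_δ`: the smallest linear category of partitions that contains `x` and `y`. -/
def generated (δ : ℂ) {k l k' l' : ℕ} (x : Part k l) (y : Part k' l') : Family :=
  sInf {K | IsLinearCategory δ K ∧ x ∈ K k l ∧ y ∈ K k' l'}

theorem mem_generated {δ : ℂ} {k l k' l' : ℕ} {x : Part k l} {y : Part k' l'} {m n : ℕ}
    {z : Part m n} : z ∈ generated δ x y m n ↔
      ∀ K : Family, IsLinearCategory δ K → x ∈ K k l → y ∈ K k' l' → z ∈ K m n := by
  simp [generated, sInf_apply, Submodule.mem_iInf]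

theorem isLinearCategory_generated (δ : ℂ) {k l k' l' : ℕ} (x : Part k l) (y : Part k' l') :
    IsLinearCategory δ (generated δ x y) where
  id_mem := mem_generated.2 fun _ h _ _ => h.id_mem
  pair_mem := mem_generated.2 fun _ h _ _ => h.pair_mem
  tensor_mem hu hv := mem_generated.2 fun K h hx hy =>
    h.tensor_mem (mem_generated.1 hu K h hx hy) (mem_generated.1 hv K h hx hy)
  comp_mem hu hv := mem_generated.2 fun K h hx hy =>
    h.comp_mem (mem_generated.1 hu K h hx hy) (mem_generated.1 hv K h hx hy)
  invol_mem hu := mem_generated.2 fun K h hx hy =>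
    h.invol_mem (mem_generated.1 hu K h hx hy)

/-- `K` is easy if every `K(k,l)` is spanned by a set of partitions. -/
def IsEasy (K : Family) : Prop :=
  ∀ k l : ℕ, ∃ C : Set (Partn k l), K k l = Submodule.span ℂ (toPart '' C)

/-! ### Non-crossing partitions -/

/-- Position of a point when one walks around the picture: the upper row from left to right, then
the lower row from right to left. -/
def circlePos {k l : ℕ} : Fin k ⊕ Fin l → ℕ :=
  Sum.elim (fun i => (i : ℕ)) (fun j => k + (Fin.rev j : ℕ))

/-- A partition is non-crossing if no two distinct blocks cross. -/
def IsNonCrossing {k l : ℕ} (p : Partn k l) : Prop :=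
  ∀ a b c d : Fin k ⊕ Fin l, circlePos a < circlePos b → circlePos b < circlePos c →
    circlePos c < circlePos d → p a c → p b d → p a b

/-- `NCPart_δ`: the linear spans of all non-crossing partitions. -/
def NCPart : Family :=
  fun k l => Submodule.span ℂ (toPart '' {p : Partn k l | IsNonCrossing p})

/-! ### The map `𝒫_(δ)` -/

/-- `π_(δ) = id - (1/δ) · (disconnected pair of points)`. -/
def projOne (δ : ℂ) : Part 1 1 := idPart - (1 / δ) • disconnecter

/-- Tensor powers; the zeroth power is the empty partition. -/
def tensorPow (x : Part 1 1) : (n : ℕ) → Part n n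
  | 0 => toPart ⊤
  | n + 1 => tensor (tensorPow x n) x

/-- `𝒫_(δ) x = π_(δ)^{⊗ l} x π_(δ)^{⊗ k}` for `x ∈ Part_δ(k,l)`. -/
def proj (δ : ℂ) {k l : ℕ} (x : Part k l) : Part k l :=
  comp δ (tensorPow (projOne δ) l) (comp δ x (tensorPow (projOne δ) k))

end PartCat

end

/-!
The inclusions come from explicit constructions, the strictness from three linear categories that
contain the generators on one side and miss an element on the other.

**Algebra.** Colour the points of a partition `p` by two labels and record which labellings are
constant on blocks. This gives a 0-1 matrix `transfer p` that determines `p`, and composition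
becomes the matrix product up to the factor `2 ^ loops` (`transfer_mul`). So associativity, the
interchange law and the compatibility with the involution, *including the loop counts*, are read off
from matrix identities (`transfer_injective`), and they extend bilinearly to every `δ`. Concrete
compositions are computed in the same way, by looking at labellings.

**Obstructions.** The projections `π = π_(δ)` and `ρ = δ⁻¹ d` (with `d` the disconnected pair of
points) are orthogonal idempotents with sum `id`, and `ρ` fixes the singleton.
* `± (π - ρ)` is a self-adjoint involution, and the elements that intertwine its tensor powers form a
  linear category (`intertwiners`). With the sign `+` it contains `𝒫 b₃` and `abac`, but not the
  singleton; with the sign `-` it contains `𝒫 b₄` and the singleton, but not `𝒫 b₃`, which has an odd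
  number of legs and is nonzero.
* To separate `abac` from `⟨𝒫 b₃, ↑ ⊗ ↑⟩`, write a row as a word in the colours `π`, `ρ`. The
  blocks may join points of colour `ρ` only with points of colour `ρ`, and points of colour `π` only
  with points of colour `π` that have equally many `ρ`-coloured points modulo 2 to their left; the
  numbers of `ρ`-coloured points in both rows must agree modulo 2 (`RespectsLabels`). Compressed by
  the colour projections, these partitions span a linear category (`alternating`). It contains
  `𝒫 b₃` and `↑ ⊗ ↑`. For the word `π ρ π ρ` the first point must be isolated, so the compression
  vanishes on this category; but it does not vanish on `abac`.

**Non-easiness.** An easy category contains each partition that occurs in one of its elements, and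
`b_n` occurs with coefficient `1` in `𝒫 b_n` (`proj_toPart_apply`). Capping `b₃` gives the
singleton, and capping `b₄` with a singleton gives `b₃`, both of which were excluded.

**Inclusions.** Contracting the middle legs of `𝒫 b₃ ⊗ 𝒫 b₃` gives `𝒫 b₄` up to a multiple of
`𝒫 (pair ⊗ pair)` (`IsLinearCategory.proj_block4_mem`), so each category of the second row lies in
the one above it.

**Noncrossing partitions.** They are closed under composition because the middle points can be
glued one pair of neighbours after the other on a line (`exists_partial_glue`). They are generated
by the singleton and `b₃` because a noncrossing partition has an isolated point or two neighbouring
points in one block, so that it arises from a smaller one by inserting or doubling a point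
(`IsLinearCategory.toPart_mem_of_isNonCrossing`).
-/

noncomputable section

namespace PartCat

/-! ### Labellings and transfer matrices -/

/-- The labelling of the upper points by `x` and of the lower points by `y` is constant on the blocks
of `p`. -/
def Compat {k l : ℕ} {β : Type*} (p : Partn k l) (x : Fin k → β) (y : Fin l → β) : Prop :=
  p ≤ Setoid.ker (Sum.elim x y)

theorem map_le_iff {α β : Type*} {r : Setoid α} {f : α → β} {s : Setoid β} :
    Setoid.map r f ≤ s ↔ r ≤ Setoid.comap f s := by
  refine ⟨fun h => Setoid.le_comap_map.trans fun a b hab => h hab, fun h => ?_⟩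
  refine Setoid.eqvGen_le ?_
  rintro _ _ ⟨a, b, hab, rfl, rfl⟩
  exact h hab

theorem stack_le_ker_iff {k l m : ℕ} {q : Partn l m} {p : Partn k l} {β : Type*} {x : Fin k → β}
    {y : Fin l → β} {z : Fin m → β} :
    stack q p ≤ Setoid.ker (Sum.elim x (Sum.elim y z)) ↔ Compat p x y ∧ Compat q y z := by
  have h : Setoid.comap (Sum.map id Sum.inl) (Setoid.ker (Sum.elim x (Sum.elim y z))) =
      Setoid.ker (Sum.elim x y) := by
    ext a b
    rcases a with a | a <;> rcases b with b | b <;> rfl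
  rw [stack, sup_le_iff, map_le_iff, map_le_iff, h]
  rfl

theorem elim_outer {k l m : ℕ} {β : Type*} (x : Fin k → β) (y : Fin l → β) (z : Fin m → β)
    (a : Fin k ⊕ Fin m) : Sum.elim x (Sum.elim y z) (outer a) = Sum.elim x z a := by
  rcases a with a | a <;> rfl

theorem Compat.comp {k l m : ℕ} {q : Partn l m} {p : Partn k l} {β : Type*} {x : Fin k → β}
    {y : Fin l → β} {z : Fin m → β} (hp : Compat p x y) (hq : Compat q y z) :
    Compat (compPartn q p) x z := by
  intro a b hab
  have := stack_le_ker_iff.2 ⟨hp, hq⟩ hab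
  rwa [Setoid.ker_def, elim_outer, elim_outer] at this

/-- Labellings of the middle row that extend a labelling of the outer rows of a stacked picture
amount to a choice of one label for each loop. -/
theorem card_extensions {k l m : ℕ} (q : Partn l m) (p : Partn k l) (x : Fin k → Bool)
    (z : Fin m → Bool) (h : Compat (compPartn q p) x z) :
    Nat.card {y : Fin l → Bool // Compat p x y ∧ Compat q y z} = 2 ^ loops q p := by
  classical
  have hF : ∀ y : {y : Fin l → Bool // Compat p x y ∧ Compat q y z},
      stack q p ≤ Setoid.ker (Sum.elim x (Sum.elim y.1 z)) := fun y => stack_le_ker_iff.2 y.2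
  let F : {y : Fin l → Bool // Compat p x y ∧ Compat q y z} →
      ({c : Quotient (stack q p) // ∀ x : Fin k ⊕ Fin m, c ≠ Quotient.mk (stack q p) (outer x)}
        → Bool) :=
    fun y c => Quotient.lift (Sum.elim x (Sum.elim y.1 z)) (fun a b hab => hF y hab) c.1
  have hbij : Function.Bijective F := by
    constructor
    · intro y y' hyy
      ext j
      by_cases hj : ∀ a : Fin k ⊕ Fin m,
          Quotient.mk (stack q p) (Sum.inr (Sum.inl j)) ≠ Quotient.mk (stack q p) (outer a)
      · exact congrFun hyy ⟨_, hj⟩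
      · push Not at hj
        obtain ⟨a, ha⟩ := hj
        have h1 := hF y (Quotient.exact ha)
        have h2 := hF y' (Quotient.exact ha)
        rw [Setoid.ker_def, elim_outer] at h1 h2
        exact h1.trans h2.symm
    · intro g
      -- Extend the outer labels and the labels `g` of the loops to a labelling of all blocks.
      let H : Quotient (stack q p) → Bool := fun c =>
        if hc : ∀ a : Fin k ⊕ Fin m, c ≠ Quotient.mk (stack q p) (outer a) then g ⟨c, hc⟩
        else Sum.elim x z (not_forall_not.1 hc).choose
      have Hout : ∀ a : Fin k ⊕ Fin m, H (Quotient.mk _ (outer a)) = Sum.elim x z a := by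
        intro a
        have hc : ¬ ∀ b : Fin k ⊕ Fin m,
            Quotient.mk (stack q p) (outer a) ≠ Quotient.mk (stack q p) (outer b) :=
          fun hc => hc a rfl
        simp only [H, dif_neg hc]
        exact (h (show stack q p (outer a) (outer _) from
          Quotient.exact (not_forall_not.1 hc).choose_spec)).symm
      have Hall : Sum.elim x (Sum.elim (fun j => H (Quotient.mk _ (Sum.inr (Sum.inl j)))) z) =
          H ∘ Quotient.mk _ := by
        funext a
        rcases a with a | a | a
        · exact (Hout (Sum.inl a)).symm
        · rfl
        · exact (Hout (Sum.inr a)).symm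
      have hle : stack q p ≤ Setoid.ker
          (Sum.elim x (Sum.elim (fun j => H (Quotient.mk _ (Sum.inr (Sum.inl j)))) z)) := by
        intro a b hab
        rw [Setoid.ker_def, Hall]
        exact congrArg H (Quotient.sound hab)
      refine ⟨⟨_, stack_le_ker_iff.1 hle⟩, ?_⟩
      funext ⟨c, hc⟩
      induction c using Quotient.inductionOn with
      | h a =>
        refine (congrFun Hall a).trans ?_
        simp only [Function.comp, H]
        exact dif_pos hc
  rw [Nat.card_congr (Equiv.ofBijective F hbij), loops, Nat.card_fun]
  simp

open scoped Classical in
/-- The transfer matrix of a partition, with labels in `Bool`: the entry at `(x, y)` tells whether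
the labelling `x` of the upper row and `y` of the lower row is constant on blocks. -/
def transfer {k l : ℕ} (p : Partn k l) : Matrix (Fin k → Bool) (Fin l → Bool) ℕ :=
  Matrix.of fun x y => if Compat p x y then 1 else 0

theorem transfer_of_compat {k l : ℕ} {p : Partn k l} {x : Fin k → Bool} {y : Fin l → Bool}
    (h : Compat p x y) : transfer p x y = 1 := by simp [transfer, h]

theorem transfer_of_not_compat {k l : ℕ} {p : Partn k l} {x : Fin k → Bool} {y : Fin l → Bool}
    (h : ¬ Compat p x y) : transfer p x y = 0 := by simp [transfer, h]

theorem transfer_eq_one_iff {k l : ℕ} {p : Partn k l} {x : Fin k → Bool} {y : Fin l → Bool} :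
    transfer p x y = 1 ↔ Compat p x y := by simp [transfer]

/-- With two labels the loop parameter is `2`. -/
theorem transfer_mul {k l m : ℕ} (q : Partn l m) (p : Partn k l) :
    transfer p * transfer q = 2 ^ loops q p • transfer (compPartn q p) := by
  classical
  ext x z
  have h1 : (transfer p * transfer q) x z =
      Nat.card {y : Fin l → Bool // Compat p x y ∧ Compat q y z} := by
    rw [Matrix.mul_apply, Nat.card_eq_fintype_card, Fintype.card_subtype, Finset.card_filter]
    refine Finset.sum_congr rfl fun y _ => ?_
    by_cases hp : Compat p x y <;> by_cases hq : Compat q y z <;> simp [transfer, hp, hq]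
  rw [h1, Matrix.smul_apply]
  by_cases h : Compat (compPartn q p) x z
  · rw [card_extensions q p x z h, transfer_of_compat h]
    simp
  · rw [transfer_of_not_compat h, smul_zero]
    have : IsEmpty {y : Fin l → Bool // Compat p x y ∧ Compat q y z} :=
      ⟨fun y => h (y.2.1.comp y.2.2)⟩
    exact Nat.card_of_isEmpty

theorem compat_const {k l : ℕ} {β : Type*} (p : Partn k l) (b : β) :
    Compat p (fun _ => b) (fun _ => b) := by
  intro a b _
  rw [Setoid.ker_def]
  rcases a with a | a <;> rcases b with b | b <;> rfl

/-- The indicator of a block is a compatible labelling, so two labels suffice to detect blocks. -/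
theorem le_of_compat {k l : ℕ} {p p' : Partn k l}
    (h : ∀ (x : Fin k → Bool) (y : Fin l → Bool), Compat p x y → Compat p' x y) : p' ≤ p := by
  classical
  intro a b hab
  have e : ∀ c, Sum.elim (fun i => decide (p a (Sum.inl i)))
      (fun i => decide (p a (Sum.inr i))) c = decide (p a c) := by rintro (c | c) <;> rfl
  have h1 : Compat p (fun i => decide (p a (Sum.inl i)))
      (fun i => decide (p a (Sum.inr i))) := by
    intro c d hcd
    rw [Setoid.ker_def, e, e, decide_eq_decide]
    exact ⟨fun h => p.trans' h hcd, fun h => p.trans' h (p.symm' hcd)⟩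
  have h2 := h _ _ h1 hab
  rw [Setoid.ker_def, e, e, decide_eq_decide] at h2
  exact h2.1 (p.refl' a)

theorem ext_compat {k l : ℕ} {p p' : Partn k l}
    (h : ∀ (x : Fin k → Bool) (y : Fin l → Bool), Compat p x y ↔ Compat p' x y) : p = p' :=
  le_antisymm (le_of_compat fun x y => (h x y).2) (le_of_compat fun x y => (h x y).1)

/-- A partition and a power of `2` are determined by the rescaled transfer matrix. -/
theorem transfer_injective {k l : ℕ} {p p' : Partn k l} {c c' : ℕ}
    (h : 2 ^ c • transfer p = 2 ^ c' • transfer p') : c = c' ∧ p = p' := by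
  have hc : c = c' := by
    have := congrFun (congrFun h fun _ => true) fun _ => true
    rw [Matrix.smul_apply, Matrix.smul_apply, transfer_of_compat (compat_const _ _),
      transfer_of_compat (compat_const _ _)] at this
    simpa using this
  refine ⟨hc, ext_compat fun x y => ?_⟩
  subst hc
  have := congrFun (congrFun h x) y
  rw [Matrix.smul_apply, Matrix.smul_apply, smul_eq_mul, smul_eq_mul] at this
  have := Nat.eq_of_mul_eq_mul_left (by positivity) this
  rw [← transfer_eq_one_iff, ← transfer_eq_one_iff, this]

theorem compat_compPartn_iff {k l m : ℕ} {q : Partn l m} {p : Partn k l} {x : Fin k → Bool}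
    {z : Fin m → Bool} : Compat (compPartn q p) x z ↔ ∃ y, Compat p x y ∧ Compat q y z := by
  refine ⟨fun h => ?_, fun ⟨y, hp, hq⟩ => hp.comp hq⟩
  have h1 := card_extensions q p x z h
  have : 0 < Nat.card {y : Fin l → Bool // Compat p x y ∧ Compat q y z} := by
    rw [h1]; positivity
  obtain ⟨⟨y, hy⟩⟩ := (Nat.card_pos_iff.1 this).1
  exact ⟨y, hy⟩

theorem compPartn_eq {k l m : ℕ} {q : Partn l m} {p : Partn k l} {r : Partn k m}
    (h : ∀ x z, Compat r x z ↔ ∃ y : Fin l → Bool, Compat p x y ∧ Compat q y z) :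
    compPartn q p = r :=
  ext_compat fun x z => by rw [compat_compPartn_iff, h]

/-- If the labels of the outer rows determine those of the middle row, there are no loops. -/
theorem loops_eq_zero {k l m : ℕ} {q : Partn l m} {p : Partn k l}
    (h : ∀ x z (y y' : Fin l → Bool), Compat p x y → Compat q y z → Compat p x y' →
      Compat q y' z → y = y') : loops q p = 0 := by
  have h1 := card_extensions q p _ _ (compat_const _ true)
  have : Subsingleton {y : Fin l → Bool // Compat p (fun _ => true) y ∧
      Compat q y (fun _ => true)} :=
    ⟨fun y y' => Subtype.ext (h _ _ _ _ y.2.1 y.2.2 y'.2.1 y'.2.2)⟩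
  have h2 : 2 ^ loops q p ≤ 1 := by rw [← h1]; exact Finite.card_le_one_iff_subsingleton.2 this
  by_contra h3
  exact absurd h2 (not_le.2 (Nat.one_lt_two_pow h3))

theorem tensorBlock_map_castAdd {k l k' l' : ℕ} (p : Partn k l) (q : Partn k' l')
    (a : Fin k ⊕ Fin l) : tensorBlock p q (Sum.map (Fin.castAdd k') (Fin.castAdd l') a) =
      Sum.inl (Quotient.mk p a) := by
  rcases a with a | a <;> simp [tensorBlock]

theorem tensorBlock_map_natAdd {k l k' l' : ℕ} (p : Partn k l) (q : Partn k' l')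
    (a : Fin k' ⊕ Fin l') : tensorBlock p q (Sum.map (Fin.natAdd k) (Fin.natAdd l) a) =
      Sum.inr (Quotient.mk q a) := by
  rcases a with a | a <;> simp [tensorBlock]

theorem exists_eq_map_castAdd_or_natAdd {k l k' l' : ℕ} (a : Fin (k + k') ⊕ Fin (l + l')) :
    (∃ b : Fin k ⊕ Fin l, a = Sum.map (Fin.castAdd k') (Fin.castAdd l') b) ∨
      ∃ b : Fin k' ⊕ Fin l', a = Sum.map (Fin.natAdd k) (Fin.natAdd l) b := by
  rcases a with a | a
  · induction a using Fin.addCases with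
    | left i => exact Or.inl ⟨Sum.inl i, rfl⟩
    | right i => exact Or.inr ⟨Sum.inl i, rfl⟩
  · induction a using Fin.addCases with
    | left i => exact Or.inl ⟨Sum.inr i, rfl⟩
    | right i => exact Or.inr ⟨Sum.inr i, rfl⟩

theorem compat_tensorPartn_iff {k l k' l' : ℕ} {β : Type*} {p : Partn k l} {q : Partn k' l'}
    {x : Fin (k + k') → β} {y : Fin (l + l') → β} :
    Compat (tensorPartn p q) x y ↔
      Compat p (fun i => x (Fin.castAdd k' i)) (fun j => y (Fin.castAdd l' j)) ∧
      Compat q (fun i => x (Fin.natAdd k i)) (fun j => y (Fin.natAdd l j)) := by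
  let eL : Fin k ⊕ Fin l → Fin (k + k') ⊕ Fin (l + l') := Sum.map (Fin.castAdd k') (Fin.castAdd l')
  let eR : Fin k' ⊕ Fin l' → Fin (k + k') ⊕ Fin (l + l') := Sum.map (Fin.natAdd k) (Fin.natAdd l)
  have hL : ∀ a, tensorBlock p q (eL a) = Sum.inl (Quotient.mk p a) := tensorBlock_map_castAdd p q
  have hR : ∀ a, tensorBlock p q (eR a) = Sum.inr (Quotient.mk q a) := tensorBlock_map_natAdd p q
  have hcov : ∀ a, (∃ b, a = eL b) ∨ ∃ b, a = eR b := exists_eq_map_castAdd_or_natAdd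
  have vL : ∀ a, Sum.elim (fun i => x (Fin.castAdd k' i)) (fun j => y (Fin.castAdd l' j)) a =
      Sum.elim x y (eL a) := by rintro (a | a) <;> rfl
  have vR : ∀ a, Sum.elim (fun i => x (Fin.natAdd k i)) (fun j => y (Fin.natAdd l j)) a =
      Sum.elim x y (eR a) := by rintro (a | a) <;> rfl
  constructor
  · intro h
    constructor
    · intro a b hab
      rw [Setoid.ker_def, vL, vL]
      exact h (by rw [tensorPartn, Setoid.ker_def, hL, hL, Quotient.sound hab])
    · intro a b hab
      rw [Setoid.ker_def, vR, vR]
      exact h (by rw [tensorPartn, Setoid.ker_def, hR, hR, Quotient.sound hab])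
  · rintro ⟨h1, h2⟩ a b hab
    rw [tensorPartn, Setoid.ker_def] at hab
    rw [Setoid.ker_def]
    rcases hcov a with ⟨a, rfl⟩ | ⟨a, rfl⟩ <;> rcases hcov b with ⟨b, rfl⟩ | ⟨b, rfl⟩
    · rw [hL, hL, Sum.inl.injEq] at hab
      rw [← vL, ← vL]
      exact h1 (Quotient.exact hab)
    · rw [hL, hR] at hab; cases hab
    · rw [hL, hR] at hab; cases hab
    · rw [hR, hR, Sum.inr.injEq] at hab
      rw [← vR, ← vR]
      exact h2 (Quotient.exact hab)

theorem compat_starPartn_iff {k l : ℕ} {β : Type*} {p : Partn k l} {x : Fin l → β}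
    {y : Fin k → β} : Compat (starPartn p) x y ↔ Compat p y x := by
  have h : ∀ a, Sum.elim x y a = Sum.elim y x a.swap := by rintro (a | a) <;> rfl
  constructor
  · intro hc a b hab
    have := @hc a.swap b.swap (show p a.swap.swap b.swap.swap by simpa using hab)
    rw [Setoid.ker_def, h, h] at this
    simpa using this
  · intro hc a b hab
    have := hc hab
    rw [Setoid.ker_def] at this ⊢
    rw [h, h, this]

theorem compat_ker_iff {k l : ℕ} {α β : Type*} {f : Fin k → α} {g : Fin l → α} {x : Fin k → β}
    {y : Fin l → β} : Compat (Setoid.ker (Sum.elim f g)) x y ↔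
      (∀ i j, f i = f j → x i = x j) ∧ (∀ i j, f i = g j → x i = y j) ∧
        (∀ i j, g i = g j → y i = y j) := by
  constructor
  · intro h
    exact ⟨fun i j hij => @h (Sum.inl i) (Sum.inl j) hij,
      fun i j hij => @h (Sum.inl i) (Sum.inr j) hij,
      fun i j hij => @h (Sum.inr i) (Sum.inr j) hij⟩
  · rintro ⟨h1, h2, h3⟩ (a | a) (b | b) hab
    · exact h1 _ _ hab
    · exact h2 _ _ hab
    · exact (h2 _ _ (Eq.symm hab)).symm
    · exact h3 _ _ hab

theorem compat_bot {k l : ℕ} {β : Type*} {x : Fin k → β} {y : Fin l → β} :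
    Compat (⊥ : Partn k l) x y := bot_le (α := Setoid _)

theorem compat_top_iff {β : Type*} {x y : Fin 1 → β} :
    Compat (⊤ : Partn 1 1) x y ↔ x = y := by
  constructor
  · intro h
    funext i
    exact @h (Sum.inl i) (Sum.inr i) trivial
  · rintro rfl (a | a) (b | b) _ <;> exact congrArg x (Subsingleton.elim _ _)

/-! ### Algebra of formal linear combinations of partitions -/

section Bilinear

variable {k l m k' l' : ℕ}

/-- Composition as a bilinear map. -/
def compₗ (δ : ℂ) : Part l m →ₗ[ℂ] Part k l →ₗ[ℂ] Part k m :=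
  LinearMap.mk₂ ℂ (comp δ)
    (fun y y' x => by
      classical
      exact Finsupp.sum_add_index' (by simp) (fun q b b' => by
        rw [← Finsupp.sum_add]
        exact Finsupp.sum_congr fun p _ => by rw [← Finsupp.single_add]; ring_nf))
    (fun c y x => by
      classical
      unfold comp
      rw [Finsupp.sum_smul_index (by simp), Finsupp.smul_sum]
      refine Finsupp.sum_congr fun q _ => ?_
      rw [Finsupp.smul_sum]
      exact Finsupp.sum_congr fun p _ => by rw [Finsupp.smul_single, smul_eq_mul]; ring_nf)
    (fun y x x' => by
      classical
      unfold comp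
      rw [← Finsupp.sum_add]
      refine Finsupp.sum_congr fun q _ => ?_
      exact Finsupp.sum_add_index' (by simp) (fun p a a' => by
        rw [← Finsupp.single_add]; ring_nf))
    (fun c y x => by
      classical
      unfold comp
      rw [Finsupp.smul_sum]
      refine Finsupp.sum_congr fun q _ => ?_
      rw [Finsupp.sum_smul_index (by simp), Finsupp.smul_sum]
      exact Finsupp.sum_congr fun p _ => by rw [Finsupp.smul_single, smul_eq_mul]; ring_nf)

theorem compₗ_apply (δ : ℂ) (y : Part l m) (x : Part k l) : compₗ δ y x = comp δ y x := rfl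

/-- Tensor product as a bilinear map. -/
def tensorₗ : Part k l →ₗ[ℂ] Part k' l' →ₗ[ℂ] Part (k + k') (l + l') :=
  LinearMap.mk₂ ℂ tensor
    (fun y y' x => by
      classical
      exact Finsupp.sum_add_index' (by simp) (fun q b b' => by
        rw [← Finsupp.sum_add]
        exact Finsupp.sum_congr fun p _ => by rw [← Finsupp.single_add]; ring_nf))
    (fun c y x => by
      classical
      unfold tensor
      rw [Finsupp.sum_smul_index (by simp), Finsupp.smul_sum]
      refine Finsupp.sum_congr fun q _ => ?_
      rw [Finsupp.smul_sum]
      exact Finsupp.sum_congr fun p _ => by rw [Finsupp.smul_single, smul_eq_mul]; ring_nf)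
    (fun y x x' => by
      classical
      unfold tensor
      rw [← Finsupp.sum_add]
      refine Finsupp.sum_congr fun q _ => ?_
      exact Finsupp.sum_add_index' (by simp) (fun p a a' => by
        rw [← Finsupp.single_add]; ring_nf))
    (fun c y x => by
      classical
      unfold tensor
      rw [Finsupp.smul_sum]
      refine Finsupp.sum_congr fun q _ => ?_
      rw [Finsupp.sum_smul_index (by simp), Finsupp.smul_sum]
      exact Finsupp.sum_congr fun p _ => by rw [Finsupp.smul_single, smul_eq_mul]; ring_nf)

theorem tensorₗ_apply (x : Part k l) (y : Part k' l') : tensorₗ x y = tensor x y := rfl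

theorem comp_add_left (δ : ℂ) (y y' : Part l m) (x : Part k l) :
    comp δ (y + y') x = comp δ y x + comp δ y' x := LinearMap.map_add₂ (compₗ δ) y y' x

theorem comp_sub_left (δ : ℂ) (y y' : Part l m) (x : Part k l) :
    comp δ (y - y') x = comp δ y x - comp δ y' x := LinearMap.map_sub₂ (compₗ δ) y y' x

theorem comp_smul_left (δ c : ℂ) (y : Part l m) (x : Part k l) :
    comp δ (c • y) x = c • comp δ y x := LinearMap.map_smul₂ (compₗ δ) c y x

theorem comp_zero_left (δ : ℂ) (x : Part k l) : comp δ (0 : Part l m) x = 0 :=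
  LinearMap.map_zero₂ (compₗ δ) x

theorem comp_add_right (δ : ℂ) (y : Part l m) (x x' : Part k l) :
    comp δ y (x + x') = comp δ y x + comp δ y x' := map_add (compₗ δ y) x x'

theorem comp_sub_right (δ : ℂ) (y : Part l m) (x x' : Part k l) :
    comp δ y (x - x') = comp δ y x - comp δ y x' := map_sub (compₗ δ y) x x'

theorem comp_smul_right (δ c : ℂ) (y : Part l m) (x : Part k l) :
    comp δ y (c • x) = c • comp δ y x := map_smul (compₗ δ y) c x

theorem comp_zero_right (δ : ℂ) (y : Part l m) : comp δ y (0 : Part k l) = 0 :=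
  map_zero (compₗ δ y)

theorem tensor_add_left (y y' : Part k l) (x : Part k' l') :
    tensor (y + y') x = tensor y x + tensor y' x := LinearMap.map_add₂ tensorₗ y y' x

theorem tensor_sub_left (y y' : Part k l) (x : Part k' l') :
    tensor (y - y') x = tensor y x - tensor y' x := LinearMap.map_sub₂ tensorₗ y y' x

theorem tensor_smul_left (c : ℂ) (y : Part k l) (x : Part k' l') :
    tensor (c • y) x = c • tensor y x := LinearMap.map_smul₂ tensorₗ c y x

theorem tensor_zero_left (x : Part k' l') : tensor (0 : Part k l) x = 0 :=
  LinearMap.map_zero₂ tensorₗ x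

theorem tensor_add_right (y : Part k l) (x x' : Part k' l') :
    tensor y (x + x') = tensor y x + tensor y x' := map_add (tensorₗ y) x x'

theorem tensor_sub_right (y : Part k l) (x x' : Part k' l') :
    tensor y (x - x') = tensor y x - tensor y x' := map_sub (tensorₗ y) x x'

theorem tensor_smul_right (c : ℂ) (y : Part k l) (x : Part k' l') :
    tensor y (c • x) = c • tensor y x := map_smul (tensorₗ y) c x

theorem tensor_zero_right (y : Part k l) : tensor y (0 : Part k' l') = 0 :=
  map_zero (tensorₗ y)

/-- Involution as an antilinear map. -/
def involₗ : Part k l →ₛₗ[starRingEnd ℂ] Part l k where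
  toFun := invol
  map_add' x y := by
    classical
    exact Finsupp.sum_add_index' (by simp) (fun p a b => by rw [map_add, Finsupp.single_add])
  map_smul' c x := by
    classical
    unfold invol
    rw [Finsupp.sum_smul_index (by simp), Finsupp.smul_sum]
    exact Finsupp.sum_congr fun p _ => by rw [Finsupp.smul_single, smul_eq_mul, map_mul]

theorem invol_add (x y : Part k l) : invol (x + y) = invol x + invol y := map_add involₗ x y

theorem invol_sub (x y : Part k l) : invol (x - y) = invol x - invol y := map_sub involₗ x y

theorem invol_smul (c : ℂ) (x : Part k l) : invol (c • x) = starRingEnd ℂ c • invol x :=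
  LinearMap.map_smulₛₗ involₗ c x

theorem invol_zero : invol (0 : Part k l) = 0 := map_zero involₗ

theorem comp_toPart (δ : ℂ) (q : Partn l m) (p : Partn k l) :
    comp δ (toPart q) (toPart p) = δ ^ loops q p • toPart (compPartn q p) := by
  rw [comp, toPart, toPart, toPart, Finsupp.sum_single_index (by simp),
    Finsupp.sum_single_index (by simp), Finsupp.smul_single, smul_eq_mul, mul_one]

theorem tensor_toPart (p : Partn k l) (q : Partn k' l') :
    tensor (toPart p) (toPart q) = toPart (tensorPartn p q) := by
  rw [tensor, toPart, toPart, toPart, Finsupp.sum_single_index (by simp),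
    Finsupp.sum_single_index (by simp), mul_one]

theorem invol_toPart (p : Partn k l) : invol (toPart p) = toPart (starPartn p) := by
  simp [invol, toPart]

/-- To prove a property of all elements of `Part k l`, closed under linear combinations, it is
enough to treat partitions. -/
theorem part_induction {motive : Part k l → Prop} (x : Part k l) (h0 : motive 0)
    (hadd : ∀ x y, motive x → motive y → motive (x + y))
    (hsmul : ∀ (c : ℂ) p, motive (c • toPart p)) : motive x :=
  Finsupp.induction_linear x h0 hadd fun p a => by
    have : Finsupp.single p a = a • toPart p := by simp [toPart]
    rw [this]; exact hsmul a p

end Bilinear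

section Laws

variable {k l m n k' l' m' : ℕ}

theorem compPartn_assoc_and_loops (r : Partn m n) (q : Partn l m) (p : Partn k l) :
    loops q p + loops r (compPartn q p) = loops r q + loops (compPartn r q) p ∧
      compPartn r (compPartn q p) = compPartn (compPartn r q) p := by
  apply transfer_injective
  have h := Matrix.mul_assoc (transfer p) (transfer q) (transfer r)
  rw [transfer_mul, transfer_mul, Matrix.smul_mul, Matrix.mul_smul, transfer_mul, transfer_mul,
    smul_smul, smul_smul, ← pow_add, ← pow_add] at h
  exact h

theorem comp_assoc (δ : ℂ) (z : Part m n) (y : Part l m) (x : Part k l) :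
    comp δ z (comp δ y x) = comp δ (comp δ z y) x := by
  induction x using part_induction with
  | h0 => simp only [comp_zero_right]
  | hadd x x' h h' => simp only [comp_add_right, h, h']
  | hsmul c p =>
    induction y using part_induction with
    | h0 => simp only [comp_zero_right, comp_zero_left]
    | hadd x x' h h' => simp only [comp_add_right, comp_add_left, h, h']
    | hsmul b q =>
      induction z using part_induction with
      | h0 => simp only [comp_zero_left]
      | hadd x x' h h' => simp only [comp_add_left, h, h']
      | hsmul a r =>
        have h := compPartn_assoc_and_loops r q p
        simp only [comp_smul_left, comp_smul_right, comp_toPart, smul_smul, h.2]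
        congr 1
        calc c * (b * δ ^ loops q p) * (a * δ ^ loops r (compPartn q p))
            = c * (b * a) * δ ^ (loops q p + loops r (compPartn q p)) := by ring
          _ = _ := by rw [h.1]; ring

theorem transfer_tensorPartn (p : Partn k l) (q : Partn k' l') (x : Fin (k + k') → Bool)
    (y : Fin (l + l') → Bool) : transfer (tensorPartn p q) x y =
      transfer p (fun i => x (Fin.castAdd k' i)) (fun j => y (Fin.castAdd l' j)) *
      transfer q (fun i => x (Fin.natAdd k i)) (fun j => y (Fin.natAdd l j)) := by
  classical
  simp only [transfer, Matrix.of_apply, compat_tensorPartn_iff]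
  split_ifs <;> simp_all

theorem tensorPartn_comp_and_loops (q : Partn l m) (p : Partn k l) (q' : Partn l' m')
    (p' : Partn k' l') :
    loops (tensorPartn q q') (tensorPartn p p') = loops q p + loops q' p' ∧
      compPartn (tensorPartn q q') (tensorPartn p p') =
        tensorPartn (compPartn q p) (compPartn q' p') := by
  apply transfer_injective
  rw [← transfer_mul]
  ext x z
  have h1 := congrFun (congrFun (transfer_mul q p) fun i => x (Fin.castAdd k' i))
    fun j => z (Fin.castAdd m' j)
  have h2 := congrFun (congrFun (transfer_mul q' p') fun i => x (Fin.natAdd k i))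
    fun j => z (Fin.natAdd m j)
  rw [Matrix.mul_apply] at h1 h2 ⊢
  rw [Matrix.smul_apply, transfer_tensorPartn, pow_add, smul_eq_mul, mul_mul_mul_comm]
  rw [Matrix.smul_apply, smul_eq_mul] at h1 h2
  rw [← h1, ← h2, Finset.sum_mul_sum, ← Finset.sum_product',
    ← (Fin.appendEquiv l l').sum_comp]
  refine Finset.sum_congr rfl fun y _ => ?_
  simp [transfer_tensorPartn, mul_mul_mul_comm]

/-- The interchange law. -/
theorem tensor_comp_tensor (δ : ℂ) (y : Part l m) (y' : Part l' m') (x : Part k l)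
    (x' : Part k' l') :
    comp δ (tensor y y') (tensor x x') = tensor (comp δ y x) (comp δ y' x') := by
  induction x using part_induction with
  | h0 => simp only [comp_zero_right, tensor_zero_left]
  | hadd x x' h h' => simp only [comp_add_right, tensor_add_left, h, h']
  | hsmul c p =>
    induction y using part_induction with
    | h0 => simp only [tensor_zero_left, comp_zero_left]
    | hadd x x' h h' => simp only [comp_add_left, tensor_add_left, h, h']
    | hsmul b q =>
      induction x' using part_induction with
      | h0 => simp only [comp_zero_right, tensor_zero_right]
      | hadd x x' h h' => simp only [comp_add_right, tensor_add_right, h, h']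
      | hsmul c' p' =>
        induction y' using part_induction with
        | h0 => simp only [tensor_zero_right, comp_zero_left]
        | hadd x x' h h' => simp only [comp_add_left, tensor_add_right, h, h']
        | hsmul b' q' =>
          have h := tensorPartn_comp_and_loops q p q' p'
          simp only [comp_smul_left, comp_smul_right, tensor_smul_left, tensor_smul_right,
            tensor_toPart, comp_toPart, smul_smul, h.1, h.2]
          congr 1
          ring

theorem transfer_starPartn (p : Partn k l) : transfer (starPartn p) = (transfer p).transpose := by
  classical
  ext x y
  simp only [transfer, Matrix.of_apply, Matrix.transpose_apply, compat_starPartn_iff]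

theorem starPartn_comp_and_loops (q : Partn l m) (p : Partn k l) :
    loops q p = loops (starPartn p) (starPartn q) ∧
      starPartn (compPartn q p) = compPartn (starPartn p) (starPartn q) := by
  apply transfer_injective
  rw [← transfer_mul, transfer_starPartn, transfer_starPartn, transfer_starPartn,
    ← Matrix.transpose_mul, transfer_mul, Matrix.transpose_smul]

theorem invol_comp (δ : ℝ) (y : Part l m) (x : Part k l) :
    invol (comp δ y x) = comp δ (invol x) (invol y) := by
  induction x using part_induction with
  | h0 => simp only [comp_zero_right, comp_zero_left, invol_zero]
  | hadd x x' h h' => simp only [comp_add_right, comp_add_left, invol_add, h, h']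
  | hsmul c p =>
    induction y using part_induction with
    | h0 => simp only [comp_zero_right, comp_zero_left, invol_zero]
    | hadd x x' h h' => simp only [comp_add_right, comp_add_left, invol_add, h, h']
    | hsmul b q =>
      have h := starPartn_comp_and_loops q p
      simp only [comp_smul_left, comp_smul_right, invol_smul, invol_toPart, comp_toPart, smul_smul,
        h.1, h.2, map_mul, map_pow, Complex.conj_ofReal]
      congr 1
      ring

theorem starPartn_starPartn (p : Partn k l) : starPartn (starPartn p) = p :=
  ext_compat fun x y => by rw [compat_starPartn_iff, compat_starPartn_iff]

theorem starPartn_tensorPartn (p : Partn k l) (q : Partn k' l') :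
    starPartn (tensorPartn p q) = tensorPartn (starPartn p) (starPartn q) :=
  ext_compat fun x y => by
    rw [compat_starPartn_iff, compat_tensorPartn_iff, compat_tensorPartn_iff,
      compat_starPartn_iff, compat_starPartn_iff]

theorem invol_tensor (x : Part k l) (y : Part k' l') :
    invol (tensor x y) = tensor (invol x) (invol y) := by
  induction x using part_induction with
  | h0 => simp only [tensor_zero_left, invol_zero]
  | hadd x x' h h' => simp only [tensor_add_left, invol_add, h, h']
  | hsmul c p =>
    induction y using part_induction with
    | h0 => simp only [tensor_zero_right, invol_zero]
    | hadd x x' h h' => simp only [tensor_add_right, invol_add, h, h']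
    | hsmul b q =>
      simp only [tensor_smul_left, tensor_smul_right, invol_smul, invol_toPart, tensor_toPart,
        starPartn_tensorPartn]

/-- Associativity of the tensor product, with `Part 1 1` as the third factor: in this case both
sides have definitionally equal types and no cast is needed. -/
theorem tensor_assoc_one (x : Part k l) (y : Part k' l') (z : Part 1 1) :
    tensor (tensor x y) z = tensor x (tensor y z) := by
  induction x using part_induction with
  | h0 => simp only [tensor_zero_left]
  | hadd x x' h h' => simp only [tensor_add_left, h, h']
  | hsmul c p =>
    induction y using part_induction with
    | h0 => simp only [tensor_zero_right, tensor_zero_left]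
    | hadd x x' h h' => simp only [tensor_add_right, tensor_add_left, h, h']
    | hsmul b q =>
      induction z using part_induction with
      | h0 => simp only [tensor_zero_right]
      | hadd x x' h h' => simp only [tensor_add_right, h, h']
      | hsmul a r =>
        have h : tensorPartn (tensorPartn p q) r = tensorPartn p (tensorPartn q r) := by
          have e : ∀ (a b : ℕ) (i : Fin 1), Fin.natAdd (a + b) i = Fin.natAdd a (Fin.natAdd b i) :=
            fun a b i => Fin.ext (Nat.add_assoc a b i)
          refine ext_compat fun x y => ?_
          rw [compat_tensorPartn_iff, compat_tensorPartn_iff, and_assoc]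
          refine Iff.trans ?_ (compat_tensorPartn_iff (k' := k' + 1) (l' := l' + 1)).symm
          rw [compat_tensorPartn_iff]
          simp only [e]
          rfl
        simp only [tensor_smul_left, tensor_smul_right, tensor_toPart, h]

theorem partn_zero_eq (p : Partn 0 0) : p = ⊤ :=
  Setoid.ext fun a => (IsEmpty.false a).elim

theorem tensorPartn_unit (p : Partn k l) (q : Partn 0 0) : tensorPartn p q = p := by
  refine ext_compat fun x y => compat_tensorPartn_iff.trans ?_
  refine (and_iff_left ?_).trans Iff.rfl
  intro a
  exact (IsEmpty.false a).elim

theorem tensor_unit (x : Part k l) : tensor x (toPart (⊤ : Partn 0 0)) = x := by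
  induction x using part_induction with
  | h0 => exact tensor_zero_left _
  | hadd x x' h h' => exact (tensor_add_left _ _ _).trans (congrArg₂ _ h h')
  | hsmul c p =>
    rw [tensor_smul_left, tensor_toPart, tensorPartn_unit]

/-- The identity partition on `n` points. -/
def idPartn (n : ℕ) : Partn n n := Setoid.ker (Sum.elim id id)

theorem compat_idPartn_iff {β : Type*} {n : ℕ} {x y : Fin n → β} :
    Compat (idPartn n) x y ↔ x = y := by
  rw [idPartn, compat_ker_iff]
  constructor
  · rintro ⟨-, h, -⟩
    exact funext fun i => h i i rfl
  · rintro rfl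
    simp +contextual

theorem transfer_idPartn (n : ℕ) : transfer (idPartn n) = 1 := by
  classical
  ext x y
  simp only [transfer, Matrix.of_apply, compat_idPartn_iff, Matrix.one_apply]

theorem compPartn_idPartn (p : Partn k l) :
    loops p (idPartn k) = 0 ∧ compPartn p (idPartn k) = p := by
  apply transfer_injective
  rw [← transfer_mul, transfer_idPartn, Matrix.one_mul, pow_zero, one_smul]

theorem idPartn_compPartn (p : Partn k l) :
    loops (idPartn l) p = 0 ∧ compPartn (idPartn l) p = p := by
  apply transfer_injective
  rw [← transfer_mul, transfer_idPartn, Matrix.mul_one, pow_zero, one_smul]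

theorem comp_idPartn (δ : ℂ) (x : Part k l) : comp δ x (toPart (idPartn k)) = x := by
  induction x using part_induction with
  | h0 => exact comp_zero_left _ _
  | hadd x x' h h' => rw [comp_add_left, h, h']
  | hsmul c p =>
    rw [comp_smul_left, comp_toPart, (compPartn_idPartn p).1, (compPartn_idPartn p).2, pow_zero,
      one_smul]

theorem idPartn_comp (δ : ℂ) (x : Part k l) : comp δ (toPart (idPartn l)) x = x := by
  induction x using part_induction with
  | h0 => exact comp_zero_right _ _
  | hadd x x' h h' => rw [comp_add_right, h, h']
  | hsmul c p =>
    rw [comp_smul_right, comp_toPart, (idPartn_compPartn p).1, (idPartn_compPartn p).2, pow_zero,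
      one_smul]

theorem idPartn_zero : idPartn 0 = ⊤ := partn_zero_eq _

theorem idPartn_one : idPartn 1 = ⊤ :=
  ext_compat fun x y => by rw [compat_idPartn_iff, compat_top_iff]

theorem tensorPartn_idPartn (m n : ℕ) : tensorPartn (idPartn m) (idPartn n) = idPartn (m + n) := by
  refine ext_compat fun x y => ?_
  rw [compat_tensorPartn_iff, compat_idPartn_iff, compat_idPartn_iff, compat_idPartn_iff]
  constructor
  · rintro ⟨h1, h2⟩
    exact funext fun i => Fin.addCases (fun i => congrFun h1 i) (fun i => congrFun h2 i) i
  · rintro rfl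
    exact ⟨rfl, rfl⟩

theorem comp_idPart (δ : ℂ) (x : Part 1 l) : comp δ x idPart = x := by
  rw [idPart, ← idPartn_one, comp_idPartn]

theorem idPart_comp (δ : ℂ) (x : Part k 1) : comp δ idPart x = x := by
  rw [idPart, ← idPartn_one, idPartn_comp]

theorem comp_unit (δ : ℂ) (x : Part 0 l) : comp δ x (toPart ⊤) = x := by
  rw [← idPartn_zero, comp_idPartn]

end Laws

/-! ### Small partitions -/

section Elementary

variable {k l m n : ℕ}

theorem compat_word_iff {β : Type*} {w : Fin n → ℕ} {x : Fin 0 → β} {y : Fin n → β} :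
    Compat (Setoid.ker (Sum.elim Fin.elim0 w) : Partn 0 n) x y ↔
      ∀ i j, w i = w j → y i = y j := by
  rw [compat_ker_iff]
  exact ⟨fun h => h.2.2, fun h => ⟨fun i => i.elim0, fun i => i.elim0, h⟩⟩

/-- A criterion for computing a loop-free composition: the labels `f x z` of the middle row are
determined by those of the outer rows. -/
theorem comp_toPart_eq (δ : ℂ) {q : Partn l m} {p : Partn k l} {r : Partn k m}
    (f : (Fin k → Bool) → (Fin m → Bool) → Fin l → Bool)
    (h : ∀ x y z, Compat p x y ∧ Compat q y z ↔ y = f x z ∧ Compat r x z) :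
    comp δ (toPart q) (toPart p) = toPart r := by
  have h1 : loops q p = 0 := loops_eq_zero fun x z y y' hp hq hp' hq' =>
    ((h x y z).1 ⟨hp, hq⟩).1.trans ((h x y' z).1 ⟨hp', hq'⟩).1.symm
  have h2 : compPartn q p = r := compPartn_eq fun x z =>
    ⟨fun hr => ⟨_, (h x _ z).2 ⟨rfl, hr⟩⟩, fun ⟨y, hy⟩ => ((h x y z).1 hy).2⟩
  rw [comp_toPart, h1, h2, pow_zero, one_smul]

/-- The reflected singleton. -/
def cosingleton : Part 1 0 := toPart ⊥

/-- The reflected pair partition. -/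
def copair : Part 2 0 := invol pair

theorem singleton_eq : singleton = toPart ⊥ :=
  congrArg toPart (ext_compat fun x y => by
    refine iff_of_true (compat_word_iff.2 fun i j _ => ?_) compat_bot
    rw [Subsingleton.elim i j])

theorem starPartn_bot : starPartn (⊥ : Partn k l) = ⊥ :=
  ext_compat fun x y => by
    rw [compat_starPartn_iff]
    exact iff_of_true compat_bot compat_bot

theorem invol_singleton : invol singleton = cosingleton := by
  rw [singleton_eq, invol_toPart, starPartn_bot, cosingleton]

theorem invol_disconnecter : invol disconnecter = disconnecter := by
  rw [disconnecter, invol_toPart, starPartn_bot]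

theorem invol_idPart : invol idPart = idPart := by
  rw [idPart, invol_toPart]
  exact congrArg toPart (ext_compat fun x y => by
    rw [compat_starPartn_iff, compat_top_iff, compat_top_iff, eq_comm])

theorem singleton_comp_cosingleton (δ : ℂ) : comp δ singleton cosingleton = disconnecter := by
  rw [singleton_eq]
  exact comp_toPart_eq δ (fun _ _ => Fin.elim0) fun x y z =>
    iff_of_true ⟨compat_bot, compat_bot⟩ ⟨Subsingleton.elim _ _, compat_bot⟩

theorem cosingleton_comp_singleton (δ : ℂ) : comp δ cosingleton singleton = δ • toPart ⊤ := by
  rw [singleton_eq, cosingleton, comp_toPart, partn_zero_eq (compPartn _ _)]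
  congr 1
  have h := card_extensions (⊥ : Partn 1 0) (⊥ : Partn 0 1) _ _ (compat_const _ true)
  have e : Nat.card {y : Fin 1 → Bool // Compat (⊥ : Partn 0 1) (fun _ => true) y ∧
      Compat (⊥ : Partn 1 0) y (fun _ => true)} = 2 ^ 1 := by
    rw [Nat.card_congr (Equiv.subtypeUnivEquiv fun y => ⟨compat_bot, compat_bot⟩)]
    simp
  rw [e] at h
  rw [← Nat.pow_right_injective le_rfl h, pow_one]

theorem disconnecter_comp_singleton (δ : ℂ) : comp δ disconnecter singleton = δ • singleton := by
  rw [← singleton_comp_cosingleton δ, ← comp_assoc, cosingleton_comp_singleton, comp_smul_right,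
    comp_unit]

theorem disconnecter_comp_disconnecter (δ : ℂ) :
    comp δ disconnecter disconnecter = δ • disconnecter := by
  nth_rewrite 2 [← singleton_comp_cosingleton δ]
  rw [comp_assoc, disconnecter_comp_singleton, comp_smul_left, singleton_comp_cosingleton]

theorem pair_eq : pair = toPart (⊤ : Partn 0 2) :=
  congrArg toPart (Setoid.ext fun a b => by
    rcases a with a | a
    · exact a.elim0
    rcases b with b | b
    · exact b.elim0
    exact iff_of_true (by fin_cases a <;> fin_cases b <;> rfl) trivial)

theorem compat_pair_iff {β : Type*} {x : Fin 0 → β} {y : Fin 2 → β} :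
    Compat (⊤ : Partn 0 2) x y ↔ y 0 = y 1 := by
  constructor
  · intro h
    exact @h (Sum.inr 0) (Sum.inr 1) trivial
  · rintro h (a | a)
    · exact a.elim0
    rintro (b | b) _
    · exact b.elim0
    fin_cases a <;> fin_cases b
    exacts [rfl, h, h.symm, rfl]

theorem tensor_singleton_singleton : tensor singleton singleton = toPart (⊥ : Partn 0 2) := by
  rw [singleton_eq, tensor_toPart]
  exact congrArg toPart (ext_compat fun x y =>
    iff_of_true (compat_tensorPartn_iff.2 ⟨compat_bot, compat_bot⟩) compat_bot)

theorem tensor_disconnecter_idPart_comp_pair (δ : ℂ) :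
    comp δ (tensor disconnecter idPart) pair = tensor singleton singleton := by
  rw [tensor_singleton_singleton, pair_eq, disconnecter, idPart, tensor_toPart]
  refine comp_toPart_eq (l := 2) δ (fun x z _ => z 1) fun x y z => ?_
  rw [compat_pair_iff]
  refine (and_congr_right fun _ =>
    compat_tensorPartn_iff (k := 1) (k' := 1) (l := 1) (l' := 1)).trans ?_
  rw [compat_top_iff]
  simp only [compat_bot, true_and, and_true, funext_iff, Fin.forall_fin_two, Fin.forall_fin_one]
  constructor
  · rintro ⟨h1, h2⟩
    exact ⟨h1.trans h2, h2⟩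
  · rintro ⟨h1, h2⟩
    exact ⟨h1.trans h2.symm, h2⟩

theorem tensor_idPart_disconnecter_comp_pair (δ : ℂ) :
    comp δ (tensor idPart disconnecter) pair = tensor singleton singleton := by
  rw [tensor_singleton_singleton, pair_eq, disconnecter, idPart, tensor_toPart]
  refine comp_toPart_eq (l := 2) δ (fun x z _ => z 0) fun x y z => ?_
  rw [compat_pair_iff]
  refine (and_congr_right fun _ =>
    compat_tensorPartn_iff (k := 1) (k' := 1) (l := 1) (l' := 1)).trans ?_
  rw [compat_top_iff]
  simp only [compat_bot, and_true, funext_iff, Fin.forall_fin_two, Fin.forall_fin_one]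
  constructor
  · rintro ⟨h1, h2⟩
    exact ⟨h2, h1.symm.trans h2⟩
  · rintro ⟨h1, h2⟩
    exact ⟨h1.trans h2.symm, h1⟩

/-! ### Tensor powers -/

theorem tensor_unit_left (x : Part 1 1) : tensor (toPart (⊤ : Partn 0 0)) x = x := by
  induction x using part_induction with
  | h0 => exact tensor_zero_right _
  | hadd x x' h h' => exact (tensor_add_right _ _ _).trans (congrArg₂ _ h h')
  | hsmul c p =>
    rw [tensor_smul_right, tensor_toPart]
    refine congrArg (c • ·) (congrArg toPart (ext_compat fun x y => ?_))
    refine compat_tensorPartn_iff.trans ?_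
    have e : ∀ i : Fin 1, Fin.natAdd 0 i = i := fun i => Fin.ext (Nat.zero_add _)
    simp only [e]
    refine and_iff_right ?_
    intro a
    exact (IsEmpty.false a).elim

theorem tensorPow_one (x : Part 1 1) : tensorPow x 1 = x := tensor_unit_left x

theorem tensorPow_two (x : Part 1 1) : tensorPow x 2 = tensor x x :=
  congrArg (fun y => tensor y x) (tensorPow_one x)

theorem tensorPow_three (x : Part 1 1) : tensorPow x 3 = tensor (tensor x x) x :=
  congrArg (fun y => tensor y x) (tensorPow_two x)

theorem tensorPow_add (x : Part 1 1) (m n : ℕ) :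
    tensorPow x (m + n) = tensor (tensorPow x m) (tensorPow x n) := by
  induction n with
  | zero => exact (tensor_unit _).symm
  | succ n ih =>
    calc tensorPow x (m + (n + 1)) = tensor (tensorPow x (m + n)) x := rfl
      _ = tensor (tensor (tensorPow x m) (tensorPow x n)) x := by rw [ih]
      _ = tensor (tensorPow x m) (tensorPow x (n + 1)) := tensor_assoc_one _ _ _

theorem tensorPow_comp (δ : ℂ) (x y : Part 1 1) (n : ℕ) :
    comp δ (tensorPow x n) (tensorPow y n) = tensorPow (comp δ x y) n := by
  induction n with
  | zero => exact comp_unit δ _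
  | succ n ih => rw [tensorPow, tensorPow, tensorPow, tensor_comp_tensor, ih]

theorem invol_tensorPow (x : Part 1 1) (n : ℕ) :
    invol (tensorPow x n) = tensorPow (invol x) n := by
  induction n with
  | zero => rw [tensorPow, tensorPow, invol_toPart, partn_zero_eq (starPartn _)]
  | succ n ih => rw [tensorPow, tensorPow, invol_tensor, ih]

theorem tensorPow_smul (c : ℂ) (x : Part 1 1) (n : ℕ) :
    tensorPow (c • x) n = c ^ n • tensorPow x n := by
  induction n with
  | zero => simp [tensorPow]
  | succ n ih =>
    rw [tensorPow, tensorPow, ih, tensor_smul_left, tensor_smul_right, smul_smul, pow_succ]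

theorem tensorPow_idPart (n : ℕ) : tensorPow idPart n = toPart (idPartn n) := by
  induction n with
  | zero => rw [tensorPow, idPartn_zero]
  | succ n ih =>
    rw [tensorPow, ih, idPart, ← idPartn_one, tensor_toPart, tensorPartn_idPartn]

/-! ### The projection `π_(δ)` -/

theorem projOne_comp_projOne {δ : ℂ} (hδ : δ ≠ 0) :
    comp δ (projOne δ) (projOne δ) = projOne δ := by
  simp only [projOne, comp_sub_left, comp_sub_right, comp_smul_left, comp_smul_right, idPart_comp,
    comp_idPart, disconnecter_comp_disconnecter, smul_smul]
  rw [one_div, inv_mul_cancel₀ hδ, one_smul, sub_self, smul_zero, sub_zero]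

theorem disconnecter_comp_projOne {δ : ℂ} (hδ : δ ≠ 0) :
    comp δ disconnecter (projOne δ) = 0 := by
  simp only [projOne, comp_sub_right, comp_smul_right,
    comp_idPart, disconnecter_comp_disconnecter, smul_smul]
  rw [one_div, inv_mul_cancel₀ hδ, one_smul, sub_self]

theorem projOne_comp_disconnecter {δ : ℂ} (hδ : δ ≠ 0) :
    comp δ (projOne δ) disconnecter = 0 := by
  simp only [projOne, comp_sub_left, comp_smul_left,
    idPart_comp, disconnecter_comp_disconnecter, smul_smul]
  rw [one_div, inv_mul_cancel₀ hδ, one_smul, sub_self]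

theorem projOne_comp_singleton {δ : ℂ} (hδ : δ ≠ 0) :
    comp δ (projOne δ) singleton = 0 := by
  simp only [projOne, comp_sub_left, comp_smul_left,
    idPart_comp, disconnecter_comp_singleton, smul_smul]
  rw [one_div, inv_mul_cancel₀ hδ, one_smul, sub_self]

theorem invol_projOne (δ : ℝ) : invol (projOne δ) = projOne δ := by
  rw [projOne, invol_sub, invol_smul, invol_idPart, invol_disconnecter, map_div₀, map_one,
    Complex.conj_ofReal]

theorem tensor_projOne_projOne_comp_pair {δ : ℂ} (hδ : δ ≠ 0) :
    comp δ (tensor (projOne δ) (projOne δ)) pair =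
      pair - (1 / δ) • tensor singleton singleton := by
  have h1 : comp δ (tensor idPart idPart) pair = pair := by
    rw [← tensorPow_two, tensorPow_idPart, idPartn_comp]
  have h2 : comp δ (tensor idPart (projOne δ)) pair =
      pair - (1 / δ) • tensor singleton singleton := by
    rw [projOne, tensor_sub_right, tensor_smul_right, comp_sub_left, comp_smul_left, h1,
      tensor_idPart_disconnecter_comp_pair]
  have h3 : comp δ (tensor (projOne δ) idPart) pair =
      pair - (1 / δ) • tensor singleton singleton := by
    rw [projOne, tensor_sub_left, tensor_smul_left, comp_sub_left, comp_smul_left, h1,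
      tensor_disconnecter_idPart_comp_pair]
  calc comp δ (tensor (projOne δ) (projOne δ)) pair
      = comp δ (comp δ (tensor (projOne δ) idPart) (tensor idPart (projOne δ))) pair := by
        rw [tensor_comp_tensor, comp_idPart, idPart_comp]
    _ = comp δ (tensor (projOne δ) idPart) (comp δ (tensor (projOne δ) idPart) pair) := by
        rw [← comp_assoc, h2, h3]
    _ = comp δ (tensor (projOne δ) idPart) pair := by
        rw [comp_assoc, tensor_comp_tensor, projOne_comp_projOne hδ, comp_idPart]
    _ = _ := h3

theorem proj_zero_upper (δ : ℂ) (x : Part 0 n) :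
    proj δ x = comp δ (tensorPow (projOne δ) n) x := by
  rw [proj, tensorPow, comp_unit]

/-! ### Self-intertwiners of an involution -/

/-- The elements that intertwine the tensor powers of `σ`. They form a linear category if `σ` is a
self-adjoint involution that can be moved along the pair partition. -/
def intertwiners (δ : ℂ) (σ : Part 1 1) : Family := fun k l =>
  { carrier := {x | comp δ (tensorPow σ l) x = comp δ x (tensorPow σ k)}
    add_mem' := fun {x y} hx hy => by
      simp only [Set.mem_ofPred_eq] at hx hy ⊢
      rw [comp_add_left, comp_add_right, hx, hy]
    zero_mem' := by simp only [Set.mem_ofPred_eq, comp_zero_left, comp_zero_right]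
    smul_mem' := fun c x hx => by
      simp only [Set.mem_ofPred_eq] at hx ⊢
      rw [comp_smul_left, comp_smul_right, hx] }

theorem mem_intertwiners {δ : ℂ} {σ : Part 1 1} {x : Part k l} :
    x ∈ intertwiners δ σ k l ↔ comp δ (tensorPow σ l) x = comp δ x (tensorPow σ k) := Iff.rfl

theorem isLinearCategory_intertwiners {δ : ℝ} {σ : Part 1 1} (hσ : comp δ σ σ = idPart)
    (hσ' : invol σ = σ)
    (hp : comp δ (tensor σ idPart) pair = comp δ (tensor idPart σ) pair) :
    IsLinearCategory δ (intertwiners δ σ) where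
  id_mem := by rw [mem_intertwiners, tensorPow_one, comp_idPart, idPart_comp]
  pair_mem := by
    rw [mem_intertwiners, tensorPow_two, tensorPow, comp_unit]
    calc comp δ (tensor σ σ) pair
        = comp δ (comp δ (tensor σ idPart) (tensor idPart σ)) pair := by
          rw [tensor_comp_tensor, comp_idPart, idPart_comp]
      _ = comp δ (tensor (comp δ σ σ) (comp δ idPart idPart)) pair := by
          rw [← comp_assoc, ← hp, comp_assoc, tensor_comp_tensor]
      _ = pair := by
          rw [hσ, idPart_comp, ← tensorPow_two, tensorPow_idPart, idPartn_comp]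
  tensor_mem hx hy := by
    rw [mem_intertwiners] at hx hy ⊢
    rw [tensorPow_add, tensorPow_add, tensor_comp_tensor, tensor_comp_tensor, hx, hy]
  comp_mem hy hx := by
    rw [mem_intertwiners] at hx hy ⊢
    rw [comp_assoc, hy, ← comp_assoc, hx, comp_assoc]
  invol_mem hx := by
    rw [mem_intertwiners] at hx ⊢
    have h := congrArg invol hx
    rw [invol_comp, invol_comp, invol_tensorPow, invol_tensorPow, hσ'] at h
    exact h.symm

/-- For `s = ±1`, the involution that acts as `s` on the image of `π_(δ)` and as `-s` on the
singleton. In terms of the colour projections it is `s (π - ρ)`. -/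
def reflection (δ : ℝ) (s : ℤˣ) : Part 1 1 :=
  ((s : ℤ) : ℂ) • (idPart - (2 / (δ : ℂ)) • disconnecter)

theorem unit_cast_mul_self (s : ℤˣ) : ((s : ℤ) : ℂ) * ((s : ℤ) : ℂ) = 1 := by
  rcases Int.units_eq_one_or s with rfl | rfl <;> simp

theorem isLinearCategory_reflection {δ : ℝ} (hδ : δ ≠ 0) (s : ℤˣ) :
    IsLinearCategory δ (intertwiners δ (reflection δ s)) := by
  have hδ' : (δ : ℂ) ≠ 0 := Complex.ofReal_ne_zero.2 hδ
  refine isLinearCategory_intertwiners ?_ ?_ ?_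
  · rw [reflection, comp_smul_left, comp_smul_right, smul_smul, unit_cast_mul_self, one_smul]
    simp only [comp_smul_left, comp_smul_right, smul_smul,
      comp_sub_left, comp_sub_right, comp_idPart, idPart_comp, disconnecter_comp_disconnecter]
    rw [div_mul_cancel₀ _ hδ']
    module
  · rw [reflection, invol_smul, invol_sub, invol_smul, invol_idPart, invol_disconnecter,
      map_div₀, Complex.conj_ofReal, Complex.conj_ofNat, map_intCast]
  · simp only [reflection, tensor_smul_left, tensor_smul_right, tensor_sub_left, tensor_sub_right,
      comp_smul_left, comp_sub_left, tensor_disconnecter_idPart_comp_pair,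
      tensor_idPart_disconnecter_comp_pair]

theorem reflection_comp_singleton {δ : ℝ} (hδ : δ ≠ 0) (s : ℤˣ) :
    comp δ (reflection δ s) singleton = (-((s : ℤ) : ℂ)) • singleton := by
  have hδ' : (δ : ℂ) ≠ 0 := Complex.ofReal_ne_zero.2 hδ
  rw [reflection, comp_smul_left, comp_sub_left, comp_smul_left, idPart_comp,
    disconnecter_comp_singleton, smul_smul, div_mul_cancel₀ _ hδ']
  module

theorem reflection_comp_projOne {δ : ℝ} (hδ : δ ≠ 0) (s : ℤˣ) :
    comp δ (reflection δ s) (projOne δ) = ((s : ℤ) : ℂ) • projOne δ := by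
  rw [reflection, comp_smul_left, comp_sub_left, comp_smul_left, idPart_comp,
    disconnecter_comp_projOne (Complex.ofReal_ne_zero.2 hδ), smul_zero, sub_zero]

theorem proj_mem_intertwiners_reflection_iff {δ : ℝ} (hδ : δ ≠ 0) (s : ℤˣ) (x : Part 0 n) :
    proj δ x ∈ intertwiners δ (reflection δ s) 0 n ↔
      ((s : ℤ) : ℂ) ^ n • proj δ x = proj δ x := by
  rw [mem_intertwiners, tensorPow, comp_unit, proj_zero_upper, comp_assoc, tensorPow_comp,
    reflection_comp_projOne hδ, tensorPow_smul, comp_smul_left]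

theorem singleton_mem_intertwiners_reflection_iff {δ : ℝ} (hδ : δ ≠ 0) (s : ℤˣ) :
    singleton ∈ intertwiners δ (reflection δ s) 0 1 ↔
      (-((s : ℤ) : ℂ)) • singleton = singleton := by
  rw [mem_intertwiners, tensorPow, comp_unit, tensorPow_one, reflection_comp_singleton hδ]

/-- A string with a singleton on either side. Applied to the second point of the pair partition it
produces `abac`, see `abac_eq`. -/
def flankedString : Part 1 3 := tensor (tensor singleton idPart) singleton

theorem tensor_comp_flankedString (δ : ℂ) (x y z : Part 1 1) :
    comp δ (tensor (tensor x y) z) flankedString =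
      tensor (tensor (comp δ x singleton) y) (comp δ z singleton) := by
  rw [flankedString]
  refine (tensor_comp_tensor δ (tensor x y) z (tensor singleton idPart) singleton).trans ?_
  refine congrArg (fun t => tensor t (comp δ z singleton)) ?_
  refine (tensor_comp_tensor δ x y singleton idPart).trans ?_
  rw [comp_idPart]

theorem flankedString_comp (δ : ℂ) (y : Part 1 1) :
    comp δ flankedString y = tensor (tensor singleton y) singleton := by
  have h : y = tensor (tensor (toPart (⊤ : Partn 0 0)) y) (toPart (⊤ : Partn 0 0)) := by
    rw [tensor_unit]; exact (tensor_unit_left y).symm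
  conv_lhs => rw [h]
  refine (tensor_comp_tensor δ (tensor singleton idPart) singleton
    (tensor (toPart (⊤ : Partn 0 0)) y) (toPart ⊤)).trans ?_
  rw [comp_unit]
  refine congrArg (fun t => tensor t singleton) ?_
  refine (tensor_comp_tensor δ singleton idPart (toPart (⊤ : Partn 0 0)) y).trans ?_
  rw [comp_unit, idPart_comp]

theorem flankedString_mem_intertwiners_reflection {δ : ℝ} (hδ : δ ≠ 0) (s : ℤˣ) :
    flankedString ∈ intertwiners δ (reflection δ s) 1 3 := by
  rw [mem_intertwiners, tensorPow_one, tensorPow_three, flankedString_comp]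
  refine (tensor_comp_flankedString _ _ _ _).trans ?_
  rw [reflection_comp_singleton hδ, tensor_smul_right, tensor_smul_left, tensor_smul_left,
    smul_smul, neg_mul_neg, unit_cast_mul_self, one_smul]

/-- The partition underlying `tensor idPart flankedString`. -/
def idFlankedPartn : Partn 2 4 :=
  tensorPartn (⊤ : Partn 1 1) (tensorPartn (tensorPartn (⊥ : Partn 0 1) (⊤ : Partn 1 1))
    (⊥ : Partn 0 1))

theorem tensor_idPart_flankedString : tensor idPart flankedString = toPart idFlankedPartn := by
  rw [flankedString, singleton_eq, idPart, tensor_toPart, tensor_toPart]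
  exact tensor_toPart _ _

theorem compat_idFlankedPartn_iff {β : Type*} {y : Fin 2 → β} {z : Fin 4 → β} :
    Compat idFlankedPartn y z ↔ y 0 = z 0 ∧ y 1 = z 2 := by
  refine (compat_tensorPartn_iff (k := 1) (l := 1) (k' := 1) (l' := 3)).trans ?_
  refine (and_congr_right fun _ => (compat_tensorPartn_iff (k := 1) (l := 2) (k' := 0)
    (l' := 1)).trans ((and_iff_left compat_bot).trans
    ((compat_tensorPartn_iff (k := 0) (l := 1) (k' := 1) (l' := 1)).trans
    (and_iff_right compat_bot)))).trans ?_
  rw [compat_top_iff, compat_top_iff]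
  simp only [funext_iff, Fin.forall_fin_one]
  rfl

theorem abac_eq (δ : ℂ) : comp δ (tensor idPart flankedString) pair = abac := by
  refine (congrArg (fun t : Part 2 4 => comp δ t pair) tensor_idPart_flankedString).trans ?_
  rw [pair_eq, abac, word]
  refine comp_toPart_eq δ (fun x z _ => z 0) fun x y z => ?_
  rw [compat_pair_iff, compat_word_iff, compat_idFlankedPartn_iff]
  simp only [funext_iff, Fin.forall_fin_two]
  constructor
  · rintro ⟨h1, h2, h3⟩
    refine ⟨⟨h2, h1.symm.trans h2⟩, ?_⟩
    have : z 0 = z 2 := by rw [← h2, ← h3, h1]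
    intro i j
    fin_cases i <;> fin_cases j <;> simp [this]
  · rintro ⟨⟨h1, h2⟩, h3⟩
    exact ⟨h1.trans h2.symm, h1, h2.trans (h3 0 2 rfl)⟩

end Elementary

/-! ### Isolated lower points -/

section Isolated

variable {k l m n k' l' : ℕ}

/-- The lower point `i` forms a block of its own. -/
def IsolatedLower (p : Partn k l) (i : Fin l) : Prop := ∀ b, p (Sum.inr i) b → b = Sum.inr i

theorem elim_update (x : Fin k → Bool) (y : Fin l → Bool) (i : Fin l) (b : Bool) :
    Sum.elim x (Function.update y i b) = Function.update (Sum.elim x y) (Sum.inr i) b := by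
  funext a
  rcases a with a | a
  · simp
  · by_cases h : a = i
    · subst h; simp
    · simp [h]

/-- A lower point is isolated if its label can be changed at will. -/
theorem isolatedLower_iff {p : Partn k l} {i : Fin l} :
    IsolatedLower p i ↔ ∀ (x : Fin k → Bool) (y : Fin l → Bool) (b : Bool), Compat p x y →
      Compat p x (Function.update y i b) := by
  constructor
  · intro h x y b hc a a' haa
    rw [Setoid.ker_def, elim_update]
    by_cases ha : a = Sum.inr i
    · subst ha; rw [h _ haa]
    · by_cases ha' : a' = Sum.inr i
      · subst ha'; rw [h _ (p.symm' haa)]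
      · rw [Function.update_of_ne ha, Function.update_of_ne ha']
        exact hc haa
  · intro h b hb
    by_contra hne
    have := h _ _ false (compat_const p true) hb
    rw [Setoid.ker_def, elim_update, Function.update_self, Function.update_of_ne hne] at this
    rcases b with b | b <;> simp at this

theorem IsolatedLower.compPartn {q : Partn l m} {i : Fin m} (h : IsolatedLower q i)
    (p : Partn k l) : IsolatedLower (compPartn q p) i := by
  rw [isolatedLower_iff] at h ⊢
  intro x z b hc
  obtain ⟨y, hp, hq⟩ := compat_compPartn_iff.1 hc
  exact compat_compPartn_iff.2 ⟨y, hp, h y z b hq⟩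

theorem IsolatedLower.tensorPartn_left {p : Partn k l} {i : Fin l} (h : IsolatedLower p i)
    (q : Partn k' l') : IsolatedLower (tensorPartn p q) (Fin.castAdd l' i) := by
  rw [isolatedLower_iff] at h ⊢
  intro x y b hc
  rw [compat_tensorPartn_iff] at hc ⊢
  refine ⟨?_, ?_⟩
  · convert h _ _ b hc.1 using 1
    funext j
    by_cases hj : j = i
    · subst hj; simp
    · simp [hj]
  · convert hc.2 using 1
    funext j
    rw [Function.update_of_ne]
    intro e
    have := congrArg Fin.val e
    simp only [Fin.val_natAdd, Fin.val_castAdd] at this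
    omega

theorem IsolatedLower.tensorPartn_right {q : Partn k' l'} {i : Fin l'} (h : IsolatedLower q i)
    (p : Partn k l) : IsolatedLower (tensorPartn p q) (Fin.natAdd l i) := by
  rw [isolatedLower_iff] at h ⊢
  intro x y b hc
  rw [compat_tensorPartn_iff] at hc ⊢
  refine ⟨?_, ?_⟩
  · convert hc.1 using 1
    funext j
    rw [Function.update_of_ne]
    intro e
    have := congrArg Fin.val e
    simp only [Fin.val_natAdd, Fin.val_castAdd] at this
    omega
  · convert h _ _ b hc.2 using 1
    funext j
    by_cases hj : j = i
    · subst hj; simp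
    · simp [hj]

theorem isolatedLower_bot (i : Fin l) : IsolatedLower (⊥ : Partn k l) i := fun _ h => Eq.symm h

/-- The span of the partitions that have an isolated lower point. -/
def isolatedSpan (k l : ℕ) : Submodule ℂ (Part k l) :=
  Submodule.span ℂ (toPart '' {p | ∃ i, IsolatedLower p i})

theorem toPart_mem_isolatedSpan {p : Partn k l} {i : Fin l} (h : IsolatedLower p i) :
    toPart p ∈ isolatedSpan k l := Submodule.subset_span ⟨p, ⟨i, h⟩, rfl⟩

/-- Bilinear operations on spans of partitions can be checked on partitions. -/
theorem map₂_mem {M : Type*} [AddCommGroup M] [Module ℂ M] (f : Part k l →ₗ[ℂ] Part k' l' →ₗ[ℂ] M)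
    {S : Submodule ℂ M} {A : Set (Partn k l)} {B : Set (Partn k' l')}
    (h : ∀ p ∈ A, ∀ q ∈ B, f (toPart p) (toPart q) ∈ S) {x : Part k l} {y : Part k' l'}
    (hx : x ∈ Submodule.span ℂ (toPart '' A)) (hy : y ∈ Submodule.span ℂ (toPart '' B)) :
    f x y ∈ S :=
  LinearMap.BilinMap.apply_apply_mem_of_mem_span S _ _ f
    (by rintro _ ⟨p, hp, rfl⟩ _ ⟨q, hq, rfl⟩; exact h p hp q hq) _ _ hx hy

theorem mem_span_univ (x : Part k l) : x ∈ Submodule.span ℂ (toPart '' Set.univ) := by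
  induction x using part_induction with
  | h0 => exact zero_mem _
  | hadd x y hx hy => exact add_mem hx hy
  | hsmul c p => exact Submodule.smul_mem _ _ (Submodule.subset_span ⟨p, trivial, rfl⟩)

theorem comp_mem_isolatedSpan (δ : ℂ) {y : Part l m} (hy : y ∈ isolatedSpan l m) (x : Part k l) :
    comp δ y x ∈ isolatedSpan k m :=
  map₂_mem (compₗ δ) (by
    rintro q ⟨i, hi⟩ p -
    rw [compₗ_apply, comp_toPart]
    exact Submodule.smul_mem _ _ (toPart_mem_isolatedSpan (hi.compPartn p))) hy (mem_span_univ x)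

theorem tensor_mem_isolatedSpan_left {x : Part k l} (hx : x ∈ isolatedSpan k l)
    (y : Part k' l') : tensor x y ∈ isolatedSpan (k + k') (l + l') :=
  map₂_mem tensorₗ (by
    rintro q ⟨i, hi⟩ p -
    rw [tensorₗ_apply, tensor_toPart]
    exact toPart_mem_isolatedSpan (hi.tensorPartn_left p)) hx (mem_span_univ y)

theorem tensor_mem_isolatedSpan_right (x : Part k l) {y : Part k' l'}
    (hy : y ∈ isolatedSpan k' l') : tensor x y ∈ isolatedSpan (k + k') (l + l') :=
  map₂_mem tensorₗ (by
    rintro p - q ⟨i, hi⟩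
    rw [tensorₗ_apply, tensor_toPart]
    exact toPart_mem_isolatedSpan (hi.tensorPartn_right p)) (mem_span_univ x) hy

/-- Each correction term in `π_(δ)^{⊗ n} = id^{⊗ n} + ...` has a factor `disconnecter`. -/
theorem tensorPow_projOne_sub_mem (δ : ℂ) (n : ℕ) :
    tensorPow (projOne δ) n - toPart (idPartn n) ∈ isolatedSpan n n := by
  induction n with
  | zero => rw [tensorPow, idPartn_zero, sub_self]; exact zero_mem _
  | succ n ih =>
    have h : tensorPow (projOne δ) (n + 1) - toPart (idPartn (n + 1)) =
        tensor (tensorPow (projOne δ) n - toPart (idPartn n)) idPart -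
          (1 / δ) • tensor (tensorPow (projOne δ) n) disconnecter := by
      rw [← tensorPow_idPart, ← tensorPow_idPart, tensorPow, tensorPow]
      nth_rewrite 2 [projOne]
      rw [tensor_sub_right, tensor_sub_left, tensor_smul_right]
      abel
    rw [h]
    exact sub_mem (tensor_mem_isolatedSpan_left ih _) (Submodule.smul_mem _ _
      (tensor_mem_isolatedSpan_right _ (toPart_mem_isolatedSpan (isolatedLower_bot 0))))

theorem proj_sub_mem_isolatedSpan (δ : ℂ) (x : Part 0 n) : proj δ x - x ∈ isolatedSpan 0 n := by
  have h := comp_mem_isolatedSpan δ (tensorPow_projOne_sub_mem δ n) x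
  rwa [comp_sub_left, idPartn_comp, ← proj_zero_upper] at h

theorem apply_eq_zero_of_mem_isolatedSpan {x : Part k l} (hx : x ∈ isolatedSpan k l)
    {p : Partn k l} (hp : ∀ i, ¬ IsolatedLower p i) : x p = 0 := by
  refine (Submodule.span_le (p := LinearMap.ker (Finsupp.lapply (R := ℂ) (M := ℂ) p))).2 ?_ hx
  rintro _ ⟨q, ⟨i, hi⟩, rfl⟩
  have : q ≠ p := fun e => hp i (e ▸ hi)
  simp [toPart, this]

/-- The projection keeps the coefficient of a partition without isolated points. -/
theorem proj_toPart_apply (δ : ℂ) {p : Partn 0 n} (hp : ∀ i, ¬ IsolatedLower p i) :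
    proj δ (toPart p) p = 1 := by
  have h := apply_eq_zero_of_mem_isolatedSpan (proj_sub_mem_isolatedSpan δ (toPart p)) hp
  rw [Finsupp.sub_apply, sub_eq_zero] at h
  rw [h, toPart, Finsupp.single_eq_same]

end Isolated

/-! ### Linear categories -/

section Category

variable {k l m n k' l' : ℕ} {δ : ℂ} {K : Family}

theorem generated_le {x : Part k l} {y : Part k' l'} (hK : IsLinearCategory δ K)
    (hx : x ∈ K k l) (hy : y ∈ K k' l') : generated δ x y ≤ K :=
  fun _ _ _ hz => mem_generated.1 hz K hK hx hy

theorem left_mem_generated (x : Part k l) (y : Part k' l') : x ∈ generated δ x y k l :=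
  mem_generated.2 fun _ _ hx _ => hx

theorem right_mem_generated (x : Part k l) (y : Part k' l') : y ∈ generated δ x y k' l' :=
  mem_generated.2 fun _ _ _ hy => hy

/-- Since `δ ≠ 0`, loops can be ignored when membership of partitions is concerned. -/
theorem IsLinearCategory.compPartn_mem (hK : IsLinearCategory δ K) (hδ : δ ≠ 0) {q : Partn l m}
    {p : Partn k l} (hq : toPart q ∈ K l m) (hp : toPart p ∈ K k l) :
    toPart (compPartn q p) ∈ K k m := by
  have h := hK.comp_mem hq hp
  rw [comp_toPart] at h
  exact (Submodule.smul_mem_iff _ (pow_ne_zero _ hδ)).1 h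

theorem IsLinearCategory.tensorPartn_mem (hK : IsLinearCategory δ K) {p : Partn k l}
    {q : Partn k' l'} (hp : toPart p ∈ K k l) (hq : toPart q ∈ K k' l') :
    toPart (tensorPartn p q) ∈ K (k + k') (l + l') := by
  rw [← tensor_toPart]; exact hK.tensor_mem hp hq

theorem IsLinearCategory.starPartn_mem (hK : IsLinearCategory δ K) {p : Partn k l}
    (hp : toPart p ∈ K k l) : toPart (starPartn p) ∈ K l k := by
  rw [← invol_toPart]; exact hK.invol_mem hp

theorem IsLinearCategory.starPartn_mem_iff (hK : IsLinearCategory δ K) {p : Partn k l} :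
    toPart (starPartn p) ∈ K l k ↔ toPart p ∈ K k l :=
  ⟨fun h => by simpa only [starPartn_starPartn] using hK.starPartn_mem h, hK.starPartn_mem⟩

theorem IsLinearCategory.unit_mem (hK : IsLinearCategory δ K) (hδ : δ ≠ 0) (p : Partn 0 0) :
    toPart p ∈ K 0 0 := by
  have h : toPart (⊤ : Partn 0 2) ∈ K 0 2 := pair_eq ▸ hK.pair_mem
  rw [partn_zero_eq p, ← partn_zero_eq (compPartn (starPartn (⊤ : Partn 0 2)) ⊤)]
  exact hK.compPartn_mem hδ (hK.starPartn_mem h) h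

theorem IsLinearCategory.idPartn_mem (hK : IsLinearCategory δ K) (hδ : δ ≠ 0) (n : ℕ) :
    toPart (idPartn n) ∈ K n n := by
  induction n with
  | zero => exact hK.unit_mem hδ _
  | succ n ih =>
    rw [← tensorPartn_idPartn]
    exact hK.tensorPartn_mem ih (idPartn_one ▸ hK.id_mem)

theorem IsLinearCategory.tensorPow_mem (hK : IsLinearCategory δ K) (hδ : δ ≠ 0) {x : Part 1 1}
    (hx : x ∈ K 1 1) (n : ℕ) : tensorPow x n ∈ K n n := by
  induction n with
  | zero => exact hK.unit_mem hδ _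
  | succ n ih => exact hK.tensor_mem ih hx

theorem IsLinearCategory.projOne_mem (hK : IsLinearCategory δ K)
    (hd : disconnecter ∈ K 1 1) : projOne δ ∈ K 1 1 :=
  sub_mem hK.id_mem (Submodule.smul_mem _ _ hd)

theorem IsLinearCategory.proj_mem (hK : IsLinearCategory δ K) (hδ : δ ≠ 0)
    (hd : disconnecter ∈ K 1 1) {x : Part k l} (hx : x ∈ K k l) : proj δ x ∈ K k l :=
  hK.comp_mem (hK.tensorPow_mem hδ (hK.projOne_mem hd) l)
    (hK.comp_mem hx (hK.tensorPow_mem hδ (hK.projOne_mem hd) k))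

/-! ### Bending a lower point upwards -/

/-- Bend the last lower point of a partition without upper points to the upper row. -/
def bend (p : Partn 0 (n + 1)) : Partn 1 n :=
  compPartn (tensorPartn (idPartn n) (starPartn (⊤ : Partn 0 2)))
    (tensorPartn (l := n + 1) (k' := 1) (l' := 1) p ⊤)

theorem IsLinearCategory.bend_mem (hK : IsLinearCategory δ K) (hδ : δ ≠ 0)
    {p : Partn 0 (n + 1)} (hp : toPart p ∈ K 0 (n + 1)) : toPart (bend p) ∈ K 1 n := by
  have h : toPart (⊤ : Partn 0 2) ∈ K 0 2 := pair_eq ▸ hK.pair_mem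
  exact hK.compPartn_mem hδ (l := n + 2) (hK.tensorPartn_mem (k' := 2) (l' := 0)
    (hK.idPartn_mem hδ n) (hK.starPartn_mem h))
    (hK.tensorPartn_mem (k := 0) (k' := 1) (l' := 1) hp hK.id_mem)

theorem compat_bend_iff {p : Partn 0 (n + 1)} {x : Fin 1 → Bool} {z : Fin n → Bool} :
    Compat (bend p) x z ↔ Compat p Fin.elim0 (Fin.snoc z (x 0)) := by
  have h0 : ∀ i : Fin 1, Fin.natAdd 0 i = i := fun i => Fin.ext (Nat.zero_add _)
  refine (compat_compPartn_iff (l := n + 2) (k := 1)).trans ?_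
  have e1 : ∀ y : Fin (n + 2) → Bool, Compat (tensorPartn p (⊤ : Partn 1 1)) x y ↔
      Compat p Fin.elim0 (fun j => y (Fin.castSucc j)) ∧ x 0 = y (Fin.last (n + 1)) := by
    intro y
    refine (compat_tensorPartn_iff (k := 0) (l := n + 1) (k' := 1) (l' := 1)).trans ?_
    rw [compat_top_iff, funext_iff, Fin.forall_fin_one]
    refine and_congr (iff_of_eq (congrArg₂ _ (Subsingleton.elim _ _) rfl)) ?_
    rw [h0]
    rfl
  have e2 : ∀ y : Fin (n + 2) → Bool,
      Compat (tensorPartn (idPartn n) (starPartn (⊤ : Partn 0 2))) y z ↔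
      (∀ j : Fin n, y (Fin.castSucc (Fin.castSucc j)) = z j) ∧
        y (Fin.castSucc (Fin.last n)) = y (Fin.last (n + 1)) := by
    intro y
    refine (compat_tensorPartn_iff (k := n) (l := n) (k' := 2) (l' := 0)).trans ?_
    rw [compat_idPartn_iff, compat_starPartn_iff, compat_pair_iff, funext_iff]
    rfl
  simp only [e1, e2]
  constructor
  · rintro ⟨y, ⟨h1, h2⟩, h3, h4⟩
    convert h1 using 1
    funext j
    induction j using Fin.lastCases with
    | last => rw [Fin.snoc_last, h2, h4]
    | cast j => rw [Fin.snoc_castSucc, h3]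
  · intro h
    refine ⟨Fin.snoc (Fin.snoc z (x 0)) (x 0), ⟨?_, ?_⟩, ?_, ?_⟩
    · simpa using h
    all_goals simp

theorem IsLinearCategory.disconnecter_mem (hK : IsLinearCategory δ K) (hδ : δ ≠ 0)
    (h : tensor singleton singleton ∈ K 0 2) : disconnecter ∈ K 1 1 := by
  rw [tensor_singleton_singleton] at h
  have e : bend (⊥ : Partn 0 2) = ⊥ := ext_compat fun x z =>
    iff_of_true (compat_bend_iff.2 compat_bot) compat_bot
  rw [disconnecter, ← e]
  exact hK.bend_mem hδ h

/-! ### Inserting isolated points -/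

/-- The partition that inserts a new isolated point at place `i` of the lower row. -/
def insertPartn (n : ℕ) (i : Fin (n + 1)) : Partn n (n + 1) :=
  Setoid.ker (Sum.elim some (Fin.insertNth (α := fun _ => Option (Fin n)) i none some))

theorem compat_insertPartn_iff {β : Type*} {i : Fin (n + 1)} {x : Fin n → β} {y : Fin (n + 1) → β} :
    Compat (insertPartn n i) x y ↔ ∀ j, x j = y (i.succAbove j) := by
  rw [insertPartn, compat_ker_iff]
  constructor
  · rintro ⟨-, h, -⟩ j
    exact h _ _ (by simp)
  · intro h
    refine ⟨fun a b hab => ?_, fun a b hab => ?_, fun a b hab => ?_⟩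
    · rw [Option.some_injective _ hab]
    · rcases Fin.eq_self_or_eq_succAbove i b with rfl | ⟨c, rfl⟩
      · simp at hab
      · simp only [Fin.insertNth_apply_succAbove, Option.some.injEq] at hab
        rw [hab, h]
    · rcases Fin.eq_self_or_eq_succAbove i a with h₁ | ⟨c, rfl⟩ <;>
        rcases Fin.eq_self_or_eq_succAbove i b with h₂ | ⟨d, rfl⟩
      · rw [h₁, h₂]
      · subst h₁; simp at hab
      · subst h₂; simp at hab
      · simp only [Fin.insertNth_apply_succAbove, Option.some.injEq] at hab
        rw [hab]

theorem insertPartn_last (n : ℕ) :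
    insertPartn n (Fin.last n) = tensorPartn (idPartn n) (⊥ : Partn 0 1) := by
  refine ext_compat fun x y => ?_
  rw [compat_insertPartn_iff]
  refine Iff.trans ?_ (compat_tensorPartn_iff (k := n) (l := n) (k' := 0) (l' := 1)).symm
  rw [compat_idPartn_iff, funext_iff, and_iff_left compat_bot]
  simp only [Fin.succAbove_last]
  rfl

theorem insertPartn_castSucc (n : ℕ) (i : Fin (n + 1)) :
    insertPartn (n + 1) i.castSucc = tensorPartn (insertPartn n i) (⊤ : Partn 1 1) := by
  refine ext_compat fun x y => ?_
  rw [compat_insertPartn_iff, Fin.forall_fin_succ']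
  refine Iff.trans ?_ (compat_tensorPartn_iff (k := n) (l := n + 1) (k' := 1) (l' := 1)).symm
  rw [compat_insertPartn_iff, compat_top_iff, funext_iff, Fin.forall_fin_one]
  have e : i.castSucc.succAbove (Fin.last n) = Fin.last (n + 1) := by
    rw [Fin.succAbove_of_le_castSucc _ _ (Fin.castSucc_le_castSucc_iff.2 (Fin.le_last i)),
      Fin.succ_last]
  simp only [Fin.castSucc_succAbove_castSucc, e]
  rfl

theorem IsLinearCategory.insertPartn_mem (hK : IsLinearCategory δ K) (hδ : δ ≠ 0)
    (hs : singleton ∈ K 0 1) (n : ℕ) (i : Fin (n + 1)) :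
    toPart (insertPartn n i) ∈ K n (n + 1) := by
  induction n with
  | zero =>
    obtain rfl : i = Fin.last 0 := Fin.ext (by omega)
    rw [insertPartn_last]
    exact hK.tensorPartn_mem (hK.idPartn_mem hδ 0) (singleton_eq ▸ hs)
  | succ n ih =>
    induction i using Fin.lastCases with
    | last =>
      rw [insertPartn_last]
      exact hK.tensorPartn_mem (hK.idPartn_mem hδ _) (singleton_eq ▸ hs)
    | cast i =>
      rw [insertPartn_castSucc]
      exact hK.tensorPartn_mem (ih i) hK.id_mem

/-- A partition with an isolated lower point arises by inserting that point. -/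
theorem insertPartn_comp {p : Partn k (n + 1)} {i : Fin (n + 1)} (h : IsolatedLower p i) :
    compPartn (insertPartn n i) (Setoid.comap (Sum.map id i.succAbove) p) = p := by
  refine compPartn_eq fun x z => ?_
  constructor
  · intro hc
    refine ⟨fun j => z (i.succAbove j), ?_, compat_insertPartn_iff.2 fun j => rfl⟩
    intro a b hab
    have := hc hab
    rw [Setoid.ker_def] at this ⊢
    rcases a with a | a <;> rcases b with b | b <;> exact this
  · rintro ⟨y, h1, h2⟩ a b hab
    rw [compat_insertPartn_iff] at h2
    have hy : y = fun j => z (i.succAbove j) := funext h2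
    subst hy
    have hcov : ∀ c : Fin k ⊕ Fin (n + 1), c = Sum.inr i ∨
        ∃ d : Fin k ⊕ Fin n, c = Sum.map id i.succAbove d := by
      rintro (c | c)
      · exact Or.inr ⟨Sum.inl c, rfl⟩
      · rcases Fin.eq_self_or_eq_succAbove i c with rfl | ⟨d, rfl⟩
        · exact Or.inl rfl
        · exact Or.inr ⟨Sum.inr d, rfl⟩
    rcases hcov a with rfl | ⟨c, rfl⟩
    · rw [h b hab]
    rcases hcov b with rfl | ⟨d, rfl⟩
    · rw [h _ (p.symm' hab)]
    have := @h1 c d hab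
    rw [Setoid.ker_def] at this ⊢
    rcases c with c | c <;> rcases d with d | d <;> exact this

theorem IsLinearCategory.mem_of_isolatedLower (hK : IsLinearCategory δ K) (hδ : δ ≠ 0)
    (hs : singleton ∈ K 0 1) {p : Partn k (n + 1)} {i : Fin (n + 1)} (h : IsolatedLower p i)
    (hp : toPart (Setoid.comap (Sum.map id i.succAbove) p : Partn k n) ∈ K k n) :
    toPart p ∈ K k (n + 1) := by
  rw [← insertPartn_comp h]
  exact hK.compPartn_mem hδ (hK.insertPartn_mem hδ hs n i) hp

theorem partn_zero_two_eq (p : Partn 0 2) : p = ⊤ ∨ p = ⊥ := by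
  by_cases h : p (Sum.inr 0) (Sum.inr 1)
  · left
    refine top_le_iff.1 fun a b _ => ?_
    rcases a with a | a
    · exact a.elim0
    rcases b with b | b
    · exact b.elim0
    fin_cases a <;> fin_cases b
    exacts [p.refl' _, h, p.symm' h, p.refl' _]
  · right
    refine le_bot_iff.1 fun a b hab => ?_
    rcases a with a | a
    · exact a.elim0
    rcases b with b | b
    · exact b.elim0
    fin_cases a <;> fin_cases b
    exacts [rfl, (h hab).elim, (h (p.symm' hab)).elim, rfl]

theorem IsLinearCategory.isolatedSpan_le (hK : IsLinearCategory δ K) (hδ : δ ≠ 0)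
    (hs : singleton ∈ K 0 1) : isolatedSpan 0 3 ≤ K 0 3 := by
  refine Submodule.span_le.2 ?_
  rintro _ ⟨p, ⟨i, hi⟩, rfl⟩
  refine hK.mem_of_isolatedLower hδ hs hi ?_
  rcases partn_zero_two_eq (Setoid.comap (Sum.map id i.succAbove) p) with h | h
  · rw [h, ← pair_eq]; exact hK.pair_mem
  · rw [h, ← tensor_singleton_singleton]; exact hK.tensor_mem hs hs

/-- In the presence of the singleton, `𝒫_(δ)` only adds elements of the category. -/
theorem IsLinearCategory.proj_mem_iff (hK : IsLinearCategory δ K) (hδ : δ ≠ 0)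
    (hs : singleton ∈ K 0 1) (x : Part 0 3) : proj δ x ∈ K 0 3 ↔ x ∈ K 0 3 := by
  have h := hK.isolatedSpan_le hδ hs (proj_sub_mem_isolatedSpan δ x)
  exact ⟨fun hx => by simpa using sub_mem hx h, fun hx => by simpa using add_mem h hx⟩

end Category

/-! ### The four-block from two three-blocks -/

section FourBlock

variable {K : Family}

theorem copair_comp_tensorPow {δ : ℝ} (hδ : δ ≠ 0) :
    comp δ copair (tensorPow (projOne δ) 2) =
      copair - (1 / (δ : ℂ)) • tensor cosingleton cosingleton := by
  have h := congrArg invol (tensor_projOne_projOne_comp_pair (Complex.ofReal_ne_zero.2 hδ))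
  rw [invol_comp, ← tensorPow_two, invol_tensorPow, invol_projOne, invol_sub, invol_smul,
    invol_tensor, invol_singleton, map_div₀, map_one, Complex.conj_ofReal] at h
  exact h

/-- Apply `x` to the third and fourth of six points, and leave the others unchanged. -/
def contractMiddle (x : Part 2 0) : Part 6 4 :=
  tensor (tensor (toPart (idPartn 2)) x) (toPart (idPartn 2))

theorem contractMiddle_sub_smul (x y : Part 2 0) (c : ℂ) :
    contractMiddle (x - c • y) = contractMiddle x - c • contractMiddle y := by
  simp only [contractMiddle, tensor_sub_right, tensor_smul_right, tensor_sub_left, tensor_smul_left]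

theorem contractMiddle_comp_tensorPow (δ : ℂ) (x : Part 2 0) (y : Part 1 1) :
    comp δ (contractMiddle x) (tensorPow y 6) =
      comp δ (tensorPow y 4) (contractMiddle (comp δ x (tensorPow y 2))) := by
  have h6 : tensorPow y 6 = tensor (tensor (tensorPow y 2) (tensorPow y 2)) (tensorPow y 2) :=
    (tensorPow_add y 4 2).trans (congrArg (fun t => tensor t (tensorPow y 2)) (tensorPow_add y 2 2))
  have h4 : tensorPow y 4 = tensor (tensor (tensorPow y 2) (toPart (⊤ : Partn 0 0)))
      (tensorPow y 2) := by
    rw [tensor_unit]; exact tensorPow_add y 2 2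
  rw [h6, h4]
  refine (tensor_comp_tensor δ (tensor (toPart (idPartn 2)) x) (toPart (idPartn 2))
    (tensor (tensorPow y 2) (tensorPow y 2)) (tensorPow y 2)).trans ?_
  refine Eq.trans ?_ (tensor_comp_tensor δ (tensor (tensorPow y 2) (toPart (⊤ : Partn 0 0)))
    (tensorPow y 2) (tensor (toPart (idPartn 2)) (comp δ x (tensorPow y 2)))
    (toPart (idPartn 2))).symm
  rw [tensor_comp_tensor, tensor_comp_tensor, idPartn_comp, comp_idPartn, ← idPartn_zero,
    idPartn_comp]

theorem compat_block3_iff {β : Type*} {x : Fin 0 → β} {y : Fin 3 → β} :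
    Compat (Setoid.ker (Sum.elim Fin.elim0 ![0, 0, 0]) : Partn 0 3) x y ↔
      y 0 = y 1 ∧ y 1 = y 2 := by
  rw [compat_word_iff]
  refine ⟨fun h => ⟨h 0 1 rfl, h 1 2 rfl⟩, ?_⟩
  rintro ⟨h1, h2⟩ i j -
  fin_cases i <;> fin_cases j <;> simp [h1, h2]

theorem compat_block4_iff {β : Type*} {x : Fin 0 → β} {y : Fin 4 → β} :
    Compat (Setoid.ker (Sum.elim Fin.elim0 ![0, 0, 0, 0]) : Partn 0 4) x y ↔
      y 0 = y 1 ∧ y 1 = y 2 ∧ y 2 = y 3 := by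
  rw [compat_word_iff]
  refine ⟨fun h => ⟨h 0 1 rfl, h 1 2 rfl, h 2 3 rfl⟩, ?_⟩
  rintro ⟨h1, h2, h3⟩ i j -
  fin_cases i <;> fin_cases j <;> simp [h1, h2, h3]

theorem compat_tensor_block3_iff {x : Fin 0 → Bool} {y : Fin 6 → Bool} :
    Compat (tensorPartn (Setoid.ker (Sum.elim Fin.elim0 ![0, 0, 0]) : Partn 0 3)
      (Setoid.ker (Sum.elim Fin.elim0 ![0, 0, 0]) : Partn 0 3)) x y ↔
      (y 0 = y 1 ∧ y 1 = y 2) ∧ (y 3 = y 4 ∧ y 4 = y 5) := by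
  refine (compat_tensorPartn_iff (k := 0) (l := 3) (k' := 0) (l' := 3)).trans ?_
  rw [compat_block3_iff, compat_block3_iff]
  rfl

theorem compat_contractMiddle_iff {r : Partn 2 0} {y : Fin 6 → Bool} {z : Fin 4 → Bool} :
    Compat (tensorPartn (tensorPartn (idPartn 2) r) (idPartn 2)) y z ↔
      (y 0 = z 0 ∧ y 1 = z 1) ∧ Compat r ![y 2, y 3] Fin.elim0 ∧ (y 4 = z 2 ∧ y 5 = z 3) := by
  refine (compat_tensorPartn_iff (k := 4) (l := 2) (k' := 2) (l' := 2)).trans ?_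
  refine (and_congr_left' (compat_tensorPartn_iff (k := 2) (l := 2) (k' := 2) (l' := 0))).trans ?_
  rw [compat_idPartn_iff, compat_idPartn_iff, and_assoc, funext_iff, funext_iff,
    Fin.forall_fin_two, Fin.forall_fin_two]
  refine and_congr Iff.rfl (and_congr (iff_of_eq (congrArg₂ _ ?_ (Subsingleton.elim _ _))) Iff.rfl)
  funext i
  fin_cases i <;> rfl

theorem contractMiddle_copair (δ : ℂ) :
    comp δ (contractMiddle copair) (tensor block3 block3) = block4 := by
  rw [contractMiddle, copair, pair_eq, invol_toPart, block3, word, tensor_toPart, tensor_toPart,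
    tensor_toPart, block4, word]
  refine comp_toPart_eq (l := 6) δ (fun _ z => ![z 0, z 1, z 1, z 2, z 2, z 3]) fun x y z => ?_
  rw [compat_tensor_block3_iff, compat_contractMiddle_iff, compat_block4_iff, compat_starPartn_iff,
    compat_pair_iff]
  constructor
  · rintro ⟨⟨⟨h1, h2⟩, h3, h4⟩, ⟨h5, h6⟩, h7, h8, h9⟩
    change y 2 = y 3 at h7
    refine ⟨?_, ?_⟩
    · funext i
      fin_cases i <;> simp_all
    · simp_all
  · rintro ⟨rfl, h⟩
    simp_all

theorem contractMiddle_cosingletons (δ : ℂ) :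
    comp δ (contractMiddle (tensor cosingleton cosingleton)) (tensor block3 block3) =
      tensor pair pair := by
  rw [contractMiddle, pair_eq, cosingleton, tensor_toPart, block3, word, tensor_toPart,
    tensor_toPart, tensor_toPart, tensor_toPart]
  refine comp_toPart_eq (l := 6) δ (fun _ z => ![z 0, z 1, z 1, z 2, z 2, z 3]) fun x y z => ?_
  rw [compat_tensor_block3_iff]
  refine (and_congr_right fun _ => compat_contractMiddle_iff).trans ?_
  refine Iff.trans ?_ (and_congr_right fun _ => compat_tensorPartn_iff
    (k := 0) (l := 2) (k' := 0) (l' := 2)).symm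
  rw [compat_pair_iff, compat_pair_iff]
  change _ ↔ _ ∧ z 0 = z 1 ∧ z 2 = z 3
  have e : Compat (tensorPartn (⊥ : Partn 1 0) (⊥ : Partn 1 0)) ![y 2, y 3] Fin.elim0 :=
    compat_tensorPartn_iff.2 ⟨compat_bot, compat_bot⟩
  constructor
  · rintro ⟨⟨⟨h1, h2⟩, h3, h4⟩, ⟨h5, h6⟩, -, h8, h9⟩
    refine ⟨?_, ?_⟩
    · funext i
      fin_cases i <;> simp_all
    · simp_all
  · rintro ⟨h0, h⟩
    refine ⟨?_, ?_, e, ?_⟩ <;> subst h0 <;> simp_all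

/-- Contracting a leg of one copy of `𝒫 b₃` with a leg of another gives `𝒫 b₄ - δ⁻¹ 𝒫 (pair ⊗ pair)`: the
correction comes from the two projections that meet at the contracted legs. -/
theorem IsLinearCategory.proj_block4_mem {δ : ℝ} (hK : IsLinearCategory δ K) (hδ : δ ≠ 0)
    (hd : disconnecter ∈ K 1 1) (h3 : proj δ block3 ∈ K 0 3) : proj δ block4 ∈ K 0 4 := by
  have hδ' : (δ : ℂ) ≠ 0 := Complex.ofReal_ne_zero.2 hδ
  have hI : toPart (idPartn 2) ∈ K 2 2 := hK.idPartn_mem hδ' 2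
  have hc : contractMiddle copair ∈ K 6 4 :=
    hK.tensor_mem (hK.tensor_mem hI (hK.invol_mem hK.pair_mem)) hI
  have h6 : tensor (proj δ block3) (proj δ block3) ∈ K 0 6 := hK.tensor_mem h3 h3
  have h := hK.comp_mem hc h6
  have e : tensor (proj δ block3) (proj δ block3) =
      comp δ (tensorPow (projOne δ) 6) (tensor block3 block3) := by
    rw [proj_zero_upper, ← tensor_comp_tensor]
    exact congrArg (fun t => comp (δ : ℂ) t (tensor block3 block3))
      (tensorPow_add (projOne δ) 3 3).symm
  rw [e, comp_assoc, contractMiddle_comp_tensorPow, copair_comp_tensorPow hδ,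
    contractMiddle_sub_smul, ← comp_assoc, comp_sub_left, comp_smul_left, contractMiddle_copair,
    contractMiddle_cosingletons, comp_sub_right, comp_smul_right, ← proj_zero_upper] at h
  have hpp : tensor pair pair ∈ K 0 4 := hK.tensor_mem hK.pair_mem hK.pair_mem
  have hT : tensorPow (projOne δ) 4 ∈ K 4 4 := hK.tensorPow_mem hδ' (hK.projOne_mem hd) 4
  have h' := (K 0 4).smul_mem (1 / (δ : ℂ)) (hK.comp_mem hT hpp)
  simpa using add_mem h h'

end FourBlock

/-! ### Colour words -/

section Colour

variable {k l m n k' l' : ℕ}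

/-- The projections onto the two colours: `true` stands for the image of `π_(δ)` and `false` for
the multiples of the singleton. -/
def colorProj (δ : ℂ) : Bool → Part 1 1
  | true => projOne δ
  | false => (1 / δ) • disconnecter

/-- The tensor product of the colour projections along a word. -/
def wordProj (δ : ℂ) : (n : ℕ) → (Fin n → Bool) → Part n n
  | 0, _ => toPart ⊤
  | n + 1, w => tensor (wordProj δ n fun i => w i.castSucc) (colorProj δ (w (Fin.last n)))

theorem colorProj_comp_self {δ : ℂ} (hδ : δ ≠ 0) (a : Bool) :
    comp δ (colorProj δ a) (colorProj δ a) = colorProj δ a := by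
  cases a
  · rw [colorProj, comp_smul_left, comp_smul_right, disconnecter_comp_disconnecter, smul_smul _ δ,
      one_div, inv_mul_cancel₀ hδ, one_smul]
  · exact projOne_comp_projOne hδ

theorem colorProj_comp_of_ne {δ : ℂ} (hδ : δ ≠ 0) {a b : Bool} (h : a ≠ b) :
    comp δ (colorProj δ a) (colorProj δ b) = 0 := by
  cases a <;> cases b
  · exact absurd rfl h
  · rw [colorProj, colorProj, comp_smul_left, disconnecter_comp_projOne hδ, smul_zero]
  · rw [colorProj, colorProj, comp_smul_right, projOne_comp_disconnecter hδ, smul_zero]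
  · exact absurd rfl h

theorem colorProj_false_comp_singleton {δ : ℂ} (hδ : δ ≠ 0) :
    comp δ (colorProj δ false) singleton = singleton := by
  rw [colorProj, comp_smul_left, disconnecter_comp_singleton, smul_smul, one_div,
    inv_mul_cancel₀ hδ, one_smul]

theorem invol_colorProj (δ : ℝ) (a : Bool) : invol (colorProj δ a) = colorProj δ a := by
  cases a
  · rw [colorProj, invol_smul, invol_disconnecter, map_div₀, map_one, Complex.conj_ofReal]
  · exact invol_projOne δ

theorem wordProj_comp_self {δ : ℂ} (hδ : δ ≠ 0) (w : Fin n → Bool) :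
    comp δ (wordProj δ n w) (wordProj δ n w) = wordProj δ n w := by
  induction n with
  | zero => exact comp_unit δ _
  | succ n ih => rw [wordProj, tensor_comp_tensor, ih, colorProj_comp_self hδ]

theorem wordProj_comp_of_ne {δ : ℂ} (hδ : δ ≠ 0) {w u : Fin n → Bool} (h : w ≠ u) :
    comp δ (wordProj δ n w) (wordProj δ n u) = 0 := by
  induction n with
  | zero => exact absurd (Subsingleton.elim _ _) h
  | succ n ih =>
    rw [wordProj, wordProj, tensor_comp_tensor]
    by_cases hl : w (Fin.last n) = u (Fin.last n)
    · rw [ih, tensor_zero_left]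
      intro h'
      refine h (funext fun i => ?_)
      induction i using Fin.lastCases with
      | last => exact hl
      | cast i => exact congrFun h' i
    · rw [colorProj_comp_of_ne hδ hl, tensor_zero_right]

theorem invol_wordProj (δ : ℝ) (w : Fin n → Bool) :
    invol (wordProj δ n w) = wordProj δ n w := by
  induction n with
  | zero => rw [wordProj, invol_toPart, partn_zero_eq (starPartn _)]
  | succ n ih => rw [wordProj, invol_tensor, ih, invol_colorProj]

theorem wordProj_append (δ : ℂ) (w : Fin m → Bool) (u : Fin n → Bool) :
    wordProj δ (m + n) (Fin.append w u) = tensor (wordProj δ m w) (wordProj δ n u) := by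
  induction n with
  | zero =>
    rw [Fin.append_right_nil _ _ rfl]
    exact (tensor_unit _).symm
  | succ n ih =>
    have h1 : (fun i : Fin (m + n) => Fin.append w u i.castSucc) =
        Fin.append w fun i : Fin n => u i.castSucc := by
      funext i
      induction i using Fin.addCases with
      | left i => rw [Fin.append_left]; exact Fin.append_left w u i
      | right i => rw [Fin.append_right]; exact Fin.append_right w u i.castSucc
    have h2 : Fin.append w u (Fin.last (m + n)) = u (Fin.last n) :=
      Fin.append_right w u (Fin.last n)
    calc wordProj δ (m + (n + 1)) (Fin.append w u)
        = tensor (wordProj δ (m + n) fun i => Fin.append w u i.castSucc)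
            (colorProj δ (Fin.append w u (Fin.last (m + n)))) := rfl
      _ = tensor (tensor (wordProj δ m w) (wordProj δ n fun i => u i.castSucc))
            (colorProj δ (u (Fin.last n))) := by rw [h1, h2, ih]
      _ = tensor (wordProj δ m w) (wordProj δ (n + 1) u) := tensor_assoc_one _ _ _

theorem wordProj_true (δ : ℂ) (n : ℕ) :
    wordProj δ n (fun _ => true) = tensorPow (projOne δ) n := by
  induction n with
  | zero => rfl
  | succ n ih => rw [wordProj, ih, tensorPow, colorProj]

theorem wordProj_one (δ : ℂ) (w : Fin 1 → Bool) : wordProj δ 1 w = colorProj δ (w 0) :=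
  tensor_unit_left _

theorem wordProj_comp_insertPartn {δ : ℂ} (hδ : δ ≠ 0) {w : Fin (n + 1) → Bool} {i : Fin (n + 1)}
    (h : w i = true) : comp δ (wordProj δ (n + 1) w) (toPart (insertPartn n i)) = 0 := by
  have hlast : ∀ (n : ℕ) (w : Fin (n + 1) → Bool), w (Fin.last n) = true →
      comp δ (wordProj δ (n + 1) w) (toPart (insertPartn n (Fin.last n))) = 0 := by
    intro n w h
    rw [insertPartn_last, ← tensor_toPart, ← singleton_eq, wordProj, h]
    refine (tensor_comp_tensor δ (wordProj δ n fun i => w i.castSucc) (colorProj δ true)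
      (toPart (idPartn n)) singleton).trans ?_
    rw [colorProj, projOne_comp_singleton hδ]
    exact tensor_zero_right _
  induction n with
  | zero =>
    obtain rfl : i = Fin.last 0 := Fin.ext (by omega)
    exact hlast 0 w h
  | succ n ih =>
    induction i using Fin.lastCases with
    | last => exact hlast _ w h
    | cast i =>
      rw [insertPartn_castSucc, ← tensor_toPart, wordProj]
      refine (tensor_comp_tensor δ _ _ _ _).trans ?_
      rw [ih h, tensor_zero_left]

/-- A projection `π_(δ)` at an isolated lower point kills the partition. -/
theorem wordProj_comp_of_isolatedLower {δ : ℂ} (hδ : δ ≠ 0) {w : Fin (n + 1) → Bool}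
    {i : Fin (n + 1)} (h : w i = true) {p : Partn k (n + 1)} (hp : IsolatedLower p i) :
    comp δ (wordProj δ (n + 1) w) (toPart p) = 0 := by
  have e := comp_toPart δ (insertPartn n i) (Setoid.comap (Sum.map id i.succAbove) p)
  rw [insertPartn_comp hp] at e
  have e' := congrArg (comp δ (wordProj δ (n + 1) w)) e
  rw [comp_assoc, wordProj_comp_insertPartn hδ h, comp_zero_left, comp_smul_right] at e'
  exact (smul_eq_zero.1 e'.symm).resolve_left (pow_ne_zero _ hδ)

/-! ### Parities -/

/-- The parity of the number of letters `false`. -/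
def parity (w : Fin n → Bool) : ZMod 2 := ∑ j, if w j = false then 1 else 0

/-- A letter `true` carries as its label the parity of the number of letters `false` to its left;
the letters `false` carry no label. -/
def label (w : Fin n → Bool) (i : Fin n) : Option (ZMod 2) :=
  if w i = true then some (∑ j, if j < i ∧ w j = false then 1 else 0) else none

theorem parity_append (w : Fin m → Bool) (u : Fin n → Bool) :
    parity (Fin.append w u) = parity w + parity u := by
  simp [parity, Fin.sum_univ_add, -Finset.sum_boole]

theorem label_append_left (w : Fin m → Bool) (u : Fin n → Bool) (i : Fin m) :
    label (Fin.append w u) (Fin.castAdd n i) = label w i := by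
  have h : ∀ j : Fin n, ¬ Fin.natAdd m j < Fin.castAdd n i := fun j h => by
    rw [Fin.lt_def, Fin.val_natAdd, Fin.val_castAdd] at h
    omega
  have h' : ∀ j : Fin m, Fin.castAdd n j < Fin.castAdd n i ↔ j < i := fun _ => Iff.rfl
  simp [label, Fin.sum_univ_add, h, h', -Finset.sum_boole]

theorem label_append_right (w : Fin m → Bool) (u : Fin n → Bool) (i : Fin n) :
    label (Fin.append w u) (Fin.natAdd m i) = (label u i).map (parity w + ·) := by
  have h : ∀ j : Fin m, Fin.castAdd n j < Fin.natAdd m i := fun j => by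
    rw [Fin.lt_def, Fin.val_natAdd, Fin.val_castAdd]
    omega
  have h' : ∀ j : Fin n, Fin.natAdd m j < Fin.natAdd m i ↔ j < i := fun j => by
    rw [Fin.lt_def, Fin.lt_def, Fin.val_natAdd, Fin.val_natAdd, Nat.add_lt_add_iff_left]
  by_cases hu : u i = true <;>
    simp [label, Fin.sum_univ_add, h, h', hu, parity, -Finset.sum_boole]

/-- The parities of the colour words `w` (upper row) and `u` (lower row) agree, and `p` only joins
points that carry the same label. Equal parities make the condition stable under tensor products,
where the labels of the second factor are shifted. -/
def RespectsLabels (w : Fin k → Bool) (u : Fin l → Bool) (p : Partn k l) : Prop :=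
  parity w = parity u ∧ Compat p (label w) (label u)

theorem Compat.map {β γ : Type*} {p : Partn k l} {x : Fin k → β} {y : Fin l → β}
    (h : Compat p x y) (g : β → γ) : Compat p (fun i => g (x i)) (fun i => g (y i)) := by
  intro a b hab
  have := congrArg g (h hab)
  rcases a with a | a <;> rcases b with b | b <;> exact this

theorem RespectsLabels.tensorPartn {w : Fin k → Bool} {u : Fin l → Bool} {p : Partn k l}
    {w' : Fin k' → Bool} {u' : Fin l' → Bool} {p' : Partn k' l'} (h : RespectsLabels w u p)
    (h' : RespectsLabels w' u' p') :
    RespectsLabels (Fin.append w w') (Fin.append u u') (tensorPartn p p') := by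
  refine ⟨by rw [parity_append, parity_append, h.1, h'.1], compat_tensorPartn_iff.2 ⟨?_, ?_⟩⟩
  · simp only [label_append_left]
    exact h.2
  · simp only [label_append_right, h.1]
    exact h'.2.map _

theorem RespectsLabels.compPartn {w : Fin k → Bool} {u : Fin l → Bool} {t : Fin m → Bool}
    {p : Partn k l} {q : Partn l m} (hq : RespectsLabels u t q) (hp : RespectsLabels w u p) :
    RespectsLabels w t (compPartn q p) :=
  ⟨hp.1.trans hq.1, hp.2.comp hq.2⟩

theorem RespectsLabels.starPartn {w : Fin k → Bool} {u : Fin l → Bool} {p : Partn k l}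
    (h : RespectsLabels w u p) : RespectsLabels u w (starPartn p) :=
  ⟨h.1.symm, compat_starPartn_iff.2 h.2⟩

/-- The span of the partitions that respect the labels. -/
def labelSpan (w : Fin k → Bool) (u : Fin l → Bool) : Submodule ℂ (Part k l) :=
  Submodule.span ℂ (toPart '' {p | RespectsLabels w u p})

theorem comp_mem_labelSpan (δ : ℂ) {w : Fin k → Bool} {u : Fin l → Bool} {t : Fin m → Bool}
    {y : Part l m} {x : Part k l} (hy : y ∈ labelSpan u t) (hx : x ∈ labelSpan w u) :
    comp δ y x ∈ labelSpan w t :=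
  map₂_mem (compₗ δ) (by
    intro q hq p hp
    rw [compₗ_apply, comp_toPart]
    exact Submodule.smul_mem _ _ (Submodule.subset_span ⟨_, hq.compPartn hp, rfl⟩)) hy hx

theorem tensor_mem_labelSpan {w : Fin k → Bool} {u : Fin l → Bool} {x : Part k l}
    {w' : Fin k' → Bool} {u' : Fin l' → Bool} {y : Part k' l'} (hx : x ∈ labelSpan w u)
    (hy : y ∈ labelSpan w' u') :
    tensor x y ∈ labelSpan (Fin.append w w') (Fin.append u u') :=
  map₂_mem tensorₗ (by
    intro q hq p hp
    rw [tensorₗ_apply, tensor_toPart]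
    exact Submodule.subset_span ⟨_, hq.tensorPartn hp, rfl⟩) hx hy

theorem disconnecter_mem_labelSpan (w : Fin 1 → Bool) : disconnecter ∈ labelSpan w w :=
  Submodule.subset_span ⟨⊥, ⟨rfl, compat_bot⟩, rfl⟩

theorem colorProj_mem_labelSpan (δ : ℂ) (w : Fin 1 → Bool) (a : Bool) :
    colorProj δ a ∈ labelSpan w w := by
  cases a
  · exact Submodule.smul_mem _ _ (disconnecter_mem_labelSpan w)
  · exact sub_mem (Submodule.subset_span ⟨⊤, ⟨rfl, compat_top_iff.2 rfl⟩, rfl⟩)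
      (Submodule.smul_mem _ _ (disconnecter_mem_labelSpan w))

theorem wordProj_mem_labelSpan (δ : ℂ) (w : Fin n → Bool) : wordProj δ n w ∈ labelSpan w w := by
  induction n with
  | zero => exact Submodule.subset_span ⟨⊤, ⟨rfl, fun a => (IsEmpty.false a).elim⟩, rfl⟩
  | succ n ih =>
    have e : Fin.append (fun i : Fin n => w i.castSucc) (fun _ : Fin 1 => w (Fin.last n)) = w := by
      funext i
      induction i using Fin.lastCases with
      | last => exact Fin.append_right _ _ (0 : Fin 1)
      | cast i => exact Fin.append_left _ _ i
    have h := tensor_mem_labelSpan (ih fun i => w i.castSucc)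
      (colorProj_mem_labelSpan δ (fun _ => w (Fin.last n)) (w (Fin.last n)))
    rw [e] at h
    exact h

/-- The linear category spanned by the partitions that respect labels, compressed by the projections
of the colour words of both rows. -/
def alternating (δ : ℂ) : Family := fun k l =>
  Submodule.span ℂ {x | ∃ (w : Fin k → Bool) (u : Fin l → Bool) (p : Partn k l),
    RespectsLabels w u p ∧ x = comp δ (wordProj δ l u) (comp δ (toPart p) (wordProj δ k w))}

theorem compress_mem_alternating {δ : ℂ} {w : Fin k → Bool} {u : Fin l → Bool} {x : Part k l}
    (hx : x ∈ labelSpan w u) :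
    comp δ (wordProj δ l u) (comp δ x (wordProj δ k w)) ∈ alternating δ k l := by
  induction hx using Submodule.span_induction with
  | mem x hx =>
    obtain ⟨p, hp, rfl⟩ := hx
    exact Submodule.subset_span ⟨w, u, p, hp, rfl⟩
  | zero => rw [comp_zero_left, comp_zero_right]; exact zero_mem _
  | add x y _ _ hx hy => rw [comp_add_left, comp_add_right]; exact add_mem hx hy
  | smul c x _ hx => rw [comp_smul_left, comp_smul_right]; exact Submodule.smul_mem _ _ hx

theorem tensor_singleton_singleton_mem_alternating {δ : ℂ} (hδ : δ ≠ 0) :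
    tensor singleton singleton ∈ alternating δ 0 2 := by
  refine Submodule.subset_span ⟨Fin.elim0, fun _ => false, ⊥, ⟨by decide, compat_bot⟩, ?_⟩
  have e : comp δ (tensor (colorProj δ false) (colorProj δ false)) (tensor singleton singleton) =
      tensor singleton singleton := by
    rw [tensor_comp_tensor, colorProj_false_comp_singleton hδ]
  have e' : wordProj δ 2 (fun _ => false) = tensor (colorProj δ false) (colorProj δ false) :=
    congrArg (fun t => tensor t (colorProj δ false)) (tensor_unit_left _)
  rw [← tensor_singleton_singleton, e']
  exact (e.symm.trans (congrArg _ (comp_unit δ (tensor singleton singleton)).symm))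

theorem proj_block3_mem_alternating (δ : ℂ) : proj δ block3 ∈ alternating δ 0 3 := by
  refine Submodule.subset_span ⟨Fin.elim0, fun _ => true, _, ⟨?_, compat_block3_iff.2 ?_⟩, ?_⟩
  · decide
  · decide
  · rw [proj, block3, word, wordProj_true, wordProj, tensorPow]

theorem isLinearCategory_alternating {δ : ℝ} (hδ : δ ≠ 0) :
    IsLinearCategory δ (alternating δ) where
  id_mem := by
    have hδ' : (δ : ℂ) ≠ 0 := Complex.ofReal_ne_zero.2 hδ
    have h : ∀ a, colorProj δ a ∈ alternating δ 1 1 := by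
      intro a
      have := compress_mem_alternating (δ := δ) (wordProj_mem_labelSpan δ fun _ : Fin 1 => a)
      rwa [wordProj_comp_self hδ', wordProj_comp_self hδ', wordProj_one] at this
    have e : idPart = colorProj δ true + colorProj δ false := by
      rw [colorProj, colorProj, projOne, sub_add_cancel]
    rw [e]
    exact add_mem (h _) (h _)
  pair_mem := by
    have hδ' : (δ : ℂ) ≠ 0 := Complex.ofReal_ne_zero.2 hδ
    have h1 : comp δ (tensor (projOne δ) (projOne δ)) pair ∈ alternating δ 0 2 := by
      refine Submodule.subset_span ⟨Fin.elim0, fun _ => true, ⊤,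
        ⟨by decide, compat_pair_iff.2 rfl⟩, ?_⟩
      rw [wordProj_true, tensorPow_two, wordProj, comp_unit, pair_eq]
    rw [tensor_projOne_projOne_comp_pair hδ'] at h1
    simpa using add_mem h1 (Submodule.smul_mem _ (1 / (δ : ℂ))
      (tensor_singleton_singleton_mem_alternating hδ'))
  tensor_mem hx hy := by
    refine LinearMap.BilinMap.apply_apply_mem_of_mem_span _ _ _ tensorₗ ?_ _ _ hx hy
    rintro _ ⟨w, u, p, hp, rfl⟩ _ ⟨w', u', p', hp', rfl⟩
    refine Submodule.subset_span ⟨_, _, _, hp.tensorPartn hp', ?_⟩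
    rw [tensorₗ_apply, wordProj_append, wordProj_append, ← tensor_toPart, tensor_comp_tensor,
      tensor_comp_tensor]
  comp_mem hy hx := by
    have hδ' : (δ : ℂ) ≠ 0 := Complex.ofReal_ne_zero.2 hδ
    refine LinearMap.BilinMap.apply_apply_mem_of_mem_span _ _ _ (compₗ δ) ?_ _ _ hy hx
    rintro _ ⟨u', t, q, hq, rfl⟩ _ ⟨w, u, p, hp, rfl⟩
    rw [compₗ_apply, ← comp_assoc, ← comp_assoc, comp_assoc _ (wordProj _ _ u')]
    by_cases h : u' = u
    · subst h
      rw [wordProj_comp_self hδ', comp_assoc _ (wordProj _ _ u'), comp_assoc _ (toPart q)]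
      exact compress_mem_alternating (comp_mem_labelSpan _ (Submodule.subset_span ⟨q, hq, rfl⟩)
        (comp_mem_labelSpan _ (wordProj_mem_labelSpan _ _) (Submodule.subset_span ⟨p, hp, rfl⟩)))
    · rw [wordProj_comp_of_ne hδ' h, comp_zero_left, comp_zero_right, comp_zero_right]
      exact zero_mem _
  invol_mem {k l x} hx := by
    induction hx using Submodule.span_induction with
    | mem x hx =>
      obtain ⟨w, u, p, hp, rfl⟩ := hx
      refine Submodule.subset_span ⟨_, _, _, hp.starPartn, ?_⟩
      rw [invol_comp, invol_comp, invol_wordProj, invol_wordProj, invol_toPart, comp_assoc]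
    | zero => rw [invol_zero]; exact zero_mem _
    | add x y _ _ hx hy => rw [invol_add]; exact add_mem hx hy
    | smul c x _ hx => rw [invol_smul]; exact Submodule.smul_mem _ _ hx

theorem wordProj_comp_eq_zero_of_mem_alternating {δ : ℂ} (hδ : δ ≠ 0) {x : Part 0 4}
    (hx : x ∈ alternating δ 0 4) :
    comp δ (wordProj δ 4 ![true, false, true, false]) x = 0 := by
  induction hx using Submodule.span_induction with
  | mem x hx =>
    obtain ⟨w, u, p, hp, rfl⟩ := hx
    rw [comp_assoc]
    by_cases h : ![true, false, true, false] = u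
    · subst h
      -- The labels of this word are `some 0, none, some 1, none`.
      have hi : IsolatedLower p 0 := by
        rintro (b | b) hb
        · exact b.elim0
        · have h' : label ![true, false, true, false] 0 = label ![true, false, true, false] b :=
            hp.2 hb
          congr 1
          clear hb
          revert h'
          revert b
          decide
      rw [wordProj_comp_self hδ, comp_assoc, wordProj_comp_of_isolatedLower hδ rfl hi,
        comp_zero_left]
    · rw [wordProj_comp_of_ne hδ h, comp_zero_left]
  | zero => exact comp_zero_right _ _
  | add x y _ _ hx hy => rw [comp_add_right, hx, hy, add_zero]
  | smul c x _ hx => rw [comp_smul_right, hx, smul_zero]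

theorem wordProj_comp_abac {δ : ℂ} (hδ : δ ≠ 0) :
    comp δ (wordProj δ 4 ![true, false, true, false]) abac =
      abac - (1 / δ) • comp δ (toPart idFlankedPartn) (tensor singleton singleton) := by
  have hE : wordProj δ 4 ![true, false, true, false] =
      tensor (colorProj δ true) (tensor (tensor (colorProj δ false) (colorProj δ true))
        (colorProj δ false)) := by
    have h : wordProj δ 4 ![true, false, true, false] =
      tensor (tensor (tensor (tensor (toPart ⊤) (colorProj δ true)) (colorProj δ false))
        (colorProj δ true)) (colorProj δ false) := rfl
    rw [h, tensor_unit_left]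
    exact (congrArg (fun t => tensor t (colorProj δ false)) (tensor_assoc_one _ _ _)).trans
      (tensor_assoc_one (colorProj δ true) (tensor (colorProj δ false) (colorProj δ true)) _)
  have h1 : comp δ (tensor (tensor (colorProj δ false) (colorProj δ true)) (colorProj δ false))
      flankedString = comp δ flankedString (colorProj δ true) := by
    rw [flankedString_comp]
    refine (tensor_comp_flankedString _ _ _ _).trans ?_
    rw [colorProj_false_comp_singleton hδ]
  have h2 : comp δ (wordProj δ 4 ![true, false, true, false]) (toPart idFlankedPartn) =
      comp δ (toPart idFlankedPartn) (tensor (projOne δ) (projOne δ)) := by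
    rw [hE, ← tensor_idPart_flankedString]
    refine (tensor_comp_tensor δ (colorProj δ true) (tensor (tensor (colorProj δ false)
      (colorProj δ true)) (colorProj δ false)) idPart flankedString).trans ?_
    rw [h1]
    refine Eq.trans ?_ (tensor_comp_tensor δ idPart flankedString (colorProj δ true)
      (colorProj δ true)).symm
    rw [idPart_comp, comp_idPart]
  have h3 : abac = comp δ (toPart idFlankedPartn) pair := by
    rw [← abac_eq δ, ← tensor_idPart_flankedString]
  nth_rewrite 1 [h3]
  rw [comp_assoc, h2, ← comp_assoc, tensor_projOne_projOne_comp_pair hδ, comp_sub_right,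
    comp_smul_right, ← h3]

theorem abac_notMem_alternating {δ : ℂ} (hδ : δ ≠ 0) : abac ∉ alternating δ 0 4 := by
  intro h
  have h0 := wordProj_comp_eq_zero_of_mem_alternating hδ h
  rw [wordProj_comp_abac hδ, sub_eq_zero, tensor_singleton_singleton, comp_toPart, smul_smul, abac,
    word] at h0
  have h1 := DFunLike.congr_fun h0 (Setoid.ker (Sum.elim Fin.elim0 ![0, 1, 0, 2]))
  rw [toPart, Finsupp.single_eq_same, toPart, Finsupp.smul_apply] at h1
  have h2 : compPartn idFlankedPartn (⊥ : Partn 0 2) =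
      Setoid.ker (Sum.elim Fin.elim0 ![0, 1, 0, 2]) := by
    by_contra hne
    rw [Finsupp.single_eq_of_ne' hne, smul_zero] at h1
    exact one_ne_zero h1
  have h3 : Compat (compPartn idFlankedPartn (⊥ : Partn 0 2)) Fin.elim0
      ![true, false, false, false] :=
    compat_compPartn_iff.2 ⟨![true, false], compat_bot, compat_idFlankedPartn_iff.2 ⟨rfl, rfl⟩⟩
  rw [h2, compat_word_iff] at h3
  exact absurd (h3 0 2 rfl) (by decide)

end Colour

/-! ### Noncrossing partitions form a linear category -/

section NonCrossing

/-- Noncrossing with respect to the positions `pos`, as far as points of `Y` are concerned. Points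
outside `Y` may still connect points of `Y`. -/
def NonCrossingOn {X : Type*} (pos : X → ℕ) (s : Setoid X) (Y : Set X) : Prop :=
  ∀ a ∈ Y, ∀ b ∈ Y, ∀ c ∈ Y, ∀ d ∈ Y, pos a < pos b → pos b < pos c → pos c < pos d →
    s a c → s b d → s a b

/-- Join the blocks of `u` and `v`. -/
def joinBlocks {X : Type*} (s : Setoid X) (u v : X) : Setoid X where
  r x y := s x y ∨ (s x u ∨ s x v) ∧ (s y u ∨ s y v)
  iseqv := by
    refine ⟨fun x => Or.inl (s.refl' x), fun h => ?_, fun {x y z} h h' => ?_⟩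
    · exact h.imp s.symm' And.symm
    · rcases h with h | ⟨h1, h2⟩
      · rcases h' with h' | ⟨h3, h4⟩
        · exact Or.inl (s.trans' h h')
        · exact Or.inr ⟨h3.imp (s.trans' h) (s.trans' h), h4⟩
      · rcases h' with h' | ⟨h3, h4⟩
        · exact Or.inr ⟨h1, h2.imp (s.trans' (s.symm' h')) (s.trans' (s.symm' h'))⟩
        · exact Or.inr ⟨h1, h4⟩

theorem joinBlocks_iff {X : Type*} {s : Setoid X} {u v x y : X} :
    joinBlocks s u v x y ↔ s x y ∨ (s x u ∨ s x v) ∧ (s y u ∨ s y v) := Iff.rfl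

/-- Joining the blocks of two neighbouring points creates no crossing. -/
theorem NonCrossingOn.joinBlocks {X : Type*} {pos : X → ℕ} (hpos : Function.Injective pos)
    {s : Setoid X} {Y : Set X} (h : NonCrossingOn pos s Y) {u v : X} (hu : u ∈ Y) (hv : v ∈ Y)
    (huv : pos u < pos v) (hadj : ∀ y ∈ Y, ¬ (pos u < pos y ∧ pos y < pos v)) :
    NonCrossingOn pos (joinBlocks s u v) Y := by
  intro a ha b hb c hc d hd hab hbc hcd hac hbd
  rw [joinBlocks_iff] at hac hbd ⊢
  by_contra hne
  -- Points in the same block are on the same side of any chord that joins points of another block.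
  have inside : ∀ a ∈ Y, ∀ b ∈ Y, ∀ c ∈ Y, ∀ w ∈ Y, pos a < pos b → pos b < pos c → s a c →
      s b w → s a b ∨ (pos a < pos w ∧ pos w < pos c) := by
    intro a ha b hb c hc w hw hab hbc hac hbw
    rcases lt_trichotomy (pos w) (pos a) with h1 | h1 | h1
    · exact Or.inl (s.trans' (s.symm' (h w hw a ha b hb c hc h1 hab hbc (s.symm' hbw) hac))
        (s.symm' hbw))
    · rw [← hpos h1]; exact Or.inl (s.symm' hbw)
    rcases lt_trichotomy (pos w) (pos c) with h2 | h2 | h2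
    · exact Or.inr ⟨h1, h2⟩
    · rw [hpos h2] at hbw; exact Or.inl (s.trans' hac (s.symm' hbw))
    · exact Or.inl (h a ha b hb c hc w hw hab hbc h2 hac hbw)
  have outside : ∀ a ∈ Y, ∀ c ∈ Y, ∀ d ∈ Y, ∀ w ∈ Y, pos d < pos a ∨ pos c < pos d → s a c →
      s d w → s a d ∨ pos w < pos a ∨ pos c < pos w := by
    intro a ha c hc d hd w hw hda hac hdw
    by_contra! hcon
    rcases hcon.2.1.eq_or_lt with h1 | h1
    · rw [← hpos h1] at hdw; exact hcon.1 (s.symm' hdw)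
    rcases hcon.2.2.eq_or_lt with h2 | h2
    · rw [hpos h2] at hdw; exact hcon.1 (s.trans' hac (s.symm' hdw))
    rcases inside a ha w hw c hc d hd h1 h2 hac (s.symm' hdw) with h3 | h3
    · exact hcon.1 (s.trans' h3 (s.symm' hdw))
    · omega
  have ha' := hadj a ha
  have hb' := hadj b hb
  have hc' := hadj c hc
  have hd' := hadj d hd
  rcases hac with hac | ⟨ha1, hc1⟩ <;> rcases hbd with hbd | ⟨hb1, hd1⟩
  · exact hne (Or.inl (h a ha b hb c hc d hd hab hbc hcd hac hbd))
  · have i1 := inside a ha b hb c hc u hu hab hbc hac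
    have i2 := inside a ha b hb c hc v hv hab hbc hac
    have o1 := outside a ha c hc d hd u hu (Or.inr hcd) hac
    have o2 := outside a ha c hc d hd v hv (Or.inr hcd) hac
    have t1 := s.trans' (x := a) (y := d) (z := u)
    have t2 := s.trans' (x := a) (y := d) (z := v)
    grind
  · have i1 := inside b hb c hc d hd u hu hbc hcd hbd
    have i2 := inside b hb c hc d hd v hv hbc hcd hbd
    have o1 := outside b hb d hd a ha u hu (Or.inl hab) hbd
    have o2 := outside b hb d hd a ha v hv (Or.inl hab) hbd
    have t1 := s.trans' (x := b) (y := c) (z := u)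
    have t2 := s.trans' (x := b) (y := c) (z := v)
    have t3 := s.symm' (x := b) (y := a)
    grind
  · exact hne (Or.inr ⟨ha1, hb1⟩)

variable {k l m k' l' : ℕ}

theorem circlePos_inl (i : Fin k) : circlePos (Sum.inl i : Fin k ⊕ Fin l) = i := rfl

theorem circlePos_inr (j : Fin l) :
    circlePos (Sum.inr j : Fin k ⊕ Fin l) = k + (l - (j + 1)) := by
  rw [circlePos, Sum.elim_inr, Fin.val_rev]

theorem circlePos_lt (a : Fin k ⊕ Fin l) : circlePos a < k + l := by
  rcases a with i | j
  · rw [circlePos_inl]; omega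
  · rw [circlePos_inr]; omega

theorem circlePos_injective : Function.Injective (circlePos : Fin k ⊕ Fin l → ℕ) := by
  rintro (i | i) (j | j) h
  · exact congrArg Sum.inl (Fin.ext h)
  · rw [circlePos_inl, circlePos_inr] at h; omega
  · rw [circlePos_inl, circlePos_inr] at h; omega
  · rw [circlePos_inr, circlePos_inr] at h; exact congrArg Sum.inr (Fin.ext (by omega))

theorem exists_circlePos_eq {n : ℕ} (h : n < k + l) : ∃ a : Fin k ⊕ Fin l, circlePos a = n := by
  by_cases hn : n < k
  · exact ⟨Sum.inl ⟨n, hn⟩, rfl⟩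
  · refine ⟨Sum.inr ⟨k + l - 1 - n, by omega⟩, ?_⟩
    rw [circlePos_inr]
    dsimp only
    omega

theorem IsNonCrossing.comap {p : Partn k l} (hp : IsNonCrossing p)
    {f : Fin k' ⊕ Fin l' → Fin k ⊕ Fin l}
    (hf : ∀ a b, circlePos a < circlePos b → circlePos (f a) < circlePos (f b)) :
    IsNonCrossing (Setoid.comap f p : Partn k' l') :=
  fun a b c d hab hbc hcd => hp (f a) (f b) (f c) (f d) (hf _ _ hab) (hf _ _ hbc) (hf _ _ hcd)

theorem circlePos_swap (a : Fin k ⊕ Fin l) : circlePos a.swap + circlePos a + 1 = k + l := by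
  rcases a with i | j
  · rw [Sum.swap_inl, circlePos_inr, circlePos_inl]; omega
  · rw [Sum.swap_inr, circlePos_inr, circlePos_inl]; omega

theorem IsNonCrossing.starPartn {p : Partn k l} (hp : IsNonCrossing p) :
    IsNonCrossing (starPartn p) := by
  intro a b c d hab hbc hcd hac hbd
  have h1 := circlePos_swap a
  have h2 := circlePos_swap b
  have h3 := circlePos_swap c
  have h4 := circlePos_swap d
  have h := hp d.swap c.swap b.swap a.swap (by omega) (by omega) (by omega) (p.symm' hbd)
    (p.symm' hac)
  exact p.trans' hac (p.trans' (p.symm' h) (p.symm' hbd))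

theorem IsNonCrossing.tensorPartn {p : Partn k l} {q : Partn k' l'} (hp : IsNonCrossing p)
    (hq : IsNonCrossing q) : IsNonCrossing (tensorPartn p q) := by
  let eL : Fin k ⊕ Fin l → Fin (k + k') ⊕ Fin (l + l') := Sum.map (Fin.castAdd k') (Fin.castAdd l')
  let eR : Fin k' ⊕ Fin l' → Fin (k + k') ⊕ Fin (l + l') := Sum.map (Fin.natAdd k) (Fin.natAdd l)
  have hL : ∀ a, tensorBlock p q (eL a) = Sum.inl (Quotient.mk p a) := tensorBlock_map_castAdd p q
  have hR : ∀ a, tensorBlock p q (eR a) = Sum.inr (Quotient.mk q a) := tensorBlock_map_natAdd p q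
  have hcov : ∀ a, (∃ b, a = eL b) ∨ ∃ b, a = eR b := exists_eq_map_castAdd_or_natAdd
  have pL : ∀ a, (circlePos a < k ∧ circlePos (eL a) = circlePos a) ∨
      (k ≤ circlePos a ∧ circlePos (eL a) = circlePos a + (k' + l')) := by
    rintro (i | j)
    · exact Or.inl ⟨i.2, rfl⟩
    · right
      simp only [eL, Sum.map_inr, circlePos_inr, Fin.val_castAdd]
      omega
  have pR : ∀ a, circlePos (eR a) = k + circlePos a := by
    rintro (i | j)
    · simp only [eR, Sum.map_inl, circlePos_inl, Fin.val_natAdd]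
    · simp only [eR, Sum.map_inr, circlePos_inr, Fin.val_natAdd]
      omega
  have ltR := fun a : Fin k' ⊕ Fin l' => circlePos_lt a
  have LL : ∀ a b, PartCat.tensorPartn p q (eL a) (eL b) ↔ p a b := fun a b => by
    rw [PartCat.tensorPartn, Setoid.ker_def, hL, hL, Sum.inl.injEq]
    exact Quotient.eq (r := p)
  have RR : ∀ a b, PartCat.tensorPartn p q (eR a) (eR b) ↔ q a b := fun a b => by
    rw [PartCat.tensorPartn, Setoid.ker_def, hR, hR, Sum.inr.injEq]
    exact Quotient.eq (r := q)
  have LR : ∀ a b, ¬ PartCat.tensorPartn p q (eL a) (eR b) := fun a b => by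
    rw [PartCat.tensorPartn, Setoid.ker_def, hL, hR]
    exact Sum.inl_ne_inr
  have RL : ∀ a b, ¬ PartCat.tensorPartn p q (eR a) (eL b) := fun a b => by
    rw [PartCat.tensorPartn, Setoid.ker_def, hL, hR]
    exact Sum.inr_ne_inl
  intro a b c d hab hbc hcd hac hbd
  rcases hcov a with ⟨a, rfl⟩ | ⟨a, rfl⟩ <;> rcases hcov c with ⟨c, rfl⟩ | ⟨c, rfl⟩
  · rcases hcov b with ⟨b, rfl⟩ | ⟨b, rfl⟩ <;> rcases hcov d with ⟨d, rfl⟩ | ⟨d, rfl⟩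
    · have h1 := pL a
      have h2 := pL b
      have h3 := pL c
      have h4 := pL d
      rw [LL] at hac hbd ⊢
      exact hp a b c d (by omega) (by omega) (by omega) hac hbd
    · exact absurd hbd (LR _ _)
    · exact absurd hbd (RL _ _)
    · have h1 := pL c
      have h2 := pR b
      have h3 := pR d
      have h4 := ltR b
      have h5 := ltR d
      omega
  · exact absurd hac (LR _ _)
  · exact absurd hac (RL _ _)
  · rcases hcov b with ⟨b, rfl⟩ | ⟨b, rfl⟩ <;> rcases hcov d with ⟨d, rfl⟩ | ⟨d, rfl⟩
    · have h1 := pL b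
      have h2 := pR a
      have h3 := pR c
      have h4 := ltR a
      have h5 := ltR c
      omega
    · exact absurd hbd (LR _ _)
    · exact absurd hbd (RL _ _)
    · have h1 := pR a
      have h2 := pR b
      have h3 := pR c
      have h4 := pR d
      rw [RR] at hac hbd ⊢
      exact hq a b c d (by omega) (by omega) (by omega) hac hbd

/-- Positions in the picture in which `q` is drawn after `p` on one line. -/
def linePos (k l m : ℕ) : (Fin k ⊕ Fin l) ⊕ (Fin l ⊕ Fin m) → ℕ :=
  Sum.elim circlePos fun a => k + l + circlePos a

/-- Identify the lower row of `p` with the upper row of `q`. -/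
def glue : (Fin k ⊕ Fin l) ⊕ (Fin l ⊕ Fin m) → Fin k ⊕ (Fin l ⊕ Fin m) :=
  Sum.elim (Sum.map id Sum.inl) Sum.inr

theorem linePos_injective : Function.Injective (linePos k l m) := by
  rintro (a | a) (b | b) h
  · exact congrArg Sum.inl (circlePos_injective h)
  · have := circlePos_lt a
    simp only [linePos, Sum.elim_inl, Sum.elim_inr] at h
    omega
  · have := circlePos_lt b
    simp only [linePos, Sum.elim_inl, Sum.elim_inr] at h
    omega
  · simp only [linePos, Sum.elim_inr, Nat.add_left_cancel_iff] at h
    exact congrArg Sum.inr (circlePos_injective h)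

/-- In the picture on one line, the lower point `i` of `p` and the upper point `i` of `q` become
neighbours once the pairs with smaller index are discarded. Gluing the first `n` points of the
middle row one after the other creates no crossings among the points that are not yet glued. -/
theorem exists_partial_glue {q : Partn l m} {p : Partn k l} (hq : IsNonCrossing q)
    (hp : IsNonCrossing p) (n : ℕ) (hn : n ≤ l) :
    ∃ s : Setoid ((Fin k ⊕ Fin l) ⊕ (Fin l ⊕ Fin m)),
      (∀ a b, p a b → s (Sum.inl a) (Sum.inl b)) ∧ (∀ a b, q a b → s (Sum.inr a) (Sum.inr b)) ∧
      (∀ i : Fin l, (i : ℕ) < n → s (Sum.inl (Sum.inr i)) (Sum.inr (Sum.inl i))) ∧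
      s ≤ Setoid.comap glue (stack q p) ∧
      NonCrossingOn (linePos k l m) s
        {x | ∀ i : Fin l, (i : ℕ) < n → x ≠ Sum.inl (Sum.inr i) ∧ x ≠ Sum.inr (Sum.inl i)} := by
  have hstp : ∀ a b, p a b → stack q p (glue (Sum.inl a)) (glue (Sum.inl b)) := fun a b h =>
    (le_sup_left : _ ≤ stack q p) (Setoid.le_comap_map h)
  have hstq : ∀ a b, q a b → stack q p (glue (Sum.inr a)) (glue (Sum.inr b)) := fun a b h =>
    (le_sup_right : _ ≤ stack q p) (Setoid.le_comap_map h)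
  induction n with
  | zero =>
    refine ⟨Setoid.ker (Sum.map (Quotient.mk p) (Quotient.mk q)), ?_, ?_, ?_, ?_, ?_⟩
    · intro a b h
      exact congrArg Sum.inl (Quotient.sound h)
    · intro a b h
      exact congrArg Sum.inr (Quotient.sound h)
    · intro i hi; omega
    · rintro (a | a) (b | b) h
      · exact hstp a b (Quotient.exact (Sum.inl_injective h))
      · exact absurd h Sum.inl_ne_inr
      · exact absurd h Sum.inr_ne_inl
      · exact hstq a b (Quotient.exact (Sum.inr_injective h))
    · rintro a - b - c - d - hab hbc hcd hac hbd
      rcases a with a | a <;> rcases c with c | c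
      · rcases b with b | b
        · rcases d with d | d
          · exact congrArg Sum.inl (Quotient.sound (hp a b c d hab hbc hcd
              (Quotient.exact (Sum.inl_injective hac)) (Quotient.exact (Sum.inl_injective hbd))))
          · exact absurd hbd Sum.inl_ne_inr
        · have := circlePos_lt c
          simp only [linePos, Sum.elim_inl, Sum.elim_inr] at hbc
          omega
      · exact absurd hac Sum.inl_ne_inr
      · exact absurd hac Sum.inr_ne_inl
      · rcases b with b | b
        · have := circlePos_lt b
          simp only [linePos, Sum.elim_inl, Sum.elim_inr] at hab
          omega
        · rcases d with d | d
          · exact absurd hbd Sum.inr_ne_inl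
          · simp only [linePos, Sum.elim_inr, Nat.add_lt_add_iff_left] at hab hbc hcd
            exact congrArg Sum.inr (Quotient.sound (hq a b c d hab hbc hcd
              (Quotient.exact (Sum.inr_injective hac)) (Quotient.exact (Sum.inr_injective hbd))))
  | succ n ih =>
    obtain ⟨s, h1, h2, h3, h4, h5⟩ := ih (by omega)
    let t : Fin l := ⟨n, hn⟩
    have hmid : ∀ i : Fin l, linePos k l m (Sum.inl (Sum.inr i)) = k + (l - (i + 1)) ∧
        linePos k l m (Sum.inr (Sum.inl i)) = k + l + i := fun i => ⟨circlePos_inr i, rfl⟩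
    have htn : (t : ℕ) = n := rfl
    refine ⟨joinBlocks s (Sum.inl (Sum.inr t)) (Sum.inr (Sum.inl t)), ?_, ?_, ?_, ?_, ?_⟩
    · exact fun a b h => Or.inl (h1 a b h)
    · exact fun a b h => Or.inl (h2 a b h)
    · intro i hi
      rcases Nat.lt_succ_iff_lt_or_eq.1 hi with hi | hi
      · exact Or.inl (h3 i hi)
      · obtain rfl : i = t := Fin.ext hi
        exact Or.inr ⟨Or.inl (s.refl' _), Or.inr (s.refl' _)⟩
    · intro x y hxy
      have hx : ∀ x, s x (Sum.inl (Sum.inr t)) ∨ s x (Sum.inr (Sum.inl t)) →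
          stack q p (glue x) (glue (Sum.inl (Sum.inr t))) := fun x hx =>
        hx.elim (fun h => h4 h) (fun h =>
          show stack q p (glue x) (glue (Sum.inr (Sum.inl t))) from h4 h)
      rcases joinBlocks_iff.1 hxy with h | ⟨ha, hb⟩
      · exact h4 h
      · exact (stack q p).trans' (hx x ha) ((stack q p).symm' (hx y hb))
    · have hne : ∀ i : Fin l, (i : ℕ) < n → t ≠ i := fun i hi e => by
        have := congrArg Fin.val e
        omega
      have h6 := h5.joinBlocks (u := Sum.inl (Sum.inr t)) (v := Sum.inr (Sum.inl t))
        linePos_injective (fun i hi => ⟨fun e => hne i hi (Sum.inr_injective (Sum.inl_injective e)),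
          fun e => Sum.inl_ne_inr e⟩)
        (fun i hi => ⟨fun e => Sum.inr_ne_inl e,
          fun e => hne i hi (Sum.inl_injective (Sum.inr_injective e))⟩)
        (by rw [(hmid t).1, (hmid t).2]; omega)
        (by
          rintro y hy ⟨hy1, hy2⟩
          rw [(hmid t).1] at hy1
          rw [(hmid t).2] at hy2
          rcases y with (i | i) | (i | i)
          · have : linePos k l m (Sum.inl (Sum.inl i)) = i := rfl
            omega
          · rw [(hmid i).1] at hy1
            exact (hy i (by omega)).1 rfl
          · rw [(hmid i).2] at hy2
            exact (hy i (by omega)).2 rfl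
          · have : linePos k l m (Sum.inr (Sum.inr i)) = k + l + (l + (m - (i + 1))) := by
              rw [← circlePos_inr]; rfl
            omega)
      exact fun a ha b hb c hc d hd => h6 a (fun i hi => ha i (by omega)) b
        (fun i hi => hb i (by omega)) c (fun i hi => hc i (by omega)) d
        (fun i hi => hd i (by omega))

theorem IsNonCrossing.compPartn {q : Partn l m} {p : Partn k l} (hq : IsNonCrossing q)
    (hp : IsNonCrossing p) : IsNonCrossing (compPartn q p) := by
  obtain ⟨s, h1, h2, h3, h4, h5⟩ := exists_partial_glue hq hp l le_rfl
  let unglue : Fin k ⊕ (Fin l ⊕ Fin m) → (Fin k ⊕ Fin l) ⊕ (Fin l ⊕ Fin m) :=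
    Sum.elim (fun i => Sum.inl (Sum.inl i)) (Sum.elim (fun i => Sum.inl (Sum.inr i))
      (fun i => Sum.inr (Sum.inr i)))
  have hle : stack q p ≤ Setoid.comap unglue s := by
    refine sup_le (map_le_iff.2 ?_) (map_le_iff.2 ?_)
    · intro a b hab
      have := h1 a b hab
      rcases a with a | a <;> rcases b with b | b <;> exact this
    · have e : ∀ a : Fin l ⊕ Fin m, s (unglue (Sum.inr a)) (Sum.inr a) := by
        rintro (i | i)
        · exact h3 i i.2
        · exact s.refl' _
      intro a b hab
      exact s.trans' (e a) (s.trans' (h2 a b hab) (s.symm' (e b)))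
  have hgl : ∀ a : Fin k ⊕ Fin m, glue (unglue (outer (l := l) a)) = outer a := by
    rintro (i | i) <;> rfl
  have hiff : ∀ a b, PartCat.compPartn q p a b ↔ s (unglue (outer a)) (unglue (outer b)) := by
    intro a b
    refine ⟨fun h => hle h, fun h => ?_⟩
    have := h4 h
    rw [Setoid.comap_rel, hgl, hgl] at this
    exact this
  have hpos : ∀ a : Fin k ⊕ Fin m, (circlePos a < k ∧
      linePos k l m (unglue (outer a)) = circlePos a) ∨
      (k ≤ circlePos a ∧ linePos k l m (unglue (outer a)) = circlePos a + 2 * l) := by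
    rintro (i | i)
    · exact Or.inl ⟨i.2, rfl⟩
    · right
      have : linePos k l m (Sum.inr (Sum.inr i)) = k + l + (l + (m - (i + 1))) := by
        rw [← circlePos_inr]; rfl
      refine ⟨by rw [circlePos_inr]; omega, ?_⟩
      change linePos k l m (Sum.inr (Sum.inr i)) = _
      rw [this, circlePos_inr]
      omega
  have hY : ∀ a : Fin k ⊕ Fin m, unglue (outer a) ∈ {x : (Fin k ⊕ Fin l) ⊕ (Fin l ⊕ Fin m) |
      ∀ i : Fin l, (i : ℕ) < l → x ≠ Sum.inl (Sum.inr i) ∧ x ≠ Sum.inr (Sum.inl i)} := by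
    rintro (i | i) j - <;> constructor <;> rintro ⟨⟩
  intro a b c d hab hbc hcd hac hbd
  have e1 := hpos a
  have e2 := hpos b
  have e3 := hpos c
  have e4 := hpos d
  rw [hiff] at hac hbd ⊢
  exact h5 _ (hY a) _ (hY b) _ (hY c) _ (hY d) (by omega) (by omega) (by omega) hac hbd

theorem toPart_mem_NCPart {p : Partn k l} (hp : IsNonCrossing p) : toPart p ∈ NCPart k l :=
  Submodule.subset_span ⟨p, hp, rfl⟩

theorem isNonCrossing_of_le_three {p : Partn k l} (h : k + l ≤ 3) : IsNonCrossing p := by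
  intro a b c d hab hbc hcd
  have := circlePos_lt d
  omega

theorem isLinearCategory_NCPart (δ : ℝ) : IsLinearCategory δ NCPart where
  id_mem := toPart_mem_NCPart (isNonCrossing_of_le_three (by norm_num))
  pair_mem := toPart_mem_NCPart (isNonCrossing_of_le_three (by norm_num))
  tensor_mem hx hy := map₂_mem tensorₗ (fun p hp q hq => by
    rw [tensorₗ_apply, tensor_toPart]
    exact toPart_mem_NCPart (IsNonCrossing.tensorPartn hp hq)) hx hy
  comp_mem hy hx := map₂_mem (compₗ δ) (fun q hq p hp => by
    rw [compₗ_apply, comp_toPart]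
    exact Submodule.smul_mem _ _ (toPart_mem_NCPart (IsNonCrossing.compPartn hq hp))) hy hx
  invol_mem {k l x} hx := by
    induction hx using Submodule.span_induction with
    | mem x hx =>
      obtain ⟨p, hp, rfl⟩ := hx
      rw [invol_toPart]
      exact toPart_mem_NCPart (IsNonCrossing.starPartn hp)
    | zero => rw [invol_zero]; exact zero_mem _
    | add x y _ _ hx hy => rw [invol_add]; exact add_mem hx hy
    | smul c x _ hx => rw [invol_smul]; exact Submodule.smul_mem _ _ hx

end NonCrossing

/-! ### Generation of the noncrossing partitions -/

section Generation

variable {k l n : ℕ} {δ : ℂ} {K : Family}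

/-- The partition that doubles the lower point `i`. -/
def doublePartn (n : ℕ) (i : Fin (n + 1)) : Partn (n + 1) (n + 2) :=
  Setoid.ker (Sum.elim id i.predAbove)

theorem compat_doublePartn_iff {β : Type*} {i : Fin (n + 1)} {x : Fin (n + 1) → β}
    {y : Fin (n + 2) → β} : Compat (doublePartn n i) x y ↔ ∀ j, y j = x (i.predAbove j) := by
  rw [doublePartn, compat_ker_iff]
  constructor
  · rintro ⟨-, h, -⟩ j
    exact (h _ j rfl).symm
  · intro h
    refine ⟨fun a b hab => congrArg x hab, fun a b hab => ?_, fun a b hab => ?_⟩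
    · rw [h, ← hab]; rfl
    · rw [h, h, hab]

theorem block3_eq : block3 = toPart (Setoid.ker (Sum.elim Fin.elim0 ![0, 0, 0])) := rfl

theorem compat_bend_block3_iff {x : Fin 1 → Bool} {z : Fin 2 → Bool} :
    Compat (bend (Setoid.ker (Sum.elim Fin.elim0 ![0, 0, 0]) : Partn 0 3)) x z ↔
      z 0 = x 0 ∧ z 1 = x 0 := by
  rw [compat_bend_iff, compat_block3_iff]
  change z 0 = z 1 ∧ z 1 = x 0 ↔ _
  constructor
  · rintro ⟨h1, h2⟩; exact ⟨h1.trans h2, h2⟩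
  · rintro ⟨h1, h2⟩; exact ⟨h1.trans h2.symm, h2⟩

theorem doublePartn_last (n : ℕ) : doublePartn n (Fin.last n) =
    tensorPartn (idPartn n) (bend (Setoid.ker (Sum.elim Fin.elim0 ![0, 0, 0]) : Partn 0 3)) := by
  refine ext_compat fun x y => ?_
  refine Iff.trans ?_ (compat_tensorPartn_iff (k := n) (l := n) (k' := 1) (l' := 2)).symm
  rw [compat_doublePartn_iff, compat_bend_block3_iff, compat_idPartn_iff, Fin.forall_fin_succ',
    Fin.forall_fin_succ', funext_iff, and_assoc]
  have e1 : ∀ j : Fin (n + 1), (Fin.last n).predAbove j.castSucc = j := fun j => by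
    rw [Fin.predAbove_castSucc_of_le _ _ (Fin.le_last j)]
  have e2 : (Fin.last n).predAbove (Fin.last (n + 1)) = Fin.last n := by
    rw [← Fin.succ_last, Fin.predAbove_succ_self]
  simp only [e1, e2]
  exact and_congr (forall_congr' fun j => eq_comm) Iff.rfl

theorem doublePartn_castSucc (n : ℕ) (i : Fin (n + 1)) :
    doublePartn (n + 1) i.castSucc = tensorPartn (doublePartn n i) (⊤ : Partn 1 1) := by
  refine ext_compat fun x y => ?_
  refine Iff.trans ?_ (compat_tensorPartn_iff (k := n + 1) (l := n + 2) (k' := 1) (l' := 1)).symm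
  rw [compat_doublePartn_iff, compat_doublePartn_iff, compat_top_iff, Fin.forall_fin_succ',
    funext_iff, Fin.forall_fin_one]
  have e1 : ∀ j : Fin (n + 2), i.castSucc.predAbove j.castSucc = (i.predAbove j).castSucc :=
    fun j => Fin.castSucc_predAbove_castSucc i j
  have e2 : i.castSucc.predAbove (Fin.last (n + 2)) = Fin.last (n + 1) := by
    rw [← Fin.succ_last, Fin.predAbove_succ_of_le _ _ (Fin.le_last _)]
  simp only [e1, e2]
  exact and_congr Iff.rfl eq_comm

theorem IsLinearCategory.doublePartn_mem (hK : IsLinearCategory δ K) (hδ : δ ≠ 0)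
    (hb : block3 ∈ K 0 3) (n : ℕ) (i : Fin (n + 1)) :
    toPart (doublePartn n i) ∈ K (n + 1) (n + 2) := by
  have hb' := hK.bend_mem hδ (n := 2) hb
  induction n with
  | zero =>
    obtain rfl : i = Fin.last 0 := Fin.ext (by omega)
    rw [doublePartn_last]
    exact hK.tensorPartn_mem (hK.idPartn_mem hδ 0) hb'
  | succ n ih =>
    induction i using Fin.lastCases with
    | last =>
      rw [doublePartn_last]
      exact hK.tensorPartn_mem (hK.idPartn_mem hδ _) hb'
    | cast i =>
      rw [doublePartn_castSucc]
      exact hK.tensorPartn_mem (ih i) hK.id_mem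

/-- A partition with two neighbouring lower points in one block arises by doubling a point. -/
theorem doublePartn_comp {p : Partn k (n + 2)} {i : Fin (n + 1)}
    (h : p (Sum.inr i.castSucc) (Sum.inr i.succ)) :
    compPartn (doublePartn n i) (Setoid.comap (Sum.map id i.castSucc.succAbove) p) = p := by
  have hgf : ∀ j : Fin (n + 2),
      p (Sum.inr j) (Sum.inr (i.castSucc.succAbove (i.predAbove j))) := by
    intro j
    rcases Fin.eq_self_or_eq_succAbove i.castSucc j with rfl | ⟨c, rfl⟩
    · rw [Fin.predAbove_castSucc_self, Fin.succAbove_castSucc_self]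
      exact h
    · rw [Fin.predAbove_succAbove]
  have hcomp : ∀ a : Fin k ⊕ Fin (n + 2),
      p a (Sum.map id i.castSucc.succAbove (Sum.map id i.predAbove a)) := by
    rintro (a | a)
    · exact p.refl' _
    · exact hgf a
  refine compPartn_eq fun x z => ?_
  constructor
  · intro hc
    refine ⟨fun j => z (i.castSucc.succAbove j), ?_, compat_doublePartn_iff.2 fun j => hc (hgf j)⟩
    intro a b hab
    have := hc hab
    rw [Setoid.ker_def] at this ⊢
    rcases a with a | a <;> rcases b with b | b <;> exact this
  · rintro ⟨y, h1, h2⟩ a b hab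
    rw [compat_doublePartn_iff] at h2
    have h3 := @h1 (Sum.map id i.predAbove a) (Sum.map id i.predAbove b)
      (p.trans' (p.symm' (hcomp a)) (p.trans' hab (hcomp b)))
    have e : ∀ a, Sum.elim x z a = Sum.elim x y (Sum.map id i.predAbove a) := by
      rintro (a | a)
      · rfl
      · exact h2 a
    rw [Setoid.ker_def] at h3 ⊢
    rw [e, e, h3]

/-- A partition in which the last upper and the last lower point lie in one block arises by
doubling the last upper point. -/
theorem comp_doublePartn_last {p : Partn (k + 1) (l + 1)}
    (h : p (Sum.inl (Fin.last k)) (Sum.inr (Fin.last l))) :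
    compPartn (tensorPartn (Setoid.comap (Sum.map id Fin.castSucc) p : Partn (k + 1) l)
      (⊤ : Partn 1 1)) (doublePartn k (Fin.last k)) = p := by
  refine compPartn_eq fun x z => ?_
  have e1 : ∀ j : Fin (k + 1), (Fin.last k).predAbove j.castSucc = j := fun j => by
    rw [Fin.predAbove_castSucc_of_le _ _ (Fin.le_last j)]
  have e2 : (Fin.last k).predAbove (Fin.last (k + 1)) = Fin.last k := by
    rw [← Fin.succ_last, Fin.predAbove_succ_self]
  have e3 : ∀ y : Fin (k + 2) → Bool, Compat (tensorPartn
      (Setoid.comap (Sum.map id Fin.castSucc) p : Partn (k + 1) l) (⊤ : Partn 1 1)) y z ↔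
      Compat (Setoid.comap (Sum.map id Fin.castSucc) p : Partn (k + 1) l)
        (fun j => y j.castSucc) (fun j => z j.castSucc) ∧
      y (Fin.last (k + 1)) = z (Fin.last l) := by
    intro y
    refine (compat_tensorPartn_iff (k := k + 1) (l := l) (k' := 1) (l' := 1)).trans ?_
    rw [compat_top_iff, funext_iff, Fin.forall_fin_one]
    rfl
  simp only [e3, compat_doublePartn_iff]
  constructor
  · intro hc
    refine ⟨fun j => x ((Fin.last k).predAbove j), fun j => rfl, ?_, ?_⟩
    · simp only [e1]
      intro a b hab
      have := hc hab
      rw [Setoid.ker_def] at this ⊢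
      rcases a with a | a <;> rcases b with b | b <;> exact this
    · simp only [e2]
      exact hc h
  · rintro ⟨y, h1, h2, h3⟩ 
    obtain rfl : y = fun j => x ((Fin.last k).predAbove j) := funext h1
    simp only [e1, e2] at h2 h3
    -- Move the last lower point to the last upper point, which lies in the same block.
    let r : Fin (k + 1) ⊕ Fin (l + 1) → Fin (k + 1) ⊕ Fin l :=
      Sum.elim Sum.inl (Fin.lastCases (Sum.inl (Fin.last k)) Sum.inr)
    have hr : ∀ a, p a (Sum.map id Fin.castSucc (r a)) ∧ Sum.elim x z a =
        Sum.elim x (fun j => z j.castSucc) (r a) := by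
      rintro (a | a)
      · exact ⟨p.refl' _, rfl⟩
      · induction a using Fin.lastCases with
        | last =>
          simp only [r, Sum.elim_inr, Fin.lastCases_last, Sum.map_inl, id, Sum.elim_inl]
          exact ⟨p.symm' h, h3.symm⟩
        | cast a =>
          simp only [r, Sum.elim_inr, Fin.lastCases_castSucc, Sum.map_inr]
          exact ⟨p.refl' _, trivial⟩
    intro a b hab
    rw [Setoid.ker_def, (hr a).2, (hr b).2]
    exact h2 (p.trans' (p.symm' (hr a).1) (p.trans' hab (hr b).1))

/-- A nonempty noncrossing partition has an isolated point or joins two neighbouring points. -/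
theorem IsNonCrossing.exists_isolated_or_adjacent {p : Partn k l} (hp : IsNonCrossing p)
    (hkl : 0 < k + l) : (∃ a, ∀ b, p a b → b = a) ∨
      ∃ a b : Fin k ⊕ Fin l, circlePos b = circlePos a + 1 ∧ p a b := by
  by_contra! hcon
  obtain ⟨h1, h2⟩ := hcon
  have hex : ∃ d, ∃ a b : Fin k ⊕ Fin l, circlePos a < circlePos b ∧ p a b ∧
      circlePos b - circlePos a = d := by
    obtain ⟨a, -⟩ := exists_circlePos_eq (k := k) (l := l) hkl
    obtain ⟨b, hab, hne⟩ := h1 a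
    rcases lt_or_gt_of_ne (circlePos_injective.ne hne) with h | h
    · exact ⟨_, b, a, h, p.symm' hab, rfl⟩
    · exact ⟨_, a, b, h, hab, rfl⟩
  classical
  obtain ⟨a, b, hab, hpab, hd⟩ := Nat.find_spec hex
  have hmin : ∀ a' b' : Fin k ⊕ Fin l, circlePos a' < circlePos b' → p a' b' →
      circlePos b - circlePos a ≤ circlePos b' - circlePos a' := fun a' b' h h' => by
    rw [hd]; exact Nat.find_min' hex ⟨a', b', h, h', rfl⟩
  have hb := circlePos_lt b
  have hne : circlePos b ≠ circlePos a + 1 := fun h => h2 a b h hpab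
  obtain ⟨c, hc⟩ := exists_circlePos_eq (k := k) (l := l) (n := circlePos a + 1) (by omega)
  obtain ⟨d, hcd, hdc⟩ := h1 c
  have hac : ¬ p a c := h2 a c hc
  rcases lt_trichotomy (circlePos d) (circlePos a) with h | h | h
  · exact hac (p.trans' (p.symm' (hp d a c b h (by omega) (by omega) (p.symm' hcd) hpab))
      (p.symm' hcd))
  · rw [circlePos_injective h] at hcd
    exact hac (p.symm' hcd)
  · have hdc' := circlePos_injective.ne hdc
    rcases lt_or_ge (circlePos b) (circlePos d) with h' | h'
    · exact hac (hp a c b d (by omega) (by omega) h' hpab hcd)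
    · have := hmin c d (by omega) hcd
      omega

theorem circlePos_map_succAbove (i : Fin (n + 1)) (a b : Fin k ⊕ Fin n)
    (h : circlePos a < circlePos b) :
    circlePos (Sum.map id i.succAbove a : Fin k ⊕ Fin (n + 1)) <
      circlePos (Sum.map id i.succAbove b : Fin k ⊕ Fin (n + 1)) := by
  rcases a with a | a <;> rcases b with b | b
  · exact h
  · simp only [Sum.map_inl, Sum.map_inr, id, circlePos_inl, circlePos_inr] at h ⊢
    omega
  · simp only [circlePos_inl, circlePos_inr] at h
    omega
  · simp only [Sum.map_inr, circlePos_inr] at h ⊢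
    have h' : b < a := by rw [Fin.lt_def]; omega
    have := Fin.lt_def.1 ((Fin.succAbove_lt_succAbove_iff (p := i)).2 h')
    have := (i.succAbove a).2
    omega

/-- Every linear category with the singleton and the three-block contains all noncrossing
partitions: remove isolated points and merge neighbours until no point is left. -/
theorem IsLinearCategory.toPart_mem_of_isNonCrossing (hK : IsLinearCategory δ K) (hδ : δ ≠ 0)
    (hs : singleton ∈ K 0 1) (hb : block3 ∈ K 0 3) (N : ℕ) :
    ∀ {k l : ℕ} (p : Partn k l), k + l = N → IsNonCrossing p → toPart p ∈ K k l := by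
  induction N with
  | zero =>
    intro k l p hN _
    obtain rfl : k = 0 := by omega
    obtain rfl : l = 0 := by omega
    exact hK.unit_mem hδ p
  | succ N ih =>
    have hisol : ∀ {k l : ℕ} (p : Partn k l), k + l = N + 1 → IsNonCrossing p →
        ∀ i, IsolatedLower p i → toPart p ∈ K k l := by
      intro k l p hN hp i hi
      obtain _ | l := l
      · exact i.elim0
      · exact hK.mem_of_isolatedLower hδ hs hi
          (ih _ (by omega) (hp.comap (circlePos_map_succAbove i)))
    have hadj : ∀ {k l : ℕ} (p : Partn k l), k + l = N + 1 → IsNonCrossing p →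
        ∀ i j : Fin l, (i : ℕ) = j + 1 → p (Sum.inr i) (Sum.inr j) → toPart p ∈ K k l := by
      intro k l p hN hp i j hij hpij
      obtain _ | _ | l := l
      · exact i.elim0
      · omega
      · obtain ⟨t, rfl⟩ : ∃ t : Fin (l + 1), j = t.castSucc := ⟨⟨j, by omega⟩, rfl⟩
        obtain rfl : i = t.succ := Fin.ext hij
        rw [← doublePartn_comp (p.symm' hpij)]
        exact hK.compPartn_mem hδ (hK.doublePartn_mem hδ hb l t)
          (ih _ (by omega) (hp.comap (circlePos_map_succAbove _)))
    intro k l p hN hp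
    rcases hp.exists_isolated_or_adjacent (by omega) with ⟨i | i, hi⟩ | ⟨i | i, j | j, hij, hpij⟩
    · refine hK.starPartn_mem_iff.1 (hisol (starPartn p) (by omega) hp.starPartn i fun b hb => ?_)
      have := hi b.swap hb
      rw [← Sum.swap_swap b, this]
      rfl
    · exact hisol p hN hp i hi
    · rw [circlePos_inl, circlePos_inl] at hij
      exact hK.starPartn_mem_iff.1 (hadj (starPartn p) (by omega) hp.starPartn j i hij
        (p.symm' hpij))
    · rw [circlePos_inl, circlePos_inr] at hij
      obtain _ | k := k
      · exact i.elim0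
      obtain _ | l := l
      · exact j.elim0
      obtain rfl : i = Fin.last k := Fin.ext (by rw [Fin.val_last]; omega)
      obtain rfl : j = Fin.last l := Fin.ext (by rw [Fin.val_last]; omega)
      rw [← comp_doublePartn_last hpij]
      refine hK.compPartn_mem hδ (hK.tensorPartn_mem (ih _ (by omega) (hp.comap ?_)) hK.id_mem)
        (hK.doublePartn_mem hδ hb k _)
      have := circlePos_map_succAbove (k := k + 1) (Fin.last l)
      rwa [Fin.succAbove_last] at this
    · rw [circlePos_inl, circlePos_inr] at hij
      omega
    · rw [circlePos_inr, circlePos_inr] at hij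
      exact hadj p hN hp i j (by omega) hpij

theorem IsLinearCategory.NCPart_le (hK : IsLinearCategory δ K) (hδ : δ ≠ 0)
    (hs : singleton ∈ K 0 1) (hb : block3 ∈ K 0 3) : NCPart ≤ K := by
  intro k l
  refine Submodule.span_le.2 ?_
  rintro _ ⟨p, hp, rfl⟩
  exact hK.toPart_mem_of_isNonCrossing hδ hs hb _ p rfl hp

end Generation

/-! ### The six categories -/

section Comparison

variable {k l : ℕ} {δ : ℂ} {K : Family}

theorem IsLinearCategory.tensor_singleton_singleton_mem (hK : IsLinearCategory δ K) (hδ : δ ≠ 0)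
    (h : abac ∈ K 0 4) : tensor singleton singleton ∈ K 0 2 := by
  have hc : toPart (starPartn (⊤ : Partn 0 2)) ∈ K 2 0 := hK.starPartn_mem (pair_eq ▸ hK.pair_mem)
  have h1 : toPart (compPartn (l := 4) (tensorPartn (starPartn (⊤ : Partn 0 2)) (idPartn 2))
      (Setoid.ker (Sum.elim Fin.elim0 ![0, 1, 0, 2]))) ∈ K 0 2 :=
    hK.compPartn_mem hδ (hK.tensorPartn_mem hc (hK.idPartn_mem hδ 2)) h
  have e : compPartn (l := 4) (tensorPartn (starPartn (⊤ : Partn 0 2)) (idPartn 2))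
      (Setoid.ker (Sum.elim Fin.elim0 ![0, 1, 0, 2])) = (⊥ : Partn 0 2) := by
    refine compPartn_eq fun x z => iff_of_true compat_bot ⟨![z 0, z 0, z 0, z 1], ?_, ?_⟩
    · rw [compat_word_iff]
      intro i j
      fin_cases i <;> fin_cases j <;> simp
    · refine (compat_tensorPartn_iff (k := 2) (l := 0) (k' := 2) (l' := 2)).2 ⟨?_, ?_⟩
      · rw [compat_starPartn_iff, compat_pair_iff]
        rfl
      · rw [compat_idPartn_iff, funext_iff, Fin.forall_fin_two]
        exact ⟨rfl, rfl⟩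
  rw [tensor_singleton_singleton, ← e]
  exact h1

theorem IsLinearCategory.abac_mem (hK : IsLinearCategory δ K) (hs : singleton ∈ K 0 1) :
    abac ∈ K 0 4 := by
  rw [← abac_eq δ]
  exact hK.comp_mem (hK.tensor_mem hK.id_mem (hK.tensor_mem (hK.tensor_mem hs hK.id_mem) hs))
    hK.pair_mem

theorem IsLinearCategory.singleton_mem_of_block3_mem (hK : IsLinearCategory δ K) (hδ : δ ≠ 0)
    (h : block3 ∈ K 0 3) : singleton ∈ K 0 1 := by
  have hc : toPart (starPartn (⊤ : Partn 0 2)) ∈ K 2 0 := hK.starPartn_mem (pair_eq ▸ hK.pair_mem)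
  have h1 : toPart (compPartn (l := 3) (tensorPartn (starPartn (⊤ : Partn 0 2)) (idPartn 1))
      (Setoid.ker (Sum.elim Fin.elim0 ![0, 0, 0]))) ∈ K 0 1 :=
    hK.compPartn_mem hδ (hK.tensorPartn_mem hc (hK.idPartn_mem hδ 1)) h
  have e : ∀ p : Partn 0 1, p = ⊥ := fun p => le_bot_iff.1 fun a b _ => by
    rcases a with a | a
    · exact a.elim0
    rcases b with b | b
    · exact b.elim0
    exact congrArg Sum.inr (Subsingleton.elim a b)
  rw [singleton_eq, ← e]
  exact h1

theorem IsLinearCategory.block3_mem_of_block4_mem (hK : IsLinearCategory δ K) (hδ : δ ≠ 0)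
    (hs : singleton ∈ K 0 1) (h : block4 ∈ K 0 4) : block3 ∈ K 0 3 := by
  have hc : cosingleton ∈ K 1 0 := invol_singleton ▸ hK.invol_mem hs
  have h1 : toPart (compPartn (l := 4) (tensorPartn (idPartn 3) (⊥ : Partn 1 0))
      (Setoid.ker (Sum.elim Fin.elim0 ![0, 0, 0, 0]))) ∈ K 0 3 :=
    hK.compPartn_mem hδ (hK.tensorPartn_mem (hK.idPartn_mem hδ 3) hc) h
  have e : compPartn (l := 4) (tensorPartn (idPartn 3) (⊥ : Partn 1 0))
      (Setoid.ker (Sum.elim Fin.elim0 ![0, 0, 0, 0])) =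
      (Setoid.ker (Sum.elim Fin.elim0 ![0, 0, 0]) : Partn 0 3) := by
    refine compPartn_eq fun x z => ?_
    have e1 : ∀ y : Fin 4 → Bool, Compat (tensorPartn (idPartn 3) (⊥ : Partn 1 0)) y z ↔
        y 0 = z 0 ∧ y 1 = z 1 ∧ y 2 = z 2 := fun y => by
      refine (compat_tensorPartn_iff (k := 3) (l := 3) (k' := 1) (l' := 0)).trans ?_
      rw [and_iff_left compat_bot, compat_idPartn_iff, funext_iff]
      simp only [Fin.forall_fin_succ, Fin.forall_fin_zero, and_true]
      rfl
    simp only [e1, compat_block3_iff, compat_block4_iff]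
    constructor
    · rintro ⟨h1, h2⟩
      exact ⟨![z 0, z 1, z 2, z 2], ⟨h1, h2, rfl⟩, rfl, rfl, rfl⟩
    · rintro ⟨y, ⟨h1, h2, -⟩, h3, h4, h5⟩
      exact ⟨by rw [← h3, ← h4, h1], by rw [← h4, ← h5, h2]⟩
  rw [block3_eq, ← e]
  exact h1

theorem IsEasy.toPart_mem (hK : IsEasy K) {x : Part k l} (hx : x ∈ K k l) {p : Partn k l}
    (hp : x p ≠ 0) : toPart p ∈ K k l := by
  obtain ⟨C, hC⟩ := hK k l
  rw [hC] at hx ⊢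
  have : x ∈ Finsupp.supported ℂ ℂ C := by
    rw [Finsupp.supported_eq_span_single]
    exact hx
  exact Submodule.subset_span ⟨p, (Finsupp.mem_supported ℂ x).1 this
    (Finsupp.mem_support_iff.2 hp), rfl⟩

theorem proj_block3_apply (δ : ℂ) :
    proj δ block3 (Setoid.ker (Sum.elim Fin.elim0 ![0, 0, 0])) = 1 := by
  refine proj_toPart_apply δ fun i hi => ?_
  have h : ∀ j, Sum.inr j = (Sum.inr i : Fin 0 ⊕ Fin 3) := fun j =>
    hi (Sum.inr j) (show ![0, 0, 0] i = ![0, 0, 0] j by clear hi; revert i j; decide)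
  exact absurd ((Sum.inr_injective (h 0)).trans (Sum.inr_injective (h 1)).symm) (by decide)

theorem proj_block4_apply (δ : ℂ) :
    proj δ block4 (Setoid.ker (Sum.elim Fin.elim0 ![0, 0, 0, 0])) = 1 := by
  refine proj_toPart_apply δ fun i hi => ?_
  have h : ∀ j, Sum.inr j = (Sum.inr i : Fin 0 ⊕ Fin 4) := fun j =>
    hi (Sum.inr j) (show ![0, 0, 0, 0] i = ![0, 0, 0, 0] j by clear hi; revert i j; decide)
  exact absurd ((Sum.inr_injective (h 0)).trans (Sum.inr_injective (h 1)).symm) (by decide)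

theorem IsEasy.block3_mem (hE : IsEasy K) (h : proj δ block3 ∈ K 0 3) : block3 ∈ K 0 3 :=
  hE.toPart_mem h (by rw [proj_block3_apply]; exact one_ne_zero)

theorem IsEasy.block4_mem (hE : IsEasy K) (h : proj δ block4 ∈ K 0 4) : block4 ∈ K 0 4 :=
  hE.toPart_mem h (by rw [proj_block4_apply]; exact one_ne_zero)

theorem singleton_ne_zero : singleton ≠ 0 := by
  rw [singleton_eq, toPart]
  exact Finsupp.single_ne_zero.2 one_ne_zero

theorem abac_notMem_generated {δ : ℝ} (hδ : δ ≠ 0) :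
    abac ∉ generated δ (proj δ block3) (tensor singleton singleton) 0 4 := fun h =>
  abac_notMem_alternating (Complex.ofReal_ne_zero.2 hδ)
    (generated_le (isLinearCategory_alternating hδ) (proj_block3_mem_alternating δ)
      (tensor_singleton_singleton_mem_alternating (Complex.ofReal_ne_zero.2 hδ)) _ _ h)

theorem singleton_notMem_generated {δ : ℝ} (hδ : δ ≠ 0) :
    singleton ∉ generated δ (proj δ block3) abac 0 1 := by
  intro h
  have hK := isLinearCategory_reflection hδ 1
  have h3 : proj δ block3 ∈ intertwiners δ (reflection δ 1) 0 3 :=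
    (proj_mem_intertwiners_reflection_iff hδ 1 _).2 (by simp)
  have ha : abac ∈ intertwiners δ (reflection δ 1) 0 4 := by
    rw [← abac_eq δ]
    exact hK.comp_mem (hK.tensor_mem hK.id_mem (flankedString_mem_intertwiners_reflection hδ 1))
      hK.pair_mem
  have h1 := (singleton_mem_intertwiners_reflection_iff hδ 1).1 (generated_le hK h3 ha _ _ h)
  rw [Units.val_one, Int.cast_one, neg_smul, one_smul, neg_eq_self] at h1
  exact singleton_ne_zero h1

theorem proj_block3_notMem_generated {δ : ℝ} (hδ : δ ≠ 0) :
    proj δ block3 ∉ generated δ (proj δ block4) singleton 0 3 := by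
  intro h
  have h4 : proj δ block4 ∈ intertwiners δ (reflection δ (-1)) 0 4 :=
    (proj_mem_intertwiners_reflection_iff hδ (-1) _).2 (by norm_num)
  have hs : singleton ∈ intertwiners δ (reflection δ (-1)) 0 1 :=
    (singleton_mem_intertwiners_reflection_iff hδ (-1)).2 (by simp)
  have h1 := (proj_mem_intertwiners_reflection_iff hδ (-1) _).1
    (generated_le (isLinearCategory_reflection hδ (-1)) h4 hs _ _ h)
  have h2 := DFunLike.congr_fun h1 (Setoid.ker (Sum.elim Fin.elim0 ![0, 0, 0]))
  rw [Finsupp.smul_apply, proj_block3_apply] at h2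
  norm_num at h2

theorem generated_lt {k l k' l' m n : ℕ} {x : Part k l} {y : Part k' l'} (hK : IsLinearCategory δ K)
    (hx : x ∈ K k l) (hy : y ∈ K k' l') {z : Part m n} (hz : z ∈ K m n)
    (hz' : z ∉ generated δ x y m n) : generated δ x y < K :=
  lt_of_le_of_ne (generated_le hK hx hy) fun h => hz' (h ▸ hz)

end Comparison

end PartCat

end
theorem propositionP (δ : ℝ) (hδ : δ ≠ 0) :
    let A₁ := PartCat.generated δ (PartCat.proj δ PartCat.block3)
      (PartCat.tensor PartCat.singleton PartCat.singleton)
    let A₂ := PartCat.generated δ (PartCat.proj δ PartCat.block3) PartCat.abac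
    let A₃ := PartCat.generated δ (PartCat.proj δ PartCat.block3) PartCat.singleton
    let B₁ := PartCat.generated δ (PartCat.proj δ PartCat.block4)
      (PartCat.tensor PartCat.singleton PartCat.singleton)
    let B₂ := PartCat.generated δ (PartCat.proj δ PartCat.block4) PartCat.abac
    let B₃ := PartCat.generated δ (PartCat.proj δ PartCat.block4) PartCat.singleton
    (A₁ < A₂ ∧ A₂ < A₃) ∧ (B₁ < B₂ ∧ B₂ < B₃) ∧
    (B₁ < A₁ ∧ B₂ < A₂ ∧ B₃ < A₃) ∧
    [A₁, A₂, A₃, B₁, B₂, B₃].Nodup ∧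
    (A₃ = PartCat.NCPart ∧ PartCat.IsEasy A₃) ∧
    (¬ PartCat.IsEasy A₁ ∧ ¬ PartCat.IsEasy A₂ ∧ ¬ PartCat.IsEasy B₁ ∧
      ¬ PartCat.IsEasy B₂ ∧ ¬ PartCat.IsEasy B₃) := by
  intro A₁ A₂ A₃ B₁ B₂ B₃
  have hδ' : (δ : ℂ) ≠ 0 := Complex.ofReal_ne_zero.2 hδ
  have hA₁ : PartCat.IsLinearCategory δ A₁ := PartCat.isLinearCategory_generated _ _ _
  have hA₂ : PartCat.IsLinearCategory δ A₂ := PartCat.isLinearCategory_generated _ _ _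
  have hA₃ : PartCat.IsLinearCategory δ A₃ := PartCat.isLinearCategory_generated _ _ _
  have hB₁ : PartCat.IsLinearCategory δ B₁ := PartCat.isLinearCategory_generated _ _ _
  have hB₂ : PartCat.IsLinearCategory δ B₂ := PartCat.isLinearCategory_generated _ _ _
  have hB₃ : PartCat.IsLinearCategory δ B₃ := PartCat.isLinearCategory_generated _ _ _
  have p₁ : PartCat.proj δ PartCat.block3 ∈ A₁ 0 3 := PartCat.left_mem_generated _ _
  have p₂ : PartCat.proj δ PartCat.block3 ∈ A₂ 0 3 := PartCat.left_mem_generated _ _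
  have p₃ : PartCat.proj δ PartCat.block3 ∈ A₃ 0 3 := PartCat.left_mem_generated _ _
  have q₁ : PartCat.proj δ PartCat.block4 ∈ B₁ 0 4 := PartCat.left_mem_generated _ _
  have q₂ : PartCat.proj δ PartCat.block4 ∈ B₂ 0 4 := PartCat.left_mem_generated _ _
  have q₃ : PartCat.proj δ PartCat.block4 ∈ B₃ 0 4 := PartCat.left_mem_generated _ _
  have aA₂ : PartCat.abac ∈ A₂ 0 4 := PartCat.right_mem_generated _ _
  have aB₂ : PartCat.abac ∈ B₂ 0 4 := PartCat.right_mem_generated _ _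
  have sA₃ : PartCat.singleton ∈ A₃ 0 1 := PartCat.right_mem_generated _ _
  have sB₃ : PartCat.singleton ∈ B₃ 0 1 := PartCat.right_mem_generated _ _
  have ssA₁ : PartCat.tensor PartCat.singleton PartCat.singleton ∈ A₁ 0 2 :=
    PartCat.right_mem_generated _ _
  have ssA₂ := hA₂.tensor_singleton_singleton_mem hδ' aA₂
  have ssB₂ := hB₂.tensor_singleton_singleton_mem hδ' aB₂
  have b₁ := hA₁.proj_block4_mem hδ (hA₁.disconnecter_mem hδ' ssA₁) p₁
  have b₂ := hA₂.proj_block4_mem hδ (hA₂.disconnecter_mem hδ' ssA₂) p₂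
  have b₃ := hA₃.proj_block4_mem hδ
    (hA₃.disconnecter_mem hδ' (hA₃.tensor_mem sA₃ sA₃)) p₃
  have aA₁ : PartCat.abac ∉ A₁ 0 4 := PartCat.abac_notMem_generated hδ
  have sA₂ : PartCat.singleton ∉ A₂ 0 1 := PartCat.singleton_notMem_generated hδ
  have pB₃ : PartCat.proj δ PartCat.block3 ∉ B₃ 0 3 := PartCat.proj_block3_notMem_generated hδ
  have leB₁ : B₁ ≤ A₁ := PartCat.generated_le hA₁ b₁ ssA₁
  have leB₂ : B₂ ≤ A₂ := PartCat.generated_le hA₂ b₂ aA₂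
  have ltA₁ : A₁ < A₂ := PartCat.generated_lt hA₂ p₂ ssA₂ aA₂ aA₁
  have ltA₂ : A₂ < A₃ := PartCat.generated_lt hA₃ p₃ (hA₃.abac_mem sA₃) sA₃ sA₂
  have ltB₁ : B₁ < B₂ := PartCat.generated_lt hB₂ q₂ ssB₂ aB₂ fun h => aA₁ (leB₁ _ _ h)
  have ltB₂ : B₂ < B₃ := PartCat.generated_lt hB₃ q₃ (hB₃.abac_mem sB₃) sB₃
    fun h => sA₂ (leB₂ _ _ h)
  have pB₂ : PartCat.proj δ PartCat.block3 ∉ B₂ 0 3 := fun h => pB₃ (ltB₂.le _ _ h)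
  have pB₁ : PartCat.proj δ PartCat.block3 ∉ B₁ 0 3 := fun h => pB₂ (ltB₁.le _ _ h)
  have bA₃ : PartCat.block3 ∈ A₃ 0 3 := (hA₃.proj_mem_iff hδ' sA₃ _).1 p₃
  have hNC := PartCat.isLinearCategory_NCPart δ
  have eA₃ : A₃ = PartCat.NCPart := by
    refine le_antisymm (PartCat.generated_le hNC (hNC.proj_mem hδ' ?_ ?_) ?_)
      (hA₃.NCPart_le hδ' sA₃ bA₃)
    all_goals exact PartCat.toPart_mem_NCPart (PartCat.isNonCrossing_of_le_three (by norm_num))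
  have nA₂ : PartCat.block3 ∉ A₂ 0 3 := fun h => sA₂ (hA₂.singleton_mem_of_block3_mem hδ' h)
  have nB₃ : PartCat.block4 ∉ B₃ 0 4 := fun h => pB₃
    ((hB₃.proj_mem_iff hδ' sB₃ _).2 (hB₃.block3_mem_of_block4_mem hδ' sB₃ h))
  refine ⟨⟨ltA₁, ltA₂⟩, ⟨ltB₁, ltB₂⟩, ⟨PartCat.generated_lt hA₁ b₁ ssA₁ p₁ pB₁,
    PartCat.generated_lt hA₂ b₂ aA₂ p₂ pB₂, PartCat.generated_lt hA₃ b₃ sA₃ p₃ pB₃⟩, ?_,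
    ⟨eA₃, eA₃ ▸ fun k l => ⟨_, rfl⟩⟩, fun h => nA₂ (ltA₁.le _ _ (h.block3_mem p₁)),
    fun h => nA₂ (h.block3_mem p₂),
    fun h => nB₃ ((ltB₁.trans ltB₂).le _ _ (h.block4_mem q₁)),
    fun h => nB₃ (ltB₂.le _ _ (h.block4_mem q₂)), fun h => nB₃ (h.block4_mem q₃)⟩
  have ne : ∀ {A B : PartCat.Family}, PartCat.proj δ PartCat.block3 ∈ A 0 3 →
      PartCat.proj δ PartCat.block3 ∉ B 0 3 → A ≠ B := fun h h' e => h' (e ▸ h)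
  simp only [List.nodup_cons, List.mem_cons, List.not_mem_nil, or_false, not_or,
    not_false_eq_true, List.nodup_nil, and_true]
  exact ⟨⟨ltA₁.ne, (ltA₁.trans ltA₂).ne, ne p₁ pB₁, ne p₁ pB₂, ne p₁ pB₃⟩,
    ⟨ltA₂.ne, ne p₂ pB₁, ne p₂ pB₂, ne p₂ pB₃⟩, ⟨ne p₃ pB₁, ne p₃ pB₂, ne p₃ pB₃⟩,
    ⟨ltB₁.ne, (ltB₁.trans ltB₂).ne⟩, ltB₂.ne⟩
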